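/- Let $X$ be a compact (Hausdorff) smooth $n$-dimensional manifold with corners, $\pi:W\to X$ a smooth real vector bundle of rank $m$, and $r\ge 0$ an integer. A body $R\subseteq X$ is a compact $n$-dimensional submanifold with corners ($R=X$ is allowed; the other bodies are called sub-bodies). $C^r(W|_R)$ denotes the space of $C^r$-sections of $W$ over $R$ with the $C^r$-norm of a precompact atlas: finitely many vector bundle charts $(U_i,\varphi_i,\Phi_i)$ and compact sets $K_i\subset U_i\cap R$ whose interiors relative to $R$ cover $R$, with $\|w\|^r=\sup\{|\partial_I w_i^\alpha(\varphi_i(x))| : i,\ \alpha\le m,\ |I|\le r,\ x\in K_i\}$. A force on $R$ is a continuous linear functional $F\in C^r(W|_R)^*$. Let $J^rW$ be the $r$-jet bundle and $\hat J^rW$ the iterated (non-holonomic) jet bundle, $\hat J^0W=W$, $\hat J^{r+1}W=J^1(\hat J^{r}W)$, with the jet extensions $j^r$ and $\hat\jmath^{\,r}=j^1\circ\hat\jmath^{\,r-1}$ of $C^r$-sections. Let $E$ be $J^rW$ or $\hat J^rW$, of rank $N$. A vector-valued Radon measure $\varsigma$ acting on sections of $E$ is a family that assigns to every vector bundle chart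 $a=(U_a,\varphi_a,\Phi_a)$ of $W$ an $N$-tuple $(\varsigma_{a,c})_{c}$ of real (signed, locally finite) Radon measures on $\varphi_a(U_a)$, one for each local component of $E$, such that $\sum_c\int\chi_a^c\,d\varsigma_{a,c}=\sum_c\int\chi_b^c\,d\varsigma_{b,c}$ for all charts $a,b$ and every continuous section $\chi$ of $E$ supported in $U_a\cap U_b$. It is called a hyper-stress measure for $E=J^rW$ and a non-holonomic stress measure for $E=\hat J^rW$. For a body $R$ and a continuous section $\chi$ of $E$ over $R$, put $$\int_R\chi\cdot d\varsigma:=\sum_{a}\sum_c\int_{\varphi_a(U_a\cap R)}u_a\,\chi_a^c\,d\varsigma_{a,c},$$ where $(u_a)$ is a partition of unity subordinate to a finite vector bundle atlas. Then: 1. For all hyper-stress measures $\varsigma$ and non-holonomic stress measures $\hat\varsigma$, all the integrals above exist and their sum does not depend on the atlas and the partition of unity. For every body $R$, $F_R(w)=\int_R j^rw\cdot d\varsigma$, respectively $F_R(w)=\int_R\hat\jmath^{\,r}w\cdot d\hat\varsigma$, $w\in C^r(W|_R)$, is a force on $R$; thus each stress measure induces a force system $R\mapsto F_R$. 2. For every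 force $F\in C^r(W)^*$ there are a hyper-stress measure $\varsigma$ and a non-holonomic stress measure $\hat\varsigma$ such that $$F(w)=\int_X j^rw\cdot d\varsigma=\int_X\hat\jmath^{\,r}w\cdot d\hat\varsigma\qquad\text{for all } w\in C^r(W),$$ and such that both induce the same force system, $F_R(w)=\int_R j^rw\cdot d\varsigma=\int_R\hat\jmath^{\,r}w\cdot d\hat\varsigma$ for every body $R$ and every $w\in C^r(W|_R)$. 3. If $r\ge1$, $n\ge1$, $m\ge1$ and $X\ne\emptyset$, the representing measures are not unique: for every hyper-stress measure representing $F$ there is a different one representing $F$, and likewise for non-holonomic stress measures. -/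

import Mathlib

open scoped Manifold ContDiff Topology
open Bundle MeasureTheory Set

universe u

noncomputable section

namespace GlobalStress

/-- The model with corners of `n`-dimensional manifolds with corners: the closed quadrant
`{y ∈ ℝⁿ | 0 ≤ yⁱ for all i}` in `ℝⁿ`. -/
abbrev quadrant (n : ℕ) :
    ModelWithCorners ℝ (EuclideanSpace ℝ (Fin n)) (EuclideanQuadrant n) :=
  modelWithCornersEuclideanQuadrant n

section Bodies

/-- A (sub-)body of the `n`-dimensional manifold with corners `X`: a compact subset which is an
`n`-dimensional submanifold with corners. Near the image of each of its points under a chart `φ`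
of `X`, it is mapped by a local diffeomorphism `ψ` of `ℝⁿ` to the closed quadrant. -/
structure Body (n : ℕ) (X : Type u) [TopologicalSpace X]
    [ChartedSpace (EuclideanQuadrant n) X] where
  carrier : Set X
  isCompact : IsCompact carrier
  locally_quadrant : ∀ x ∈ carrier,
    ∃ φ ∈ IsManifold.maximalAtlas (quadrant n) ∞ X, x ∈ φ.source ∧
      ∃ ψ : OpenPartialHomeomorph (EuclideanSpace ℝ (Fin n)) (EuclideanSpace ℝ (Fin n)),
        ContDiffOn ℝ ∞ ψ ψ.source ∧ ContDiffOn ℝ ∞ ψ.symm ψ.target ∧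
        φ.extend (quadrant n) x ∈ ψ.source ∧
        ∀ y ∈ ψ.source,
          (y ∈ φ.extend (quadrant n) '' (φ.source ∩ carrier) ↔ ∀ i, 0 ≤ ψ y i)

variable {n : ℕ} {X : Type u} [TopologicalSpace X] [ChartedSpace (EuclideanQuadrant n) X]

/-- The whole compact manifold with corners, as a body. -/
def Body.whole (n : ℕ) (X : Type u) [TopologicalSpace X] [ChartedSpace (EuclideanQuadrant n) X]
    [CompactSpace X] [IsManifold (quadrant n) ∞ X] : Body n X where
  carrier := univ
  isCompact := isCompact_univ
  locally_quadrant := by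
    intro x _
    refine ⟨chartAt (EuclideanQuadrant n) x, IsManifold.chart_mem_maximalAtlas x,
      mem_chart_source _ x, ?_⟩
    obtain ⟨V, hV, hVe⟩ := isOpen_induced_iff.1 (chartAt (EuclideanQuadrant n) x).open_target
    refine ⟨OpenPartialHomeomorph.ofSet V hV, contDiffOn_id, contDiffOn_id, ?_, ?_⟩
    · have : chartAt (EuclideanQuadrant n) x x ∈ (chartAt (EuclideanQuadrant n) x).target :=
        mem_chart_target _ x
      rw [← hVe] at this
      exact this
    · intro y hy
      constructor
      · rintro ⟨z, -, rfl⟩ i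
        exact (chartAt (EuclideanQuadrant n) x z).2 i
      · intro h
        have h1 : (⟨y, h⟩ : EuclideanQuadrant n) ∈ (chartAt (EuclideanQuadrant n) x).target := by
          rw [← hVe]; exact hy
        refine ⟨(chartAt (EuclideanQuadrant n) x).symm ⟨y, h⟩,
          ⟨(chartAt (EuclideanQuadrant n) x).map_target h1, mem_univ _⟩, ?_⟩
        change ((chartAt (EuclideanQuadrant n) x)
          ((chartAt (EuclideanQuadrant n) x).symm ⟨y, h⟩)).1 = y
        rw [(chartAt (EuclideanQuadrant n) x).right_inv h1]

end Bodies

section Charts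

variable (n m : ℕ) {X : Type u} [TopologicalSpace X] [ChartedSpace (EuclideanQuadrant n) X]
  (W : X → Type u) [∀ x, AddCommGroup (W x)] [∀ x, Module ℝ (W x)]
  [TopologicalSpace (TotalSpace (EuclideanSpace ℝ (Fin m)) W)] [∀ x, TopologicalSpace (W x)]
  [FiberBundle (EuclideanSpace ℝ (Fin m)) W]

/-- A smooth vector bundle chart `(U, φ, Φ)` of `W → X`: a chart `φ` of the maximal smooth atlas
of `X` together with a fibrewise linear smooth trivialization of `W`. -/
structure VBChart where
  chart : OpenPartialHomeomorph X (EuclideanQuadrant n)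
  chart_mem : chart ∈ IsManifold.maximalAtlas (quadrant n) ∞ X
  triv : Trivialization (EuclideanSpace ℝ (Fin m))
    (TotalSpace.proj : TotalSpace (EuclideanSpace ℝ (Fin m)) W → X)
  isLinear : triv.IsLinear ℝ
  contMDiffOn_triv :
    ContMDiffOn ((quadrant n).prod 𝓘(ℝ, EuclideanSpace ℝ (Fin m)))
      ((quadrant n).prod 𝓘(ℝ, EuclideanSpace ℝ (Fin m))) ∞ triv triv.source
  contMDiffOn_triv_symm :
    ContMDiffOn ((quadrant n).prod 𝓘(ℝ, EuclideanSpace ℝ (Fin m)))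
      ((quadrant n).prod 𝓘(ℝ, EuclideanSpace ℝ (Fin m))) ∞ triv.toOpenPartialHomeomorph.symm
      triv.target

namespace VBChart

variable {n m} {W}

/-- The domain `U ⊆ X` of the vector bundle chart. -/
def dom (a : VBChart n m W) : Set X := a.chart.source ∩ a.triv.baseSet

/-- The coordinate map `φ : X → ℝⁿ` (meaningful on `U`). -/
def ext (a : VBChart n m W) : X → EuclideanSpace ℝ (Fin n) := a.chart.extend (quadrant n)

/-- The inverse coordinate map `φ⁻¹` (meaningful on `φ(U)`). -/
def inv (a : VBChart n m W) : EuclideanSpace ℝ (Fin n) → X := (a.chart.extend (quadrant n)).symm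

/-- The set `φ(U ∩ R) ⊆ ℝⁿ`. -/
def img (a : VBChart n m W) (R : Set X) : Set (EuclideanSpace ℝ (Fin n)) :=
  a.ext '' (a.dom ∩ R)

theorem inv_ext (a : VBChart n m W) {x : X} (hx : x ∈ a.dom) : a.inv (a.ext x) = x :=
  a.chart.extend_left_inv hx.1

theorem isOpen_dom (a : VBChart n m W) : IsOpen a.dom :=
  a.chart.open_source.inter a.triv.open_baseSet

variable (n m W) in
/-- A vector bundle chart around a given point. -/
def atPoint [IsManifold (quadrant n) ∞ X] [VectorBundle ℝ (EuclideanSpace ℝ (Fin m)) W]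
    [ContMDiffVectorBundle ∞ (EuclideanSpace ℝ (Fin m)) W (quadrant n)] (x : X) :
    VBChart n m W where
  chart := chartAt (EuclideanQuadrant n) x
  chart_mem := IsManifold.chart_mem_maximalAtlas x
  triv := trivializationAt (EuclideanSpace ℝ (Fin m)) W x
  isLinear := inferInstance
  contMDiffOn_triv := Trivialization.contMDiffOn _
  contMDiffOn_triv_symm := Trivialization.contMDiffOn_symm _

theorem mem_dom_atPoint [IsManifold (quadrant n) ∞ X]
    [VectorBundle ℝ (EuclideanSpace ℝ (Fin m)) W]
    [ContMDiffVectorBundle ∞ (EuclideanSpace ℝ (Fin m)) W (quadrant n)] (x : X) :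
    x ∈ (atPoint n m W x).dom :=
  ⟨mem_chart_source _ x, FiberBundle.mem_baseSet_trivializationAt' x⟩

/-- The chart image of a body has unique derivatives. -/
theorem uniqueDiffOn_img (a : VBChart n m W) (R : Body n X) : 
    UniqueDiffOn ℝ (a.img R.carrier) := by
  rintro _ ⟨x, ⟨hxd, hxR⟩, rfl⟩
  obtain ⟨φ, hφ, hxφ, ψ, hψ, hψs, hxψ, hiff⟩ := R.locally_quadrant x hxR
  have hI : ∀ z, φ.extend (quadrant n) z ∈ range (quadrant n) := fun z => ⟨φ z, rfl⟩
  have hIa : ∀ z, a.ext z ∈ range (quadrant n) := fun z => ⟨a.chart z, rfl⟩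
  -- a neighbourhood of `x` adapted to both charts
  obtain ⟨U, hUo, hxU, hUsub⟩ : ∃ U : Set X, IsOpen U ∧ x ∈ U ∧
      ∀ z ∈ U, z ∈ a.dom ∧ z ∈ φ.source ∧ φ.extend (quadrant n) z ∈ ψ.source := by
    have h1 : ∀ᶠ z in 𝓝 x, φ.extend (quadrant n) z ∈ ψ.source :=
      (φ.continuousAt_extend hxφ).eventually (ψ.open_source.mem_nhds hxψ)
    have h2 : ∀ᶠ z in 𝓝 x, z ∈ a.dom := a.isOpen_dom.mem_nhds hxd
    have h3 : ∀ᶠ z in 𝓝 x, z ∈ φ.source := φ.open_source.mem_nhds hxφ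
    obtain ⟨U, hU, hUo, hxU⟩ := eventually_nhds_iff.1 (h2.and (h3.and h1))
    exact ⟨U, hUo, hxU, hU⟩
  set g : EuclideanSpace ℝ (Fin n) → EuclideanSpace ℝ (Fin n) :=
    fun z => a.ext ((φ.extend (quadrant n)).symm (ψ.symm z)) with hg
  set h : EuclideanSpace ℝ (Fin n) → EuclideanSpace ℝ (Fin n) :=
    fun y => ψ (φ.extend (quadrant n) (a.inv y)) with hh
  set Q : Set (EuclideanSpace ℝ (Fin n)) := {z | ∀ i, 0 ≤ z i} with hQ
  set z0 := ψ (φ.extend (quadrant n) x) with hz0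
  set Q' : Set (EuclideanSpace ℝ (Fin n)) :=
    (fun z => ψ (φ.extend (quadrant n) z)) '' (U ∩ R.carrier) with hQ'
  have hgz : ∀ z ∈ U, g (ψ (φ.extend (quadrant n) z)) = a.ext z := by
    intro z hz
    simp only [hg]
    rw [ψ.left_inv (hUsub z hz).2.2, φ.extend_left_inv (hUsub z hz).2.1]
  have hhz : ∀ z ∈ U, h (a.ext z) = ψ (φ.extend (quadrant n) z) := by
    intro z hz
    simp only [hh]
    rw [a.inv_ext (hUsub z hz).1]
  have hz0Q' : z0 ∈ Q' := ⟨x, ⟨hxU, hxR⟩, rfl⟩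
  have hQ'Q : Q' ⊆ Q := by
    rintro _ ⟨z, ⟨hzU, hzR⟩, rfl⟩
    exact (hiff _ (hUsub z hzU).2.2).1 ⟨z, ⟨(hUsub z hzU).2.1, hzR⟩, rfl⟩
  have hz0t : z0 ∈ ψ.target := ψ.map_source hxψ
  have hsymz0 : ψ.symm z0 = φ.extend (quadrant n) x := ψ.left_inv hxψ
  have hQ'n : Q' ∈ 𝓝[Q] z0 := by
    have h1 : ∀ᶠ z in 𝓝 z0, z ∈ ψ.target := ψ.open_target.mem_nhds hz0t
    have h2 : ∀ᶠ z in 𝓝 z0, (φ.extend (quadrant n)).symm (ψ.symm z) ∈ U := by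
      have hc : ContinuousAt (fun z => (φ.extend (quadrant n)).symm (ψ.symm z)) z0 := by
        refine ContinuousAt.comp (g := (φ.extend (quadrant n)).symm) ?_
          (ψ.continuousAt_symm hz0t)
        rw [hsymz0]
        exact φ.continuousAt_extend_symm hxφ
      refine hc.eventually (hUo.mem_nhds ?_)
      simp only []
      rw [hsymz0, φ.extend_left_inv hxφ]
      exact hxU
    filter_upwards [mem_nhdsWithin_of_mem_nhds h1, mem_nhdsWithin_of_mem_nhds h2,
      self_mem_nhdsWithin] with z hz1 hz2 hz3
    have hz4 : ψ.symm z ∈ ψ.source := ψ.map_target hz1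
    obtain ⟨w, ⟨hwφ, hwR⟩, hw⟩ := (hiff _ hz4).2 (by rw [ψ.right_inv hz1]; exact hz3)
    have hz2' := hz2
    rw [← hw, φ.extend_left_inv hwφ] at hz2'
    exact ⟨w, ⟨hz2', hwR⟩, by simp only [hw]; exact ψ.right_inv hz1⟩
  have hQu : UniqueDiffOn ℝ Q := by
    refine uniqueDiffOn_convex EuclideanQuadrant.convex ?_
    rw [interior_euclideanQuadrant]
    exact ⟨WithLp.toLp 2 fun _ => 1, by simp⟩
  have hQ'u : UniqueDiffWithinAt ℝ Q' z0 := by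
    refine (uniqueDiffWithinAt_congr ?_).1 (hQu z0 (hQ'Q hz0Q'))
    exact le_antisymm (nhdsWithin_le_of_mem hQ'n) (nhdsWithin_mono _ hQ'Q)
  have hgS : g '' Q' ⊆ a.img R.carrier := by
    rintro _ ⟨_, ⟨z, ⟨hzU, hzR⟩, rfl⟩, rfl⟩
    exact ⟨z, ⟨(hUsub z hzU).1, hzR⟩, (hgz z hzU).symm⟩
  -- differentiability of the two mutually inverse maps
  have hgd : DifferentiableWithinAt ℝ g Q' z0 := by
    have h1 : DifferentiableWithinAt ℝ ((quadrant n).extendCoordChange φ a.chart)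
        (range (quadrant n)) (φ.extend (quadrant n) x) :=
      ((quadrant n).contDiffWithinAt_extendCoordChange' hφ a.chart_mem hxφ
        hxd.1).differentiableWithinAt (by simp)
    have h2 : DifferentiableWithinAt ℝ ψ.symm Q' z0 :=
      ((hψs z0 hz0t).contDiffAt (ψ.open_target.mem_nhds hz0t)).differentiableAt
        (by simp) |>.differentiableWithinAt
    rw [← hsymz0] at h1
    refine h1.comp z0 h2 ?_
    rintro _ ⟨z, ⟨hzU, hzR⟩, rfl⟩
    change ψ.symm (ψ _) ∈ _
    rw [ψ.left_inv (hUsub z hzU).2.2]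
    exact hI z
  have hgz0 : g z0 = a.ext x := hgz x hxU
  have hhd : DifferentiableWithinAt ℝ h (g '' Q') (g z0) := by
    rw [hgz0]
    have h1 : DifferentiableWithinAt ℝ ((quadrant n).extendCoordChange a.chart φ)
        (range (quadrant n)) (a.ext x) :=
      ((quadrant n).contDiffWithinAt_extendCoordChange' a.chart_mem hφ hxd.1
        hxφ).differentiableWithinAt (by simp)
    have h2 : DifferentiableAt ℝ ψ (((quadrant n).extendCoordChange a.chart φ) (a.ext x)) := by
      have h3 : ((quadrant n).extendCoordChange a.chart φ) (a.ext x)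
          = φ.extend (quadrant n) x := by
        change φ.extend (quadrant n) (a.inv (a.ext x)) = _
        rw [a.inv_ext hxd]
      rw [h3]
      exact ((hψ _ hxψ).contDiffAt (ψ.open_source.mem_nhds hxψ)).differentiableAt (by simp)
    refine h2.comp_differentiableWithinAt (a.ext x) (h1.mono ?_)
    rintro _ ⟨_, ⟨z, ⟨hzU, hzR⟩, rfl⟩, rfl⟩
    rw [hgz z hzU]
    exact hIa z
  have hcomp : HasFDerivWithinAt (h ∘ g)
      ((fderivWithin ℝ h (g '' Q') (g z0)).comp (fderivWithin ℝ g Q' z0)) Q' z0 :=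
    hhd.hasFDerivWithinAt.comp z0 hgd.hasFDerivWithinAt (mapsTo_image g Q')
  have hid : HasFDerivWithinAt (h ∘ g) (ContinuousLinearMap.id ℝ _) Q' z0 := by
    refine (hasFDerivWithinAt_id z0 Q').congr ?_ ?_
    · rintro _ ⟨z, ⟨hzU, hzR⟩, rfl⟩
      simp only [Function.comp, id, hgz z hzU, hhz z hzU]
    · simp only [Function.comp, id, hgz0]
      exact hhz x hxU
  have heq := hQ'u.eq hcomp hid
  have hinj : Function.Injective (fderivWithin ℝ g Q' z0) := by
    intro v w hvw
    have h1 := congrArg (fun L => L v) heq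
    have h2 := congrArg (fun L => L w) heq
    simp only [ContinuousLinearMap.comp_apply, ContinuousLinearMap.id_apply] at h1 h2
    rw [← h1, ← h2, hvw]
  have hsurj : Function.Surjective (fderivWithin ℝ g Q' z0) :=
    (LinearMap.injective_iff_surjective
      (f := (fderivWithin ℝ g Q' z0 : EuclideanSpace ℝ (Fin n) →ₗ[ℝ] _))).1 hinj
  have := hgd.hasFDerivWithinAt.uniqueDiffWithinAt hQ'u hsurj.denseRange
  rw [hgz0] at this
  exact this.mono hgS

end VBChart

end Charts

section Derivatives

variable {n k : ℕ} {S : Set (EuclideanSpace ℝ (Fin n))} {y : EuclideanSpace ℝ (Fin n)}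

/-- The partial derivative `∂_I f = ∂ᵏf / ∂y^{i₁} ⋯ ∂y^{iₖ}`, `I = i₁ ⋯ iₖ`, of a function `f`
defined on `S ⊆ ℝⁿ`. -/
def partialWithin (S : Set (EuclideanSpace ℝ (Fin n))) (I : Fin k → Fin n)
    (f : EuclideanSpace ℝ (Fin n) → ℝ) (y : EuclideanSpace ℝ (Fin n)) : ℝ :=
  iteratedFDerivWithin ℝ k f S y fun l => EuclideanSpace.single (I l) 1

theorem partialWithin_add {I : Fin k → Fin n} {f g : EuclideanSpace ℝ (Fin n) → ℝ}
    (hS : UniqueDiffOn ℝ S) (hy : y ∈ S) (hf : ContDiffWithinAt ℝ k f S y)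
    (hg : ContDiffWithinAt ℝ k g S y) :
    partialWithin S I (f + g) y = partialWithin S I f y + partialWithin S I g y := by
  simp only [partialWithin, iteratedFDerivWithin_add_apply hf hg hS hy]
  rfl

theorem partialWithin_smul {I : Fin k → Fin n} {f : EuclideanSpace ℝ (Fin n) → ℝ} (c : ℝ)
    (hS : UniqueDiffOn ℝ S) (hy : y ∈ S) (hf : ContDiffWithinAt ℝ k f S y) :
    partialWithin S I (c • f) y = c • partialWithin S I f y := by
  simp only [partialWithin, iteratedFDerivWithin_const_smul_apply hf hS hy]
  rfl

theorem contDiffOn_partialWithin {I : Fin k → Fin n} {f : EuclideanSpace ℝ (Fin n) → ℝ} {j l : ℕ}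
    (hS : UniqueDiffOn ℝ S) (hf : ContDiffOn ℝ l f S) (h : j + k ≤ l) :
    ContDiffOn ℝ j (partialWithin S I f) S := fun y hy =>
  ((hf y hy).iteratedFDerivWithin_right (m := j) hS (by exact_mod_cast h) hy).continuousLinearMap_comp
    (ContinuousMultilinearMap.apply ℝ (fun _ : Fin k => EuclideanSpace ℝ (Fin n)) ℝ
      fun l => EuclideanSpace.single (I l) 1)

end Derivatives

section Bundles

variable (n m : ℕ) {X : Type u} [TopologicalSpace X] [ChartedSpace (EuclideanQuadrant n) X]
  (W : X → Type u) [∀ x, AddCommGroup (W x)] [∀ x, Module ℝ (W x)]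
  [TopologicalSpace (TotalSpace (EuclideanSpace ℝ (Fin m)) W)] [∀ x, TopologicalSpace (W x)]
  [FiberBundle (EuclideanSpace ℝ (Fin m)) W]

/-- A family of vector spaces over `X` with linear fibre coordinates, indexed by `ι`, over the
domain of each vector bundle chart of `W`. It serves as a common frame for `W` itself, its jet
bundles and its iterated jet bundles. -/
structure CoordBundle (ι : Type) where
  Fib : X → Type u
  [addCommGroup : ∀ x, AddCommGroup (Fib x)]
  [module : ∀ x, Module ℝ (Fib x)]
  coord : VBChart n m W → ∀ x, Fib x →ₗ[ℝ] (ι → ℝ)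

attribute [instance] CoordBundle.addCommGroup CoordBundle.module

/-- The bundle `W`, with the fibre coordinates `v ↦ (v^α)`, `α = 1, …, m`, of its charts. -/
def baseBundle : CoordBundle n m W (Fin m) where
  Fib := W
  coord a x :=
    haveI := a.isLinear
    (EuclideanSpace.equiv (Fin m) ℝ).toLinearMap ∘ₗ a.triv.linearMapAt ℝ x

variable {n m W} {ι : Type}

namespace CoordBundle

/-- The local representative `φ(U) → ℝ^ι` of a section. -/
def rep (E : CoordBundle n m W ι) (a : VBChart n m W) (s : ∀ x, E.Fib x)
    (y : EuclideanSpace ℝ (Fin n)) (c : ι) : ℝ :=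
  E.coord a (a.inv y) (s (a.inv y)) c

/-- The space `C^k(E|_R)` of sections over the body `R` all of whose local representatives are of
class `C^k`. A section over `R` is encoded by its extension by zero to `X`. -/
def Sec (E : CoordBundle n m W ι) (R : Body n X) (k : ℕ) : Submodule ℝ (∀ x, E.Fib x) where
  carrier := {s | (∀ x ∉ R.carrier, s x = 0) ∧
    ∀ (a : VBChart n m W) (c : ι), ContDiffOn ℝ k (fun y => E.rep a s y c) (a.img R.carrier)}
  zero_mem' := by
    refine ⟨fun _ _ => rfl, fun a c => ?_⟩
    have : (fun y => E.rep a 0 y c) = fun _ => 0 := by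
      funext y; simp [rep]
    rw [this]
    exact contDiffOn_const
  add_mem' := by
    rintro s t ⟨hs, hs'⟩ ⟨ht, ht'⟩
    refine ⟨fun x hx => by simp [hs x hx, ht x hx], fun a c => ?_⟩
    have : (fun y => E.rep a (s + t) y c) = fun y => E.rep a s y c + E.rep a t y c := by
      funext y; simp [rep]
    rw [this]
    exact (hs' a c).add (ht' a c)
  smul_mem' := by
    rintro z s ⟨hs, hs'⟩
    refine ⟨fun x hx => by simp [hs x hx], fun a c => ?_⟩
    have : (fun y => E.rep a (z • s) y c) = fun y => z * E.rep a s y c := by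
      funext y; simp [rep]
    rw [this]
    exact contDiffOn_const.mul (hs' a c)

theorem Sec.mono (E : CoordBundle n m W ι) (R : Body n X) {k l : ℕ} (h : k ≤ l) :
    E.Sec R l ≤ E.Sec R k := fun _ hs =>
  ⟨hs.1, fun a c => (hs.2 a c).of_le (by exact_mod_cast h)⟩

end CoordBundle

end Bundles

section Jets

/-- Non-decreasing multi-indices `I = i₁ ⋯ iₖ`, `i₁ ≤ ⋯ ≤ iₖ`, with `0 ≤ k ≤ r`. -/
abbrev JetIdx (n r : ℕ) : Type := Σ k : Fin (r + 1), {I : Fin k → Fin n // Monotone I}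

instance (n r : ℕ) : Fintype (JetIdx n r) :=
  haveI (k : Fin (r + 1)) : Fintype {I : Fin k → Fin n // Monotone I} := Fintype.ofFinite _
  inferInstance

variable {n m : ℕ} {X : Type u} [TopologicalSpace X] [ChartedSpace (EuclideanQuadrant n) X]
  {W : X → Type u} [∀ x, AddCommGroup (W x)] [∀ x, Module ℝ (W x)]
  [TopologicalSpace (TotalSpace (EuclideanSpace ℝ (Fin m)) W)] [∀ x, TopologicalSpace (W x)]
  [FiberBundle (EuclideanSpace ℝ (Fin m)) W] {ι : Type}

namespace CoordBundle

/-- The local coordinates `s ↦ (∂_I s_a^c (φ_a(x)))_{I, c}`, `|I| ≤ r`, of the `r`-jet at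
`x ∈ U_a ∩ R` of `C^r`-sections over `R`. -/
def jetCoord (E : CoordBundle n m W ι) (R : Body n X) (r : ℕ) (a : VBChart n m W) (x : X)
    (hx : x ∈ a.dom ∩ R.carrier) : E.Sec R r →ₗ[ℝ] (JetIdx n r × ι → ℝ) where
  toFun s p := partialWithin (a.img R.carrier) p.1.2.1 (fun y => E.rep a s.1 y p.2) (a.ext x)
  map_add' s t := by
    funext p
    have hk : ((p.1.1 : ℕ) : ℕ∞ω) ≤ (r : ℕ∞ω) := by exact_mod_cast Nat.lt_succ_iff.1 p.1.1.2
    have hy : a.ext x ∈ a.img R.carrier := ⟨x, hx, rfl⟩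
    have : (fun y => E.rep a (s + t).1 y p.2)
        = (fun y => E.rep a s.1 y p.2) + fun y => E.rep a t.1 y p.2 := by
      funext y; simp [rep]
    rw [this, partialWithin_add (a.uniqueDiffOn_img R) hy ((s.2.2 a p.2 _ hy).of_le hk)
      ((t.2.2 a p.2 _ hy).of_le hk)]
    rfl
  map_smul' z s := by
    funext p
    have hk : ((p.1.1 : ℕ) : ℕ∞ω) ≤ (r : ℕ∞ω) := by exact_mod_cast Nat.lt_succ_iff.1 p.1.1.2
    have hy : a.ext x ∈ a.img R.carrier := ⟨x, hx, rfl⟩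
    have : (fun y => E.rep a (z • s).1 y p.2) = z • fun y => E.rep a s.1 y p.2 := by
      funext y; simp [rep]
    rw [this, partialWithin_smul z (a.uniqueDiffOn_img R) hy ((s.2.2 a p.2 _ hy).of_le hk)]
    rfl

/-- The `C^r`-sections over `R` whose `r`-jet at `x` vanishes. -/
def vanishing (E : CoordBundle n m W ι) (R : Body n X) (r : ℕ) (x : X) :
    Submodule ℝ (E.Sec R r) :=
  ⨅ (a : VBChart n m W) (hx : x ∈ a.dom ∩ R.carrier), LinearMap.ker (E.jetCoord R r a x hx)

theorem vanishing_le (E : CoordBundle n m W ι) (R : Body n X) (r : ℕ) (a : VBChart n m W) (x : X)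
    (hx : x ∈ a.dom ∩ R.carrier) :
    E.vanishing R r x ≤ LinearMap.ker (E.jetCoord R r a x hx) :=
  (iInf_le _ a).trans (iInf_le _ hx)

open Classical in
/-- The `r`-jet bundle `J^r(E|_R)` over the body `R`: the fibre at `x ∈ R` consists of the
equivalence classes of `C^r`-sections having the same partial derivatives of orders `≤ r` at `x`,
and the fibre coordinates are these partial derivatives. (By means of cut-off functions every jet
of a local section is the jet of a section defined on the compact set `R`.) -/
def jetBundle (E : CoordBundle n m W ι) (R : Body n X) (r : ℕ) :
    CoordBundle n m W (JetIdx n r × ι) where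
  Fib x := E.Sec R r ⧸ E.vanishing R r x
  coord a x :=
    if hx : x ∈ a.dom ∩ R.carrier then
      (E.vanishing R r x).liftQ (E.jetCoord R r a x hx) (E.vanishing_le R r a x hx)
    else 0

/-- The jet extension mapping `j^r : C^l(E|_R) → C^k(J^r(E|_R))`, `k + r ≤ l`. -/
def jetExt (E : CoordBundle n m W ι) (R : Body n X) (r : ℕ) {k l : ℕ} (h : k + r ≤ l)
    (s : E.Sec R l) : (E.jetBundle R r).Sec R k :=
  ⟨fun x => Submodule.Quotient.mk ⟨s.1, Sec.mono E R (le_of_add_le_right h) s.2⟩, by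
    refine ⟨fun x hx => ?_, fun a p => ?_⟩
    · refine (Submodule.Quotient.mk_eq_zero _).2 ?_
      simp only [vanishing, Submodule.mem_iInf]
      exact fun a hx' => absurd hx'.2 hx
    · have hp : k + (p.1.1 : ℕ) ≤ l :=
        (Nat.add_le_add_left (Nat.lt_succ_iff.1 p.1.1.2) k).trans h
      refine (contDiffOn_partialWithin (I := p.1.2.1) (a.uniqueDiffOn_img R) (s.2.2 a p.2)
        hp).congr ?_
      rintro _ ⟨x, hx, rfl⟩
      simp only [rep, jetBundle]
      rw [a.inv_ext hx.1, dif_pos hx]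
      rfl⟩

end CoordBundle

/-- The coordinates of the iterated jets: at each generation the coordinates of the previous one
and their first derivatives. -/
def IterIdx (n m : ℕ) : ℕ → Type
  | 0 => Fin m
  | r + 1 => JetIdx n 1 × IterIdx n m r

instance IterIdx.fintype (n m : ℕ) : ∀ r, Fintype (IterIdx n m r)
  | 0 => inferInstanceAs (Fintype (Fin m))
  | r + 1 =>
    haveI := IterIdx.fintype n m r
    inferInstanceAs (Fintype (JetIdx n 1 × IterIdx n m r))

variable (m W)

/-- The `r`-jet bundle `J^r(W|_R)`. -/
def jetB (R : Body n X) (r : ℕ) : CoordBundle n m W (JetIdx n r × Fin m) :=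
  (baseBundle n m W).jetBundle R r

/-- The iterated (non-holonomic) jet bundle `Ĵ^r(W|_R)`, where `Ĵ⁰W = W` and
`Ĵ^{r+1}W = J¹(Ĵ^rW)`. -/
def iterJetB (R : Body n X) : ∀ r : ℕ, CoordBundle n m W (IterIdx n m r)
  | 0 => baseBundle n m W
  | r + 1 => (iterJetB R r).jetBundle R 1

/-- The space `C^r(W|_R)` of `C^r`-sections of `W` over the body `R`. -/
abbrev CrSec (R : Body n X) (r : ℕ) : Submodule ℝ (∀ x, W x) := (baseBundle n m W).Sec R r

variable {m W}

/-- The sections of class `C^k` over `R` are those that are `C^k` on `R` as maps from `X` to the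
total space of `W`. -/
theorem mem_crSec_iff [IsManifold (quadrant n) ∞ X] [VectorBundle ℝ (EuclideanSpace ℝ (Fin m)) W]
    [ContMDiffVectorBundle ∞ (EuclideanSpace ℝ (Fin m)) W (quadrant n)]
    (R : Body n X) (k : ℕ) (s : ∀ x, W x) :
    s ∈ CrSec m W R k ↔ (∀ x ∉ R.carrier, s x = 0) ∧
      ContMDiffOn (quadrant n) ((quadrant n).prod 𝓘(ℝ, EuclideanSpace ℝ (Fin m))) k
        (fun x => TotalSpace.mk' (EuclideanSpace ℝ (Fin m)) x (s x)) R.carrier := by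
  have hle : ((k : ℕ) : ℕ∞ω) ≤ ∞ := by exact_mod_cast le_top
  have key : ∀ a : VBChart n m W,
      ContMDiffOn (quadrant n) 𝓘(ℝ, EuclideanSpace ℝ (Fin m)) k
        (fun x => (a.triv ⟨x, s x⟩).2) (a.dom ∩ R.carrier) ↔
      ∀ c, ContDiffOn ℝ k (fun y => (baseBundle n m W).rep a s y c) (a.img R.carrier) := by
    intro a
    rw [contMDiffOn_iff_of_mem_maximalAtlas'
      (IsManifold.maximalAtlas_subset_of_le hle a.chart_mem)
      (IsManifold.chart_mem_maximalAtlas (0 : EuclideanSpace ℝ (Fin m)))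
      (fun x hx => hx.1.1) (fun x _ => mem_univ _)]
    change ContDiffOn ℝ k (fun y => (a.triv ⟨a.inv y, s (a.inv y)⟩).2) (a.img R.carrier) ↔ _
    rw [contDiffOn_euclidean]
    refine forall_congr' fun c => contDiffOn_congr ?_
    rintro _ ⟨x, hx, rfl⟩
    have := a.isLinear
    change _ = (a.triv.linearMapAt ℝ (a.inv (a.ext x)) (s (a.inv (a.ext x)))) c
    have hb : a.inv (a.ext x) ∈ a.triv.baseSet := by rw [a.inv_ext hx.1]; exact hx.1.2
    rw [a.triv.coe_linearMapAt_of_mem hb]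
  refine and_congr_right fun _ => ⟨fun h x hx => ?_, fun h a => (key a).1 ?_⟩
  · have hxd := VBChart.mem_dom_atPoint (n := n) (m := m) (W := W) x
    have h1 := (key (VBChart.atPoint n m W x)).2 (h _) x ⟨hxd, hx⟩
    refine (Trivialization.contMDiffWithinAt_section
      (e := trivializationAt (EuclideanSpace ℝ (Fin m)) W x) _ hxd.2).2
      (h1.mono_of_mem_nhdsWithin ?_)
    exact Filter.inter_mem (mem_nhdsWithin_of_mem_nhds ((VBChart.isOpen_dom _).mem_nhds hxd))
      self_mem_nhdsWithin
  · have h1 := (a.contMDiffOn_triv.of_le hle).comp (h.mono (inter_subset_right (s := a.dom)))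
      (fun x hx => a.triv.mem_source.2 hx.1.2)
    exact contMDiff_snd.comp_contMDiffOn h1

/-- The jet extension `j^r : C^r(W|_R) → C⁰(J^r(W|_R))`. -/
def jet (R : Body n X) (r : ℕ) (w : CrSec m W R r) : (jetB m W R r).Sec R 0 :=
  (baseBundle n m W).jetExt R r (by simp) w

/-- The iterated jet extension `ĵ^r : C^l(W|_R) → C^k(Ĵ^r(W|_R))`, `k + r ≤ l`, where
`ĵ^{r+1} = j¹ ∘ ĵ^r`. -/
def iterJetAux (R : Body n X) : ∀ (r : ℕ) {k l : ℕ} (_ : k + r ≤ l) (_ : CrSec m W R l),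
    (iterJetB m W R r).Sec R k
  | 0, _, _, h, w => ⟨w.1, CoordBundle.Sec.mono (baseBundle n m W) R h w.2⟩
  | r + 1, k, _, h, w =>
    (iterJetB m W R r).jetExt R 1 (le_refl (k + 1))
      (iterJetAux R r (k := k + 1) (by omega) w)

/-- The iterated jet extension `ĵ^r : C^r(W|_R) → C⁰(Ĵ^r(W|_R))`. -/
def iterJet (R : Body n X) (r : ℕ) (w : CrSec m W R r) : (iterJetB m W R r).Sec R 0 :=
  iterJetAux R r (by simp) w

end Jets

section Forces

variable (m : ℕ) {n : ℕ} {X : Type u} [TopologicalSpace X] [ChartedSpace (EuclideanQuadrant n) X]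
  (W : X → Type u) [∀ x, AddCommGroup (W x)] [∀ x, Module ℝ (W x)]
  [TopologicalSpace (TotalSpace (EuclideanSpace ℝ (Fin m)) W)] [∀ x, TopologicalSpace (W x)]
  [FiberBundle (EuclideanSpace ℝ (Fin m)) W]

/-- A precompact atlas on the body `R`: finitely many compact sets `K_i ⊆ R`, each inside the
domain of a vector bundle chart, whose interiors relative to `R` cover `R`. -/
structure PrecompactAtlas (R : Body n X) where
  A : ℕ
  chart : Fin A → VBChart n m W
  K : Fin A → Set X
  isCompact : ∀ i, IsCompact (K i)
  subset : ∀ i, K i ⊆ (chart i).dom ∩ R.carrier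
  cover : ∀ x ∈ R.carrier, ∃ i, K i ∈ 𝓝[R.carrier] x

variable {m W}

/-- The `C^r`-norm of a section `w` over `R` with respect to a precompact atlas: the supremum of
`|∂_I w_i^α(φ_i(x))|` over all `i`, `α`, `|I| ≤ r` and `x ∈ K_i`. -/
def PrecompactAtlas.crNorm {R : Body n X} (𝔎 : PrecompactAtlas m W R) (r : ℕ)
    (w : CrSec m W R r) : ℝ :=
  sSup {t : ℝ | ∃ (i : Fin 𝔎.A) (α : Fin m) (k : ℕ) (I : Fin k → Fin n) (x : X),
    k ≤ r ∧ x ∈ 𝔎.K i ∧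
      t = |partialWithin ((𝔎.chart i).img R.carrier) I
        (fun y => (baseBundle n m W).rep (𝔎.chart i) w.1 y α) ((𝔎.chart i).ext x)|}

variable (m W)

/-- A force on the body `R`: an element of `C^r(W|_R)^*`, i.e. a linear functional which is
continuous for the `C^r`-norm of a precompact atlas (all of these norms are equivalent). -/
structure Force (R : Body n X) (r : ℕ) where
  toLin : CrSec m W R r →ₗ[ℝ] ℝ
  bounded : ∃ (𝔎 : PrecompactAtlas m W R) (C : ℝ), ∀ w, |toLin w| ≤ C * 𝔎.crNorm r w

end Forces

section Measures

/-- A real (signed) Radon measure on `Y`, given by its Jordan decomposition into two mutually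
singular positive Radon measures. Its total variation need not be finite. -/
structure RealRadonMeasure (Y : Type*) [TopologicalSpace Y] [MeasurableSpace Y] where
  pos : Measure Y
  neg : Measure Y
  regular_pos : pos.Regular
  regular_neg : neg.Regular
  mutuallySingular : pos ⟂ₘ neg

namespace RealRadonMeasure

variable {Y : Type*} [TopologicalSpace Y] [MeasurableSpace Y]

/-- Integrability on `A` with respect to a real Radon measure. -/
def IntegrableOn (μ : RealRadonMeasure Y) (A : Set Y) (f : Y → ℝ) : Prop :=
  MeasureTheory.IntegrableOn f A μ.pos ∧ MeasureTheory.IntegrableOn f A μ.neg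

/-- The integral `∫_A f dμ`. -/
def integralOn (μ : RealRadonMeasure Y) (A : Set Y) (f : Y → ℝ) : ℝ :=
  ∫ y in A, f y ∂μ.pos - ∫ y in A, f y ∂μ.neg

end RealRadonMeasure

variable {n m : ℕ} {X : Type u} [TopologicalSpace X] [ChartedSpace (EuclideanQuadrant n) X]
  {W : X → Type u} [∀ x, AddCommGroup (W x)] [∀ x, Module ℝ (W x)]
  [TopologicalSpace (TotalSpace (EuclideanSpace ℝ (Fin m)) W)] [∀ x, TopologicalSpace (W x)]
  [FiberBundle (EuclideanSpace ℝ (Fin m)) W]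

/-- A vector valued Radon measure on `X` acting on the sections of `E`: for each vector bundle
chart `(U, φ, Φ)` an `ℝ^ι`-valued Radon measure on `φ(U)`, such that two of these local
representatives agree on every continuous section of `E` supported in both chart domains. -/
structure BundleMeasure [CompactSpace X] [IsManifold (quadrant n) ∞ X] {ι : Type} [Fintype ι]
    (E : CoordBundle n m W ι) where
  meas : ∀ a : VBChart n m W, ι → RealRadonMeasure (a.img univ)
  compat : ∀ (a b : VBChart n m W), ∀ χ ∈ E.Sec (Body.whole n X) 0,
    closure {x | χ x ≠ 0} ⊆ a.dom ∩ b.dom →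
      ∑ c, (meas a c).integralOn univ (fun y => E.rep a χ y c) =
        ∑ c, (meas b c).integralOn univ (fun y => E.rep b χ y c)

variable (n m W) in
/-- A finite vector bundle atlas of `W → X` with a subordinate partition of unity. -/
structure PartitionedAtlas where
  A : ℕ
  chart : Fin A → VBChart n m W
  u : PartitionOfUnity (Fin A) X
  isSubordinate : u.IsSubordinate fun i => (chart i).dom

theorem PartitionedAtlas.nonempty [CompactSpace X] [T2Space X] [IsManifold (quadrant n) ∞ X]
    [VectorBundle ℝ (EuclideanSpace ℝ (Fin m)) W]
    [ContMDiffVectorBundle ∞ (EuclideanSpace ℝ (Fin m)) W (quadrant n)] :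
    Nonempty (PartitionedAtlas n m W) := by
  obtain ⟨t, ht⟩ := isCompact_univ.elim_finite_subcover
    (fun x : X => (VBChart.atPoint n m W x).dom) (fun x => (VBChart.atPoint n m W x).isOpen_dom)
    (fun x _ => mem_iUnion.2 ⟨x, VBChart.mem_dom_atPoint x⟩)
  let e := t.equivFin
  obtain ⟨u, hu⟩ := PartitionOfUnity.exists_isSubordinate (isClosed_univ (X := X))
    (fun i : Fin t.card => (VBChart.atPoint n m W (e.symm i).1).dom)
    (fun i => (VBChart.atPoint n m W _).isOpen_dom) (by
      intro x hx
      obtain ⟨z, hz, hxz⟩ := mem_iUnion₂.1 (ht hx)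
      exact mem_iUnion.2 ⟨e ⟨z, hz⟩, by simpa using hxz⟩)
  exact ⟨⟨t.card, _, u, hu⟩⟩

variable [CompactSpace X] [IsManifold (quadrant n) ∞ X] {ι : Type} [Fintype ι]

/-- `∫_R χ · dς = v`. Here `ς` is a vector valued Radon measure on `X`, and `χ` is a section over
the body `R` whose local representatives `χ_a` have the components of sections of `E`. For every
vector bundle atlas and every subordinate partition of unity `(u_a)`, all integrals exist and
`∑_a ∑_c ∫_{φ_a(U_a ∩ R)} u_a χ_a^c dς_{a,c} = v`. -/
def BundleMeasure.HasIntegral {E : CoordBundle n m W ι} (ς : BundleMeasure E) (R : Body n X)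
    {E' : CoordBundle n m W ι} (χ : E'.Sec R 0) (v : ℝ) : Prop :=
  ∀ 𝔓 : PartitionedAtlas n m W,
    (∀ i c, (ς.meas (𝔓.chart i) c).IntegrableOn {y | (𝔓.chart i).inv y ∈ R.carrier}
      (fun y => 𝔓.u i ((𝔓.chart i).inv y) * E'.rep (𝔓.chart i) χ.1 y c)) ∧
    ∑ i, ∑ c, (ς.meas (𝔓.chart i) c).integralOn {y | (𝔓.chart i).inv y ∈ R.carrier}
      (fun y => 𝔓.u i ((𝔓.chart i).inv y) * E'.rep (𝔓.chart i) χ.1 y c) = v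

variable (n m W)

/-- Vector valued hyper-stress measures on `X`: Radon measures acting on sections of `J^rW`. -/
abbrev HyperStressMeasure (r : ℕ) := BundleMeasure (jetB m W (Body.whole n X) r)

/-- Non-holonomic stress measures on `X`: Radon measures acting on sections of `Ĵ^rW`. -/
abbrev NonholonomicStressMeasure (r : ℕ) := BundleMeasure (iterJetB m W (Body.whole n X) r)

variable {n m W}

/-- `ς` represents the force `F` on `X`: `F(w) = ∫_X j^r w · dς` for all `w ∈ C^r(W)`. -/
def HyperStressMeasure.Represents {r : ℕ} (ς : HyperStressMeasure n m W r)
    (F : Force m W (Body.whole n X) r) : Prop :=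
  ∀ w, ς.HasIntegral (Body.whole n X) (jet (Body.whole n X) r w) (F.toLin w)

/-- `ς̂` represents the force `F` on `X`: `F(w) = ∫_X ĵ^r w · dς̂` for all `w ∈ C^r(W)`. -/
def NonholonomicStressMeasure.Represents {r : ℕ} (ς : NonholonomicStressMeasure n m W r)
    (F : Force m W (Body.whole n X) r) : Prop :=
  ∀ w, ς.HasIntegral (Body.whole n X) (iterJet (Body.whole n X) r w) (F.toLin w)

end Measures

end GlobalStress

end

/-! Representation. A force is bounded by the suprema of finitely many partial derivatives `∂_I
w_i^α` over compact sets `K_i`. These derivatives form one continuous function on a disjoint union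
of copies of the `K_i`. The Hahn–Banach theorem and the Riesz–Markov–Kakutani theorem then write the
force as a finite signed sum of integrals of partial derivatives against finite measures
(`Force.exists_measures`). Each term integrates a single fibre coordinate of the jet in a single
chart. In any other chart this coordinate is a combination, with smooth coefficients, of the
coordinates there, so the sum becomes a compatible family of local measures
(`IsTame.exists_bundleMeasure`). Every partial derivative of order at most `r` is also a coordinate
of the iterated jet. The same scalar measures placed on that coordinate therefore give the
non-holonomic measure, and the two integrands agree pointwise on every body.

Transition matrices. All of this needs fibre coordinates that are linear isomorphisms, with smooth
transition matrices that are the same for all bodies (`IsTame`). The property passes from a bundle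
to its jet bundle by the product and chain rules (`IsTame.exists_pd_change`). Mixed partials have to
commute, which holds because the chart image of a body lies in the closure of its interior, and
every coordinate vector has to be attained, which is done by cut-off polynomials.

Gluing. Compatibility is postulated for continuous sections over `X` only, while a section over a
body, extended by zero, jumps at the boundary. Both sides of the transformation rule are dominated
by integrals against finite measures, so `L¹`-density of continuous functions extends the rule to
bounded measurable factors (`IsTame.int_change`). Independence of the atlas then follows by a common
refinement of two partitions of unity (`IsTame.glued_eq`).

Non-uniqueness. By the fundamental theorem of calculus, the integral of `∂_i w^α` along a coordinate
segment minus the difference of the end values of `w^α` vanishes on all jets, but the corresponding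
measure is nonzero on general continuous sections (`IsTame.exists_null`). It can be added to any
representing measure. -/

set_option linter.unusedSectionVars false

noncomputable section

namespace GlobalStress

/-! ### Symmetry of iterated partial derivatives on subsets of `ℝⁿ` -/

section EuclideanCalculus

variable {n k : ℕ} {S : Set (EuclideanSpace ℝ (Fin n))} {y : EuclideanSpace ℝ (Fin n)}
  {f g : EuclideanSpace ℝ (Fin n) → ℝ}

theorem partialWithin_congr {I : Fin k → Fin n} (h : EqOn f g S) (hy : y ∈ S) :
    partialWithin S I f y = partialWithin S I g y := by
  rw [partialWithin, partialWithin, iteratedFDerivWithin_congr h hy]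

theorem partialWithin_zero (I : Fin 0 → Fin n) : partialWithin S I f y = f y := by
  simp [partialWithin]

theorem fderivWithin_iteratedFDerivWithin_apply (hS : UniqueDiffOn ℝ S)
    (hf : ContDiffOn ℝ (k + 1 : ℕ) f S) (hy : y ∈ S) (v : Fin k → EuclideanSpace ℝ (Fin n))
    (w : EuclideanSpace ℝ (Fin n)) :
    fderivWithin ℝ (fun z => iteratedFDerivWithin ℝ k f S z v) S y w =
      fderivWithin ℝ (iteratedFDerivWithin ℝ k f S) S y w v := by
  have hd : DifferentiableWithinAt ℝ (iteratedFDerivWithin ℝ k f S) S y :=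
    hf.differentiableOn_iteratedFDerivWithin (by exact_mod_cast Nat.lt_succ_self k) hS y hy
  have h1 := ((ContinuousMultilinearMap.apply ℝ (fun _ : Fin k => EuclideanSpace ℝ (Fin n)) ℝ
    v).hasFDerivAt.comp_hasFDerivWithinAt y hd.hasFDerivWithinAt).fderivWithin (hS y hy)
  exact congrArg (fun L => L w) h1

/-- The first index is the outermost derivative. This convention fixes the form of all later
inductions on the order, which prepend an index. -/
theorem partialWithin_succ (hS : UniqueDiffOn ℝ S) (hf : ContDiffOn ℝ (k + 1 : ℕ) f S)
    (hy : y ∈ S) (I : Fin (k + 1) → Fin n) :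
    partialWithin S I f y =
      fderivWithin ℝ (partialWithin S (Fin.tail I) f) S y (EuclideanSpace.single (I 0) 1) := by
  have := fderivWithin_iteratedFDerivWithin_apply hS hf hy
    (fun l => EuclideanSpace.single (Fin.tail I l) 1) (EuclideanSpace.single (I 0) 1)
  rw [partialWithin, iteratedFDerivWithin_succ_apply_left]
  exact this.symm

/-- The iterated partial derivatives of a `C^k`-function on a set in the closure of its interior do
not depend on the order of differentiation. -/
theorem partialWithin_comp_perm (hS : UniqueDiffOn ℝ S) (hi : S ⊆ closure (interior S))
    (hf : ContDiffOn ℝ k f S) (hy : y ∈ S) (I : Fin k → Fin n) (σ : Equiv.Perm (Fin k)) :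
    partialWithin S (I ∘ σ) f y = partialWithin S I f y := by
  induction k generalizing y with
  | zero => congr 1; exact Subsingleton.elim _ _
  | succ k ih =>
    -- Adjacent transpositions generate the symmetric group, so only these need to be treated.
    have hmem : σ ∈ Submonoid.closure
        (Set.range fun i : Fin k => Equiv.swap i.castSucc i.succ) := by
      rw [Equiv.Perm.mclosure_swap_castSucc_succ]; trivial
    induction hmem using Submonoid.closure_induction generalizing I with
    | one => rfl
    | mul σ τ _ _ hσ hτ =>
      rw [Equiv.Perm.coe_mul, ← Function.comp_assoc, hτ, hσ]
    | mem σ hσ =>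
      obtain ⟨i, rfl⟩ := hσ
      dsimp only
      rcases k with _ | k
      · exact i.elim0
      induction i using Fin.cases with
      | succ i =>
        -- The transposition leaves the outermost index alone, so it acts on the tail, where the
        -- induction on the order applies.
        have h0 : (I ∘ Equiv.swap i.succ.castSucc i.succ.succ) 0 = I 0 := by
          simp only [Function.comp]
          rw [Equiv.swap_apply_of_ne_of_ne] <;> simp [Fin.ext_iff]
        have ht : Fin.tail (I ∘ Equiv.swap i.succ.castSucc i.succ.succ) =
            Fin.tail I ∘ Equiv.swap i.castSucc i.succ := by
          funext l
          simp only [Fin.tail, Function.comp]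
          congr 1
          rcases eq_or_ne l i.castSucc with rfl | h1
          · rw [Equiv.swap_apply_left, ← Fin.succ_castSucc, Equiv.swap_apply_left]
          rcases eq_or_ne l i.succ with rfl | h2
          · rw [Equiv.swap_apply_right, Equiv.swap_apply_right, Fin.succ_castSucc]
          rw [Equiv.swap_apply_of_ne_of_ne h1 h2, Equiv.swap_apply_of_ne_of_ne]
          · rw [← Fin.succ_castSucc]; exact fun h => h1 (Fin.succ_injective _ h)
          · exact fun h => h2 (Fin.succ_injective _ h)
        rw [partialWithin_succ hS hf hy, partialWithin_succ hS hf hy, h0, ht]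
        congr 1
        refine fderivWithin_congr' (fun z hz => ?_) hy
        exact ih (hf.of_le (by exact_mod_cast Nat.le_succ _)) hz _ _
      | zero =>
        -- The transposition exchanges the two outermost derivatives. These are exposed as a second
        -- derivative of the remaining `C²` function.
        have key : ∀ J : Fin (k + 2) → Fin n, partialWithin S J f y =
            fderivWithin ℝ (fderivWithin ℝ (partialWithin S (Fin.tail (Fin.tail J)) f) S) S y
              (EuclideanSpace.single (J 0) 1) (EuclideanSpace.single (J 1) 1) := by
          intro J
          have hk : ContDiffOn ℝ (2 : ℕ) (partialWithin S (Fin.tail (Fin.tail J)) f) S :=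
            contDiffOn_partialWithin hS hf (by omega)
          rw [partialWithin_succ hS hf hy]
          have h1 : EqOn (partialWithin S (Fin.tail J) f) (fun z =>
              fderivWithin ℝ (partialWithin S (Fin.tail (Fin.tail J)) f) S z
                (EuclideanSpace.single (J 1) 1)) S := fun z hz =>
            partialWithin_succ hS (hf.of_le (by exact_mod_cast Nat.le_succ _)) hz _
          rw [fderivWithin_congr' h1 hy]
          have hd : DifferentiableWithinAt ℝ
              (fderivWithin ℝ (partialWithin S (Fin.tail (Fin.tail J)) f) S) S y :=
            (hk.fderivWithin hS (m := 1) (by norm_num)).differentiableOn (by norm_num) y hy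
          rw [fderivWithin_clm_apply (hS y hy) hd (differentiableWithinAt_const _)]
          simp
        rw [key, key]
        have ht : Fin.tail (Fin.tail (I ∘ Equiv.swap (Fin.castSucc 0) (Fin.succ 0))) =
            Fin.tail (Fin.tail I) := by
          funext l
          simp only [Fin.tail, Function.comp]
          rw [Equiv.swap_apply_of_ne_of_ne] <;> simp [Fin.ext_iff]
        rw [ht]
        have hk : ContDiffOn ℝ (2 : ℕ) (partialWithin S (Fin.tail (Fin.tail I)) f) S :=
          contDiffOn_partialWithin hS hf (by omega)
        -- The second derivative within `S` is symmetric at limits of interior points, which is the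
        -- purpose of `hi`.
        have := (hk y hy).isSymmSndFDerivWithinAt (by simp) hS (hi hy) hy
        rw [this.eq]
        simp

end EuclideanCalculus

/-! ### Chart images of bodies -/

section Charts

variable {n m : ℕ} {X : Type u} [TopologicalSpace X] [ChartedSpace (EuclideanQuadrant n) X]
  {W : X → Type u} [∀ x, AddCommGroup (W x)] [∀ x, Module ℝ (W x)]
  [TopologicalSpace (TotalSpace (EuclideanSpace ℝ (Fin m)) W)] [∀ x, TopologicalSpace (W x)]
  [FiberBundle (EuclideanSpace ℝ (Fin m)) W]

namespace VBChart

theorem ext_inv (a : VBChart n m W) {S : Set X} {y : EuclideanSpace ℝ (Fin n)}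
    (hy : y ∈ a.img S) : a.ext (a.inv y) = y := by
  obtain ⟨x, hx, rfl⟩ := hy
  rw [a.inv_ext hx.1]

theorem inv_mem (a : VBChart n m W) {S : Set X} {y : EuclideanSpace ℝ (Fin n)}
    (hy : y ∈ a.img S) : a.inv y ∈ a.dom ∩ S := by
  obtain ⟨x, hx, rfl⟩ := hy
  rwa [a.inv_ext hx.1]

theorem ext_mem (a : VBChart n m W) {S : Set X} {x : X} (hx : x ∈ a.dom ∩ S) :
    a.ext x ∈ a.img S := ⟨x, hx, rfl⟩

theorem continuousAt_ext (a : VBChart n m W) {x : X} (hx : x ∈ a.dom) : ContinuousAt a.ext x :=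
  a.chart.continuousAt_extend hx.1

theorem continuousAt_inv (a : VBChart n m W) {x : X} (hx : x ∈ a.dom) :
    ContinuousAt a.inv (a.ext x) :=
  a.chart.continuousAt_extend_symm hx.1

theorem continuousOn_ext (a : VBChart n m W) : ContinuousOn a.ext a.dom := fun _ hx =>
  (a.continuousAt_ext hx).continuousWithinAt

theorem continuousOn_inv (a : VBChart n m W) (S : Set X) : ContinuousOn a.inv (a.img S) := by
  rintro _ ⟨x, hx, rfl⟩
  exact (a.continuousAt_inv hx.1).continuousWithinAt

/-- The chart image of a body is contained in the closure of its interior. -/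
theorem img_subset_closure_interior (a : VBChart n m W) (R : Body n X) :
    a.img R.carrier ⊆ closure (interior (a.img R.carrier)) := by
  rintro _ ⟨x, ⟨hxd, hxR⟩, rfl⟩
  obtain ⟨φ, hφ, hxφ, ψ, hψ, hψs, hxψ, hiff⟩ := R.locally_quadrant x hxR
  set p : EuclideanSpace ℝ (Fin n) → X := fun z => (φ.extend (quadrant n)).symm (ψ.symm z) with hp
  set z0 := ψ (φ.extend (quadrant n) x) with hz0
  have hz0t : z0 ∈ ψ.target := ψ.map_source hxψ
  have hpc : ∀ z ∈ ψ.target, ∀ w ∈ φ.source, φ.extend (quadrant n) w = ψ.symm z →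
      p z = w ∧ ContinuousAt p z := by
    intro z hz w hw hwz
    have hpz : p z = w := by simp only [hp]; rw [← hwz, φ.extend_left_inv hw]
    refine ⟨hpz, ContinuousAt.comp (g := (φ.extend (quadrant n)).symm) ?_
      (ψ.continuousAt_symm hz)⟩
    rw [← hwz]
    exact φ.continuousAt_extend_symm hw
  obtain ⟨hpz0, hpc0⟩ := hpc z0 hz0t x hxφ (ψ.left_inv hxψ).symm
  rw [mem_closure_iff]
  intro V hV hxV
  have hev : ∀ᶠ z in 𝓝 z0, z ∈ ψ.target ∧ p z ∈ a.dom ∧ a.ext (p z) ∈ V := by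
    refine Filter.Eventually.and (ψ.open_target.eventually_mem hz0t)
      (Filter.Eventually.and ?_ ?_)
    · exact hpc0.eventually (by rw [hpz0]; exact a.isOpen_dom.mem_nhds hxd)
    · have : ContinuousAt (fun z => a.ext (p z)) z0 :=
        ContinuousAt.comp (g := a.ext) (by rw [hpz0]; exact a.continuousAt_ext hxd) hpc0
      exact this.eventually (hV.eventually_mem (by simpa only [hpz0] using hxV))
  have hz0Q : ∀ i, 0 ≤ z0 i := (hiff _ hxψ).1 ⟨x, ⟨hxφ, hxR⟩, rfl⟩
  -- In the coordinates that straighten the body to the quadrant, a small step along `(1, …, 1)`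
  -- leads from any point into the open quadrant.
  obtain ⟨z1, ⟨hz1t, hz1d, hz1V⟩, hz1p⟩ : ∃ z1, (z1 ∈ ψ.target ∧ p z1 ∈ a.dom ∧
      a.ext (p z1) ∈ V) ∧ ∀ i, 0 < z1 i := by
    have hc : Filter.Tendsto (fun t : ℝ => z0 + t • (WithLp.toLp 2 fun _ => (1 : ℝ)))
        (𝓝[>] 0) (𝓝 z0) := by
      have : Continuous fun t : ℝ => z0 + t • (WithLp.toLp 2 fun _ : Fin n => (1 : ℝ)) := by
        fun_prop
      have := this.tendsto 0
      simp only [zero_smul, add_zero] at this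
      exact this.mono_left nhdsWithin_le_nhds
    obtain ⟨t, ht, ht0⟩ := ((hc.eventually hev).and self_mem_nhdsWithin).exists
    refine ⟨_, ht, fun i => ?_⟩
    have : (0 : ℝ) < t := ht0
    simpa using add_pos_of_nonneg_of_pos (hz0Q i) this
  refine ⟨a.ext (p z1), hz1V, ?_⟩
  have hlift : ∀ z ∈ ψ.target, (∀ i, 0 ≤ z i) → ∃ w ∈ φ.source ∩ R.carrier,
      φ.extend (quadrant n) w = ψ.symm z := by
    intro z hz hz'
    have := (hiff _ (ψ.map_target hz)).2 (by rwa [ψ.right_inv hz])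
    exact this
  obtain ⟨w1, ⟨hw1φ, hw1R⟩, hw1⟩ := hlift z1 hz1t fun i => (hz1p i).le
  obtain ⟨hpz1, hpc1⟩ := hpc z1 hz1t w1 hw1φ hw1
  rw [hpz1] at hz1d
  -- A full neighbourhood of `z1` parametrizes points of the body. It remains to see that its image
  -- in the chart `a` is a neighbourhood as well.
  set N : Set (EuclideanSpace ℝ (Fin n)) :=
    {z | z ∈ ψ.target ∧ (∀ i, 0 ≤ z i) ∧ p z ∈ a.dom} with hN
  have hNn : N ∈ 𝓝 z1 := by
    refine Filter.Eventually.and (ψ.open_target.eventually_mem hz1t)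
      (Filter.Eventually.and ?_ ?_)
    · refine Filter.eventually_all.2 fun i => ?_
      have : ContinuousAt (fun z : EuclideanSpace ℝ (Fin n) => z i) z1 := by fun_prop
      exact (this.eventually (lt_mem_nhds (hz1p i))).mono fun _ h => h.le
    · exact hpc1.eventually (by rw [hpz1]; exact a.isOpen_dom.mem_nhds hz1d)
  have hNimg : (fun z => a.ext (p z)) '' N ⊆ a.img R.carrier := by
    rintro _ ⟨z, ⟨hzt, hz0, hzd⟩, rfl⟩
    obtain ⟨w, ⟨hwφ, hwR⟩, hw⟩ := hlift z hzt hz0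
    refine ⟨p z, ⟨hzd, ?_⟩, rfl⟩
    rw [(hpc z hzt w hwφ hw).1]; exact hwR
  have hI : ∀ z, φ.extend (quadrant n) z ∈ range (quadrant n) := fun z => ⟨φ z, rfl⟩
  have hIa : ∀ z, a.ext z ∈ range (quadrant n) := fun z => ⟨a.chart z, rfl⟩
  have hgd : ContDiffAt ℝ ∞ (fun z => a.ext (p z)) z1 := by
    have h1 : ContDiffWithinAt ℝ ∞ ((quadrant n).extendCoordChange φ a.chart)
        (range (quadrant n)) (ψ.symm z1) := by
      rw [← hw1]
      exact (quadrant n).contDiffWithinAt_extendCoordChange' hφ a.chart_mem hw1φ hz1d.1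
    have h2 : ContDiffWithinAt ℝ ∞ ψ.symm N z1 := (hψs z1 hz1t).contDiffAt
      (ψ.open_target.mem_nhds hz1t) |>.contDiffWithinAt
    refine (h1.comp z1 h2 ?_).contDiffAt hNn
    rintro z ⟨hzt, hz0, -⟩
    obtain ⟨w, ⟨hwφ, hwR⟩, hw⟩ := hlift z hzt hz0
    exact hw ▸ hI w
  have hstrict := hgd.hasStrictFDerivAt (by simp)
  -- The map has a left inverse `h` near `z1`. It is differentiated only within the quadrant, as
  -- `a.ext (p z1)` is not yet known to avoid the boundary.
  have hinj : Function.Injective (fderiv ℝ (fun z => a.ext (p z)) z1) := by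
    set h : EuclideanSpace ℝ (Fin n) → EuclideanSpace ℝ (Fin n) :=
      fun y => ψ (φ.extend (quadrant n) (a.inv y)) with hh
    have hhd : DifferentiableWithinAt ℝ h (range (quadrant n)) (a.ext (p z1)) := by
      rw [hpz1]
      have h1 : DifferentiableWithinAt ℝ ((quadrant n).extendCoordChange a.chart φ)
          (range (quadrant n)) (a.ext w1) :=
        ((quadrant n).contDiffWithinAt_extendCoordChange' a.chart_mem hφ hz1d.1
          hw1φ).differentiableWithinAt (by simp)
      have h2 : DifferentiableAt ℝ ψ (((quadrant n).extendCoordChange a.chart φ) (a.ext w1)) := by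
        have h3 : ((quadrant n).extendCoordChange a.chart φ) (a.ext w1)
            = φ.extend (quadrant n) w1 := by
          change φ.extend (quadrant n) (a.inv (a.ext w1)) = _
          rw [a.inv_ext hz1d]
        rw [h3, hw1]
        have := ψ.map_target hz1t
        exact ((hψ _ this).contDiffAt (ψ.open_source.mem_nhds this)).differentiableAt (by simp)
      exact h2.comp_differentiableWithinAt (a.ext w1) h1
    have hcomp := hhd.hasFDerivWithinAt.comp_hasFDerivAt z1
      (hgd.differentiableAt (by simp)).hasFDerivAt (Filter.Eventually.of_forall fun z => hIa _)
    have hid : HasFDerivAt (h ∘ fun z => a.ext (p z)) (ContinuousLinearMap.id ℝ _) z1 := by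
      refine (hasFDerivAt_id z1).congr_of_eventuallyEq ?_
      filter_upwards [hNn] with z hz
      obtain ⟨w, ⟨hwφ, hwR⟩, hw⟩ := hlift z hz.1 hz.2.1
      simp only [hh, Function.comp, id]
      rw [a.inv_ext hz.2.2, (hpc z hz.1 w hwφ hw).1, hw, ψ.right_inv hz.1]
    have heq := hcomp.unique hid
    intro v w hvw
    have h1 := congrArg (fun L => L v) heq
    have h2 := congrArg (fun L => L w) heq
    simp only [ContinuousLinearMap.comp_apply, ContinuousLinearMap.id_apply] at h1 h2
    rw [← h1, ← h2, hvw]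
  have hsurj : Function.Surjective (fderiv ℝ (fun z => a.ext (p z)) z1) :=
    (LinearMap.injective_iff_surjective
      (f := (fderiv ℝ (fun z => a.ext (p z)) z1 : EuclideanSpace ℝ (Fin n) →ₗ[ℝ] _))).1 hinj
  -- A strict derivative that is onto makes the map open at `z1`, so the image of `N` is a
  -- neighbourhood.
  have hmap := hstrict.map_nhds_eq_of_surj (LinearMap.range_eq_top.2 hsurj)
  refine mem_interior_iff_mem_nhds.2 (Filter.mem_of_superset ?_ hNimg)
  rw [← hmap]
  exact Filter.image_mem_map hNn

end VBChart

end Charts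

/-! ### Partial derivatives in charts and the chain rule -/

section ChartDerivatives

variable {n m k l : ℕ} {X : Type u} [TopologicalSpace X] [ChartedSpace (EuclideanQuadrant n) X]
  {W : X → Type u} [∀ x, AddCommGroup (W x)] [∀ x, Module ℝ (W x)]
  [TopologicalSpace (TotalSpace (EuclideanSpace ℝ (Fin m)) W)] [∀ x, TopologicalSpace (W x)]
  [FiberBundle (EuclideanSpace ℝ (Fin m)) W]

/-- `f` is of class `C^k` on `S ⊆ X`. -/
abbrev SmoothOn (n : ℕ) {X : Type u} [TopologicalSpace X] [ChartedSpace (EuclideanQuadrant n) X]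
    (k : ℕ∞ω) (f : X → ℝ) (S : Set X) : Prop :=
  ContMDiffOn (quadrant n) 𝓘(ℝ, ℝ) k f S

namespace VBChart

variable {f g : X → ℝ} {x : X} {R : Body n X}

theorem chart_mem_nat (a : VBChart n m W) {k : ℕ∞ω} (hk : k ≤ ∞) :
    a.chart ∈ IsManifold.maximalAtlas (quadrant n) k X :=
  IsManifold.maximalAtlas_subset_of_le hk a.chart_mem

theorem smoothOn_iff (a : VBChart n m W) {k : ℕ∞ω} (hk : k ≤ ∞) {S : Set X} :
    SmoothOn n k f (a.dom ∩ S) ↔ ContDiffOn ℝ k (f ∘ a.inv) (a.img S) := by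
  rw [SmoothOn, contMDiffOn_iff_of_mem_maximalAtlas' (a.chart_mem_nat hk)
    (IsManifold.chart_mem_maximalAtlas (0 : ℝ)) (fun x hx => hx.1.1) (fun x _ => mem_univ _)]
  rfl

/-- The `i`-th partial derivative in the chart `a` of a function on `S ⊆ X`. -/
def dpd (a : VBChart n m W) (S : Set X) (i : Fin n) (f : X → ℝ) (x : X) : ℝ :=
  fderivWithin ℝ (f ∘ a.inv) (a.img S) (a.ext x) (EuclideanSpace.single i 1)

/-- The iterated partial derivative `∂_I` in the chart `a` of a function on `S ⊆ X`. -/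
def pd (a : VBChart n m W) (S : Set X) (I : Fin k → Fin n) (f : X → ℝ) (x : X) : ℝ :=
  partialWithin (a.img S) I (f ∘ a.inv) (a.ext x)

theorem pd_comp_inv (a : VBChart n m W) (S : Set X) (I : Fin k → Fin n) (f : X → ℝ) :
    EqOn (a.pd S I f ∘ a.inv) (partialWithin (a.img S) I (f ∘ a.inv)) (a.img S) := by
  intro y hy
  simp only [Function.comp, pd, a.ext_inv hy]

theorem pd_zero (a : VBChart n m W) (S : Set X) (I : Fin 0 → Fin n) (f : X → ℝ)
    (hx : x ∈ a.dom) : a.pd S I f x = f x := by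
  rw [pd, partialWithin_zero, Function.comp, a.inv_ext hx]

theorem pd_succ (a : VBChart n m W) (R : Body n X) (I : Fin (k + 1) → Fin n)
    (hf : SmoothOn n (k + 1 : ℕ) f (a.dom ∩ R.carrier)) (hx : x ∈ a.dom ∩ R.carrier) :
    a.pd R.carrier I f x = a.dpd R.carrier (I 0) (a.pd R.carrier (Fin.tail I) f) x := by
  rw [pd, partialWithin_succ (a.uniqueDiffOn_img R)
    ((a.smoothOn_iff (by exact_mod_cast le_top)).1 hf) (a.ext_mem hx), dpd]
  congr 1
  exact (fderivWithin_congr' (a.pd_comp_inv _ _ _) (a.ext_mem hx)).symm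

theorem smoothOn_pd (a : VBChart n m W) (R : Body n X) (I : Fin k → Fin n)
    (hf : SmoothOn n (l : ℕ) f (a.dom ∩ R.carrier)) {j : ℕ} (h : j + k ≤ l) :
    SmoothOn n j (a.pd R.carrier I f) (a.dom ∩ R.carrier) := by
  rw [a.smoothOn_iff (by exact_mod_cast le_top)] at hf ⊢
  exact (contDiffOn_partialWithin (a.uniqueDiffOn_img R) hf h).congr (a.pd_comp_inv _ _ _)

theorem pd_comp_perm (a : VBChart n m W) (R : Body n X) (I : Fin k → Fin n)
    (hf : SmoothOn n (k : ℕ) f (a.dom ∩ R.carrier)) (hx : x ∈ a.dom ∩ R.carrier)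
    (σ : Equiv.Perm (Fin k)) : a.pd R.carrier (I ∘ σ) f x = a.pd R.carrier I f x :=
  partialWithin_comp_perm (a.uniqueDiffOn_img R) (a.img_subset_closure_interior R)
    ((a.smoothOn_iff (by exact_mod_cast le_top)).1 hf) (a.ext_mem hx) I σ

theorem pd_congr (a : VBChart n m W) (S : Set X) (I : Fin k → Fin n)
    (h : EqOn f g (a.dom ∩ S)) (hx : x ∈ a.dom ∩ S) : a.pd S I f x = a.pd S I g x :=
  partialWithin_congr (fun _ hy => h (a.inv_mem hy)) (a.ext_mem hx)

/-- `dpd` depends only on the germ of the function. -/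
theorem dpd_congr (a : VBChart n m W) (S : Set X) (i : Fin n) (h : f =ᶠ[𝓝[S] x] g)
    (hx : x ∈ a.dom ∩ S) : a.dpd S i f x = a.dpd S i g x := by
  rw [dpd, dpd, Filter.EventuallyEq.fderivWithin_eq_of_mem _ (a.ext_mem hx)]
  have h1 : Filter.Tendsto a.inv (𝓝[a.img S] (a.ext x)) (𝓝[S] x) := by
    refine tendsto_nhdsWithin_iff.2 ⟨?_, ?_⟩
    · have := (a.continuousAt_inv hx.1).continuousWithinAt (s := a.img S)
      rwa [ContinuousWithinAt, a.inv_ext hx.1] at this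
    · exact eventually_mem_nhdsWithin.mono fun y hy => (a.inv_mem hy).2
  exact h1.eventually h

theorem differentiableWithinAt (a : VBChart n m W) {S : Set X}
    (hf : ContMDiffWithinAt (quadrant n) 𝓘(ℝ, ℝ) 1 f S x) (hx : x ∈ a.dom ∩ S) :
    DifferentiableWithinAt ℝ (f ∘ a.inv) (a.img S) (a.ext x) := by
  have h1 := (contMDiffWithinAt_iff_image (s := a.dom ∩ S) (a.chart_mem_nat (k := 1) (by simp))
    (IsManifold.chart_mem_maximalAtlas (0 : ℝ)) (fun x hx => hx.1.1) hx.1.1 (mem_univ _)).1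
      (hf.mono inter_subset_right)
  exact ContDiffWithinAt.differentiableWithinAt h1.2 (by simp)

theorem dpd_mul (a : VBChart n m W) (R : Body n X) (i : Fin n)
    (hf : ContMDiffWithinAt (quadrant n) 𝓘(ℝ, ℝ) 1 f R.carrier x)
    (hg : ContMDiffWithinAt (quadrant n) 𝓘(ℝ, ℝ) 1 g R.carrier x)
    (hx : x ∈ a.dom ∩ R.carrier) :
    a.dpd R.carrier i (fun z => f z * g z) x =
      a.dpd R.carrier i f x * g x + f x * a.dpd R.carrier i g x := by
  have := fderivWithin_fun_mul (a.uniqueDiffOn_img R _ (a.ext_mem hx))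
    (a.differentiableWithinAt hf hx) (a.differentiableWithinAt hg hx)
  have h2 := congrArg (fun L => L (EuclideanSpace.single i 1)) this
  simp only [Function.comp, a.inv_ext hx.1] at h2
  refine h2.trans ?_
  simp only [add_apply, smul_apply, smul_eq_mul, dpd, Function.comp_def]
  ring

theorem dpd_sum (a : VBChart n m W) (R : Body n X) (i : Fin n) {P : Type*} (s : Finset P)
    {f : P → X → ℝ}
    (hf : ∀ p, ContMDiffWithinAt (quadrant n) 𝓘(ℝ, ℝ) 1 (f p) R.carrier x)
    (hx : x ∈ a.dom ∩ R.carrier) :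
    a.dpd R.carrier i (fun z => ∑ p ∈ s, f p z) x = ∑ p ∈ s, a.dpd R.carrier i (f p) x := by
  have := fderivWithin_fun_sum (u := s) (A := fun p => f p ∘ a.inv)
    (a.uniqueDiffOn_img R _ (a.ext_mem hx)) (fun p _ => a.differentiableWithinAt (hf p) hx)
  have h2 := congrArg (fun L => L (EuclideanSpace.single i 1)) this
  refine h2.trans ?_
  simp [dpd]

/-- The coordinate functions of the chart `a`. -/
def coordFun (a : VBChart n m W) (j : Fin n) (x : X) : ℝ := a.ext x j

theorem smoothOn_coordFun (a : VBChart n m W) (j : Fin n) :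
    SmoothOn n ∞ (a.coordFun j) a.dom := by
  rw [← inter_univ a.dom, a.smoothOn_iff le_rfl]
  have h : ContDiffOn ℝ ∞ (fun y : EuclideanSpace ℝ (Fin n) => y j) (a.img univ) := by
    fun_prop
  refine h.congr fun y hy => ?_
  simp only [Function.comp, coordFun, a.ext_inv hy]

/-- The chain rule for a change of charts. -/
theorem dpd_change (a b : VBChart n m W) (R : Body n X) (i : Fin n)
    (hf : ContMDiffWithinAt (quadrant n) 𝓘(ℝ, ℝ) 1 f R.carrier x)
    (hx : x ∈ (a.dom ∩ b.dom) ∩ R.carrier) :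
    b.dpd R.carrier i f x =
      ∑ j, b.dpd R.carrier i (a.coordFun j) x * a.dpd R.carrier j f x := by
  have hxa : x ∈ a.dom ∩ R.carrier := ⟨hx.1.1, hx.2⟩
  have hxb : x ∈ b.dom ∩ R.carrier := ⟨hx.1.2, hx.2⟩
  -- The change of charts is controlled only on the overlap. This is a relative neighbourhood of the
  -- point, so the derivative within it is the derivative within the whole image.
  set S : Set (EuclideanSpace ℝ (Fin n)) := b.img R.carrier ∩ b.inv ⁻¹' a.dom with hS
  have hSn : S ∈ 𝓝[b.img R.carrier] (b.ext x) := by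
    refine Filter.inter_mem self_mem_nhdsWithin (mem_nhdsWithin_of_mem_nhds ?_)
    refine (b.continuousAt_inv hx.1.2).preimage_mem_nhds ?_
    rw [b.inv_ext hx.1.2]
    exact a.isOpen_dom.mem_nhds hx.1.1
  have hSx : b.ext x ∈ S := mem_of_mem_nhdsWithin (b.ext_mem hxb) hSn
  have hu : UniqueDiffWithinAt ℝ (b.img R.carrier) (b.ext x) :=
    b.uniqueDiffOn_img R _ (b.ext_mem hxb)
  have hu' : UniqueDiffWithinAt ℝ S (b.ext x) := hu.mono_nhds (nhdsWithin_le_of_mem hSn)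
  set τ : EuclideanSpace ℝ (Fin n) → EuclideanSpace ℝ (Fin n) := fun y => a.ext (b.inv y)
  have hτx : τ (b.ext x) = a.ext x := by simp only [τ, b.inv_ext hx.1.2]
  have hτS : MapsTo τ S (a.img R.carrier) := fun y hy => ⟨_, ⟨hy.2, (b.inv_mem hy.1).2⟩, rfl⟩
  have hτd : DifferentiableWithinAt ℝ τ S (b.ext x) := by
    have h1 : DifferentiableWithinAt ℝ ((quadrant n).extendCoordChange b.chart a.chart)
        (range (quadrant n)) (b.ext x) :=
      ((quadrant n).contDiffWithinAt_extendCoordChange' b.chart_mem a.chart_mem hx.1.2.1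
        hx.1.1.1).differentiableWithinAt (by simp)
    refine h1.mono ?_
    rintro _ ⟨⟨z, -, rfl⟩, -⟩
    exact ⟨b.chart z, rfl⟩
  have hτj : ∀ j, fderivWithin ℝ τ S (b.ext x) (EuclideanSpace.single i 1) j =
      b.dpd R.carrier i (a.coordFun j) x := by
    intro j
    have h0 := (EuclideanSpace.proj (𝕜 := ℝ) j).hasFDerivAt.comp_hasFDerivWithinAt _
      hτd.hasFDerivWithinAt
    have h1 := h0.mono_of_mem_nhdsWithin hSn
    have h2 := h1.fderivWithin hu
    exact (congrArg (fun L => L (EuclideanSpace.single i 1)) h2).symm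
  have hfa := a.differentiableWithinAt hf hxa
  rw [← hτx] at hfa
  have h1 := hfa.hasFDerivWithinAt.comp _ hτd.hasFDerivWithinAt hτS
  have h2 : HasFDerivWithinAt (f ∘ b.inv)
      ((fderivWithin ℝ (f ∘ a.inv) (a.img R.carrier) (τ (b.ext x))).comp
        (fderivWithin ℝ τ S (b.ext x))) S (b.ext x) := by
    refine h1.congr (fun y hy => ?_) ?_
    · simp only [Function.comp, τ, a.inv_ext hy.2]
    · simp only [Function.comp, τ, a.inv_ext hSx.2]
  have h3 := (h2.mono_of_mem_nhdsWithin hSn).fderivWithin hu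
  rw [dpd, h3, hτx, ContinuousLinearMap.comp_apply]
  set v := fderivWithin ℝ τ S (b.ext x) (EuclideanSpace.single i 1) with hv
  have hsum : v = ∑ j, v j • EuclideanSpace.single j (1 : ℝ) := by
    ext j
    simp [Pi.single_apply]
  rw [hsum, map_sum]
  refine Finset.sum_congr rfl fun j _ => ?_
  rw [map_smul, hτj j, smul_eq_mul]
  rfl

/-- Derivatives within the image of `R` are unique, and the derivative within the larger image of
`X` is one of them. Hence the coefficients in a change of charts do not depend on the body. -/
theorem dpd_restrict (a : VBChart n m W) (R : Body n X) (i : Fin n)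
    (hf : ContMDiffWithinAt (quadrant n) 𝓘(ℝ, ℝ) 1 f univ x) (hx : x ∈ a.dom ∩ R.carrier) :
    a.dpd R.carrier i f x = a.dpd univ i f x := by
  have h := (a.differentiableWithinAt hf ⟨hx.1, mem_univ x⟩).hasFDerivWithinAt.mono
    (t := a.img univ) (s := a.img R.carrier) (image_mono (inter_subset_inter_right _ (subset_univ _)))
  rw [dpd, h.fderivWithin (a.uniqueDiffOn_img R _ (a.ext_mem hx)), dpd]

/-- The image of the open set `U` is a neighbourhood of each of its points relative to the image of
`X`, so smoothness on `U` controls the derivative within the full image. It keeps the transition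
coefficients smooth under repeated differentiation. -/
theorem smoothOn_dpd [CompactSpace X] [IsManifold (quadrant n) ∞ X] (a : VBChart n m W)
    (i : Fin n) {U : Set X} (hU : IsOpen U) (hUa : U ⊆ a.dom) (hf : SmoothOn n ∞ f U) :
    SmoothOn n ∞ (a.dpd univ i f) U := by
  have hUa' : a.dom ∩ U = U := inter_eq_right.2 hUa
  have h1 : ContDiffOn ℝ ∞ (f ∘ a.inv) (a.img U) := by
    rw [← a.smoothOn_iff le_rfl, hUa']; exact hf
  have hUn : ∀ y ∈ a.img U, a.img U ∈ 𝓝[a.img univ] y := by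
    intro y hy
    have h2 := a.inv_mem hy
    refine mem_nhdsWithin_iff_exists_mem_nhds_inter.2 ⟨a.inv ⁻¹' U, ?_, ?_⟩
    · have := (a.continuousAt_inv h2.1).preimage_mem_nhds (t := U) (by
        rw [a.inv_ext h2.1]; exact hU.mem_nhds h2.2)
      rwa [a.ext_inv hy] at this
    · rintro z ⟨hz, hz'⟩
      exact ⟨a.inv z, ⟨(a.inv_mem hz').1, hz⟩, a.ext_inv hz'⟩
  have hsub : a.img U ⊆ a.img univ := image_mono (inter_subset_inter_right _ (subset_univ _))
  have hun : UniqueDiffOn ℝ (a.img univ) := a.uniqueDiffOn_img (Body.whole n X)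
  have h4 : ContDiffOn ℝ ∞ (fun y => fderivWithin ℝ (f ∘ a.inv) (a.img univ) y
      (EuclideanSpace.single i 1)) (a.img U) := by
    intro y hy
    have h2 : ContDiffWithinAt ℝ ∞ (f ∘ a.inv) (a.img univ) y :=
      (h1 y hy).mono_of_mem_nhdsWithin (hUn y hy)
    have h3 := h2.fderivWithin_right (m := ∞) hun (by simp) (hsub hy)
    exact (h3.clm_apply contDiffWithinAt_const).mono hsub
  rw [← hUa', a.smoothOn_iff le_rfl]
  refine h4.congr fun y hy => ?_
  simp only [Function.comp, dpd, a.ext_inv hy]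

end VBChart

end ChartDerivatives

/-! ### Sections in terms of their components on `X` -/

section Sections

variable {n m k : ℕ} {X : Type u} [TopologicalSpace X] [ChartedSpace (EuclideanQuadrant n) X]
  {W : X → Type u} [∀ x, AddCommGroup (W x)] [∀ x, Module ℝ (W x)]
  [TopologicalSpace (TotalSpace (EuclideanSpace ℝ (Fin m)) W)] [∀ x, TopologicalSpace (W x)]
  [FiberBundle (EuclideanSpace ℝ (Fin m)) W] {ι : Type}

namespace CoordBundle

/-- The components of a section with respect to the chart `a`, as functions on `X`. -/
def comp (E : CoordBundle n m W ι) (a : VBChart n m W) (s : ∀ x, E.Fib x) (c : ι) (x : X) : ℝ :=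
  E.coord a x (s x) c

theorem mem_sec_iff (E : CoordBundle n m W ι) (R : Body n X) (s : ∀ x, E.Fib x) :
    s ∈ E.Sec R k ↔ (∀ x ∉ R.carrier, s x = 0) ∧
      ∀ a c, SmoothOn n k (E.comp a s c) (a.dom ∩ R.carrier) := by
  refine and_congr_right fun _ => forall_congr' fun a => forall_congr' fun c => ?_
  rw [a.smoothOn_iff (by exact_mod_cast le_top)]
  rfl

theorem Sec.smoothOn {E : CoordBundle n m W ι} {R : Body n X} (s : E.Sec R k)
    (a : VBChart n m W) (c : ι) : SmoothOn n k (E.comp a s.1 c) (a.dom ∩ R.carrier) :=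
  ((E.mem_sec_iff R s.1).1 s.2).2 a c

theorem Sec.comp_eq_zero {E : CoordBundle n m W ι} {R : Body n X} (s : E.Sec R k)
    (a : VBChart n m W) (c : ι) {x : X} (hx : x ∉ R.carrier) : E.comp a s.1 c x = 0 := by
  rw [comp, s.2.1 x hx, map_zero]; rfl

theorem rep_eq_comp (E : CoordBundle n m W ι) (a : VBChart n m W) (s : ∀ x, E.Fib x)
    (y : EuclideanSpace ℝ (Fin n)) (c : ι) : E.rep a s y c = E.comp a s c (a.inv y) := rfl

/-- On `U_a ∩ R` the coordinates of the jet of `s` are the partial derivatives of `s`. -/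
theorem jetBundle_coord_mk (E : CoordBundle n m W ι) (R : Body n X) (r : ℕ) (a : VBChart n m W)
    {x : X} (hx : x ∈ a.dom ∩ R.carrier) (s : E.Sec R r) (p : JetIdx n r × ι) :
    (E.jetBundle R r).coord a x (Submodule.Quotient.mk s) p =
      a.pd R.carrier p.1.2.1 (E.comp a s.1 p.2) x := by
  simp only [jetBundle]
  rw [dif_pos hx]
  rfl

end CoordBundle

end Sections

/-! ### Polynomials with prescribed Taylor coefficients -/

section Polynomials

variable {n : ℕ}

/-- The monomial `∏ₗ (y - y₀)^{i_l}`, up to a constant, has only one nonzero partial derivative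
at `y₀`. -/
theorem exists_contDiff_partial_eq_single {r : ℕ} (y₀ : EuclideanSpace ℝ (Fin n))
    (p : JetIdx n r) : ∃ f : EuclideanSpace ℝ (Fin n) → ℝ, ContDiff ℝ ∞ f ∧
      ∀ q : JetIdx n r, iteratedFDeriv ℝ q.1 f y₀ (fun l => EuclideanSpace.single (q.2.1 l) 1) =
        if q = p then 1 else 0 := by
  classical
  obtain ⟨k, I, hI⟩ := p
  set M : ContinuousMultilinearMap ℝ (fun _ : Fin k => EuclideanSpace ℝ (Fin n)) ℝ :=
    (ContinuousMultilinearMap.mkPiAlgebra ℝ (Fin k) ℝ).compContinuousLinearMap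
      fun l => EuclideanSpace.proj (I l) with hM
  have hMa : ∀ v, M v = ∏ l, v l (I l) := fun v => by simp [hM]
  set p : FormalMultilinearSeries ℝ (EuclideanSpace ℝ (Fin n)) ℝ := fun j =>
    if h : j = k then h ▸ M else 0 with hp
  have hpk : p k = M := by simp [hp]
  have hpj : ∀ j : ℕ, j ≠ k → p j = 0 := fun j hj => by simp [hp, hj]
  set f : EuclideanSpace ℝ (Fin n) → ℝ := fun y => ∏ l, (y - y₀) (I l) with hf
  have hfc : ContDiff ℝ ω f := by
    refine contDiff_prod fun l _ => ?_
    exact (EuclideanSpace.proj (𝕜 := ℝ) (I l)).contDiff.comp (contDiff_id.sub contDiff_const)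
  have hps : HasFPowerSeriesOnBall f p y₀ ⊤ :=
    (HasFiniteFPowerSeriesOnBall.mk' (n := k + 1) (fun j hj => hpj j (by omega)) (by simp)
      (fun y _ => by
        rw [Finset.sum_eq_single (k : ℕ)]
        · rw [hpk, hMa]; simp [hf]
        · intro j _ hj; rw [hpj j hj]; rfl
        · intro h; simp at h)).toHasFPowerSeriesOnBall
  -- The `j`-th derivative of an analytic function at the centre is the symmetrization of the `j`-th
  -- term of its series. Here only the term of degree `k` is nonzero.
  have hder := fun (j : ℕ) (v : Fin j → EuclideanSpace ℝ (Fin n)) =>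
    hps.iteratedFDeriv_eq_sum (n := j) hfc.contDiffOn.analyticOn v
  -- The number of permutations stabilizing `I`, that is, the multi-index factorial by which the
  -- monomial is normalized.
  set N : ℝ := ∑ σ : Equiv.Perm (Fin k), if I ∘ σ = I then 1 else 0 with hN
  have hNpos : N ≠ 0 := by
    refine (Finset.sum_pos' (fun σ _ => by split_ifs <;> simp) ⟨1, Finset.mem_univ _, ?_⟩).ne'
    simp
  refine ⟨fun y => N⁻¹ * f y, (contDiff_const.mul hfc).of_le le_top, ?_⟩
  rintro ⟨j, J, hJ⟩
  have h1 : iteratedFDeriv ℝ j (fun y => N⁻¹ * f y) y₀ (fun l => EuclideanSpace.single (J l) 1) =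
      N⁻¹ * iteratedFDeriv ℝ j f y₀ (fun l => EuclideanSpace.single (J l) 1) := by
    have := iteratedFDeriv_const_smul_apply (𝕜 := ℝ) (i := j) (a := N⁻¹) (f := f) (x := y₀)
      (hfc.contDiffAt.of_le le_top)
    exact congrArg (fun L => L fun l => EuclideanSpace.single (J l) 1) this
  simp only
  rw [h1, hder]
  by_cases hjk : j = k
  · subst hjk
    have h2 : ∀ σ : Equiv.Perm (Fin j),
        p j (fun i => EuclideanSpace.single (J (σ i)) 1) = if J ∘ σ = I then 1 else 0 := by
      intro σ
      rw [hpk, hMa]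
      split_ifs with h
      · refine Finset.prod_eq_one fun l _ => ?_
        have := congrFun h l
        simp only [Function.comp] at this
        simp [this]
      · obtain ⟨l, hl⟩ := Function.ne_iff.1 h
        refine Finset.prod_eq_zero (Finset.mem_univ l) ?_
        simpa using fun h' => hl h'.symm
    simp only [h2]
    by_cases hJI : J = I
    · subst hJI
      rw [← hN, inv_mul_cancel₀ hNpos]
      simp
    · rw [Finset.sum_eq_zero, mul_zero, if_neg]
      · intro h
        simp only [Sigma.mk.injEq, heq_eq_eq, true_and, Subtype.mk.injEq] at h
        exact hJI h
      · intro σ _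
        rw [if_neg]
        intro h
        refine hJI ?_
        -- Two non-decreasing rearrangements of the same tuple coincide.
        have := Tuple.unique_monotone (f := J) (σ := σ) (τ := 1) (by rw [h]; exact hI)
          (by simpa using hJ)
        rw [h] at this
        simpa using this.symm
  · rw [Finset.sum_eq_zero, mul_zero, if_neg]
    · intro h
      exact hjk (congrArg Sigma.fst h)
    · intro σ _
      rw [hpj j fun h => hjk (Fin.ext h)]
      rfl

/-- The Taylor coefficients up to order `r` of a smooth function can be prescribed. -/
theorem exists_contDiff_partial_eq {r : ℕ} (y₀ : EuclideanSpace ℝ (Fin n))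
    (v : JetIdx n r → ℝ) : ∃ f : EuclideanSpace ℝ (Fin n) → ℝ, ContDiff ℝ ∞ f ∧
      ∀ q : JetIdx n r, iteratedFDeriv ℝ q.1 f y₀ (fun l => EuclideanSpace.single (q.2.1 l) 1) =
        v q := by
  classical
  choose f hf hfv using exists_contDiff_partial_eq_single (r := r) y₀
  have hvf : ∀ p, ContDiff ℝ ∞ fun y => v p • f p y := fun p => contDiff_const.mul (hf p)
  refine ⟨fun y => ∑ p, v p • f p y, ContDiff.sum fun p _ => hvf p, ?_⟩
  intro q
  have h1 : iteratedFDeriv ℝ q.1 (fun y => ∑ p, v p • f p y) y₀ =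
      ∑ p, v p • iteratedFDeriv ℝ q.1 (f p) y₀ := by
    have hle : ((q.1 : ℕ) : ℕ∞ω) ≤ ∞ := by exact_mod_cast le_top
    rw [iteratedFDeriv_fun_sum_apply (fun p _ => (hvf p).contDiffAt.of_le hle)]
    refine Finset.sum_congr rfl fun p _ => ?_
    exact iteratedFDeriv_const_smul_apply (𝕜 := ℝ) (a := v p) (f := f p) (x := y₀)
      ((hf p).contDiffAt.of_le hle)
  rw [h1]
  simp only [sum_apply, smul_apply, hfv]
  simp

end Polynomials

/-! ### Families of bundles with smooth transition matrices -/

section Tame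

variable {n m : ℕ} {X : Type u} [TopologicalSpace X] [ChartedSpace (EuclideanQuadrant n) X]
  {W : X → Type u} [∀ x, AddCommGroup (W x)] [∀ x, Module ℝ (W x)]
  [TopologicalSpace (TotalSpace (EuclideanSpace ℝ (Fin m)) W)] [∀ x, TopologicalSpace (W x)]
  [FiberBundle (EuclideanSpace ℝ (Fin m)) W] {ι : Type} [Fintype ι]

/-- A family of bundles `E R` over the bodies `R`, all with the same smooth transition matrices
`T a b` between the fibre coordinates of the charts `a` and `b`, which are linear isomorphisms
`E_x → ℝ^ι` at the points `x` of `R`. -/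
structure IsTame (E : Body n X → CoordBundle n m W ι)
    (T : VBChart n m W → VBChart n m W → X → ι → ι → ℝ) : Prop where
  smooth : ∀ a b c d, SmoothOn n ∞ (fun x => T a b x c d) (a.dom ∩ b.dom)
  change : ∀ (R : Body n X) (a b : VBChart n m W) (x : X), x ∈ (a.dom ∩ b.dom) ∩ R.carrier →
    ∀ ξ c, (E R).coord b x ξ c = ∑ d, T a b x c d * (E R).coord a x ξ d
  injective : ∀ (R : Body n X) (a : VBChart n m W) (x : X), x ∈ a.dom ∩ R.carrier →
    Function.Injective ((E R).coord a x)
  surjective : ∀ (R : Body n X) (a : VBChart n m W) (x : X), x ∈ a.dom ∩ R.carrier →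
    Function.Surjective ((E R).coord a x)

theorem SmoothOn.contMDiffWithinAt {a : VBChart n m W} {k l : ℕ} {f : X → ℝ} {R : Set X}
    (hf : SmoothOn n (l : ℕ) f (a.dom ∩ R)) (hkl : k ≤ l) {x : X} (hx : x ∈ a.dom ∩ R) :
    ContMDiffWithinAt (quadrant n) 𝓘(ℝ, ℝ) k f R x := by
  refine ((hf x hx).of_le (by exact_mod_cast hkl)).mono_of_mem_nhdsWithin ?_
  exact Filter.inter_mem (mem_nhdsWithin_of_mem_nhds (a.isOpen_dom.mem_nhds hx.1))
    self_mem_nhdsWithin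

/-- Column `d` of the transition matrix is the image of the basis vector `e_d` under the change of
trivialization, which is fibrewise linear and smooth. -/
theorem exists_isTame_base : ∃ T, IsTame (fun _ : Body n X => baseBundle n m W) T := by
  refine ⟨fun a b x c d => (b.triv ⟨x, a.triv.symm x (EuclideanSpace.single d 1)⟩).2 c,
    ?_, ?_, ?_, ?_⟩
  · intro a b c d
    have h1 : ContMDiffOn (quadrant n) ((quadrant n).prod 𝓘(ℝ, EuclideanSpace ℝ (Fin m))) ∞
        (fun x => a.triv.toOpenPartialHomeomorph.symm (x, EuclideanSpace.single d 1))
        (a.dom ∩ b.dom) := by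
      refine a.contMDiffOn_triv_symm.comp (contMDiffOn_id.prodMk contMDiffOn_const) ?_
      intro x hx
      exact a.triv.mem_target.2 hx.1.2
    have h2 := b.contMDiffOn_triv.comp h1 (fun x hx => by
      refine b.triv.mem_source.2 ?_
      rw [a.triv.proj_symm_apply (a.triv.mem_target.2 hx.1.2)]
      exact hx.2.2)
    have h3 := (contMDiff_snd (I := quadrant n) (J := 𝓘(ℝ, EuclideanSpace ℝ (Fin m)))
      (n := ∞)).comp_contMDiffOn h2
    have h4 := (EuclideanSpace.proj (𝕜 := ℝ) c).contMDiff (n := ∞) |>.comp_contMDiffOn h3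
    refine h4.congr fun x hx => ?_
    have := a.triv.mk_symm hx.1.2 (EuclideanSpace.single d (1 : ℝ))
    simp only [Function.comp]
    rw [← this]
    rfl
  · intro R a b x hx ξ c
    have := a.isLinear
    have := b.isLinear
    change b.triv.linearMapAt ℝ x ξ c = ∑ d, _ * a.triv.linearMapAt ℝ x ξ d
    have h1 : ξ = ∑ d, (a.triv.linearMapAt ℝ x ξ d) •
        a.triv.symmₗ ℝ x (EuclideanSpace.single d (1 : ℝ)) := by
      conv_lhs => rw [← a.triv.symmₗ_linearMapAt (R := ℝ) hx.1.1.2 ξ]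
      simp only [← map_smul, ← map_sum]
      congr 1
      ext d
      simp [Pi.single_apply]
    conv_lhs => rw [h1]
    simp only [map_sum, map_smul, WithLp.ofLp_sum, WithLp.ofLp_smul, Finset.sum_apply,
      Pi.smul_apply, smul_eq_mul]
    refine Finset.sum_congr rfl fun d _ => ?_
    rw [mul_comm, b.triv.coe_linearMapAt_of_mem hx.1.2.2, a.triv.coe_symmₗ]
    exact hx.1.1.2
  · intro R a x hx ξ η h
    have := a.isLinear
    have h1 : a.triv.linearMapAt ℝ x ξ = a.triv.linearMapAt ℝ x η :=
      (EuclideanSpace.equiv (Fin m) ℝ).injective h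
    rw [← a.triv.symmₗ_linearMapAt (R := ℝ) hx.1.2 ξ, h1]
    exact a.triv.symmₗ_linearMapAt hx.1.2 η
  · intro R a x hx v
    have := a.isLinear
    refine ⟨a.triv.symmₗ ℝ x ((EuclideanSpace.equiv (Fin m) ℝ).symm v), ?_⟩
    change (EuclideanSpace.equiv (Fin m) ℝ) (a.triv.linearMapAt ℝ x _) = v
    rw [a.triv.linearMapAt_symmₗ hx.1.2]
    rfl

namespace IsTame

variable {E : Body n X → CoordBundle n m W ι}
  {T : VBChart n m W → VBChart n m W → X → ι → ι → ℝ}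

/-- A section with given components in one chart, supported in the domain of the chart. -/
theorem exists_sec (hE : IsTame E T) (R : Body n X) (a : VBChart n m W) {k : ℕ}
    (f : X → ι → ℝ) {C : Set X} (hC : IsClosed C) (hCa : C ⊆ a.dom) (hf0 : ∀ x ∉ C, f x = 0)
    (hf : ∀ c, SmoothOn n k (fun x => f x c) (a.dom ∩ R.carrier)) :
    ∃ s ∈ (E R).Sec R k, (∀ x ∈ a.dom ∩ R.carrier, ∀ c, (E R).comp a s c x = f x c) ∧
      ∀ x ∉ C, s x = 0 := by
  classical
  choose! g hg using fun x (hx : x ∈ a.dom ∩ R.carrier) => hE.surjective R a x hx (f x)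
  set s : ∀ x, (E R).Fib x := fun x => if x ∈ a.dom ∩ R.carrier then g x else 0 with hs
  have hsx : ∀ x ∈ a.dom ∩ R.carrier, (E R).coord a x (s x) = f x := by
    intro x hx
    simp only [hs, if_pos hx, hg x hx]
  have hs0 : ∀ x ∉ C, s x = 0 := by
    intro x hx
    by_cases hxa : x ∈ a.dom ∩ R.carrier
    · refine hE.injective R a x hxa ?_
      rw [hsx x hxa, hf0 x hx, map_zero]
    · simp only [hs, if_neg hxa]
  refine ⟨s, ((E R).mem_sec_iff R s).2 ⟨fun x hx => ?_, fun b c x hx => ?_⟩,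
    fun x hx c => congrFun (hsx x hx) c, hs0⟩
  · simp only [hs]
    rw [if_neg fun h => hx h.2]
  -- In another chart `b` the components are obtained through the transition matrix at points of
  -- `a.dom`. At the other points the section vanishes nearby, since `C` is closed and contained in
  -- `a.dom`.
  · by_cases hxa : x ∈ a.dom
    · have h1 : ContMDiffWithinAt (quadrant n) 𝓘(ℝ, ℝ) k
          (fun z => ∑ d, T a b z c d * f z d) (b.dom ∩ R.carrier) x := by
        refine contMDiffWithinAt_finsetSum fun d _ => ?_
        refine ContMDiffWithinAt.mul ?_ ?_
        · refine (((hE.smooth a b c d x ⟨hxa, hx.1⟩).contMDiffAt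
            ((a.isOpen_dom.inter b.isOpen_dom).mem_nhds ⟨hxa, hx.1⟩)).of_le ?_).contMDiffWithinAt
          exact_mod_cast le_top
        · exact (SmoothOn.contMDiffWithinAt (hf d) le_rfl ⟨hxa, hx.2⟩).mono inter_subset_right
      refine h1.congr_of_eventuallyEq ?_ ?_
      · filter_upwards [mem_nhdsWithin_of_mem_nhds (a.isOpen_dom.mem_nhds hxa),
          self_mem_nhdsWithin] with z hza hz
        rw [CoordBundle.comp, hE.change R a b z ⟨⟨hza, hz.1⟩, hz.2⟩, hsx z ⟨hza, hz.2⟩]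
      · rw [CoordBundle.comp, hE.change R a b x ⟨⟨hxa, hx.1⟩, hx.2⟩, hsx x ⟨hxa, hx.2⟩]
    · have hxC : x ∉ C := fun h => hxa (hCa h)
      refine (contMDiffWithinAt_const (c := (0 : ℝ))).congr_of_eventuallyEq ?_ ?_
      · filter_upwards [mem_nhdsWithin_of_mem_nhds (hC.isOpen_compl.mem_nhds hxC)] with z hz
        rw [CoordBundle.comp, hs0 z hz, map_zero]; rfl
      · rw [CoordBundle.comp, hs0 x hxC, map_zero]; rfl

variable [IsManifold (quadrant n) ∞ X] [CompactSpace X]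

/-- In a change of charts the partial derivatives of a section are linear combinations with smooth
coefficients, which do not depend on the body, of the partial derivatives of at most the same
order. -/
theorem exists_pd_change (hE : IsTame E T) (a b : VBChart n m W) {k : ℕ} (J : Fin k → Fin n)
    (c : ι) : ∃ (P : Type) (_ : Fintype P) (q : P → X → ℝ) (len : P → ℕ)
      (I : ∀ p, Fin (len p) → Fin n) (d : P → ι), (∀ p, len p ≤ k) ∧
      (∀ p, SmoothOn n ∞ (q p) (a.dom ∩ b.dom)) ∧
      ∀ (R : Body n X) (s : (E R).Sec R k) (x : X), x ∈ (a.dom ∩ b.dom) ∩ R.carrier →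
        b.pd R.carrier J ((E R).comp b s.1 c) x =
          ∑ p, q p x * a.pd R.carrier (I p) ((E R).comp a s.1 (d p)) x := by
  induction k with
  | zero =>
    refine ⟨ι, inferInstance, fun d x => T a b x c d, fun _ => 0, fun _ => Fin.elim0, id,
      fun _ => le_rfl, fun d => hE.smooth a b c d, fun R s x hx => ?_⟩
    rw [b.pd_zero _ _ _ hx.1.2, CoordBundle.comp, hE.change R a b x hx]
    refine Finset.sum_congr rfl fun d _ => ?_
    rw [a.pd_zero _ _ _ hx.1.1]
    rfl
  | succ k ih =>
    obtain ⟨P, _, q, len, I, d, hlen, hq, hP⟩ := ih (Fin.tail J)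
    -- The product rule gives two kinds of terms: the new derivative falls on a coefficient, or on a
    -- partial derivative of the section. In the latter case the chain rule expands it in the `n`
    -- directions of the chart `a`.
    refine ⟨P ⊕ (P × Fin n), inferInstance,
      Sum.elim (fun p => b.dpd univ (J 0) (q p))
        (fun p x => q p.1 x * b.dpd univ (J 0) (a.coordFun p.2) x),
      Sum.elim len (fun p => len p.1 + 1),
      fun p => match p with
        | .inl p => I p
        | .inr p => Fin.cons p.2 (I p.1),
      Sum.elim d (fun p => d p.1), ?_, ?_, fun R s x hx => ?_⟩
    · rintro (p | p)
      · exact (hlen p).trans (Nat.le_succ _)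
      · exact Nat.succ_le_succ (hlen p.1)
    · have hU := a.isOpen_dom.inter b.isOpen_dom
      rintro (p | p)
      · exact b.smoothOn_dpd _ hU inter_subset_right (hq p)
      · exact (hq p.1).mul (b.smoothOn_dpd _ hU inter_subset_right
          ((a.smoothOn_coordFun p.2).mono inter_subset_left))
    · have hxa : x ∈ a.dom ∩ R.carrier := ⟨hx.1.1, hx.2⟩
      have hxb : x ∈ b.dom ∩ R.carrier := ⟨hx.1.2, hx.2⟩
      have hqx : ∀ p, ContMDiffAt (quadrant n) 𝓘(ℝ, ℝ) 1 (q p) x := fun p =>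
        ((hq p x hx.1).contMDiffAt ((a.isOpen_dom.inter b.isOpen_dom).mem_nhds hx.1)).of_le
          (by simp)
      have hcx : ∀ j, ContMDiffAt (quadrant n) 𝓘(ℝ, ℝ) 1 (a.coordFun j) x := fun j =>
        ((a.smoothOn_coordFun j x hx.1.1).contMDiffAt (a.isOpen_dom.mem_nhds hx.1.1)).of_le
          (by simp)
      have hpx : ∀ p, ContMDiffWithinAt (quadrant n) 𝓘(ℝ, ℝ) 1
          (a.pd R.carrier (I p) ((E R).comp a s.1 (d p))) R.carrier x := fun p => by
        have := a.smoothOn_pd R (I p) (CoordBundle.Sec.smoothOn s a (d p)) (j := 1)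
          (by have := hlen p; omega)
        exact SmoothOn.contMDiffWithinAt this le_rfl hxa
      rw [b.pd_succ R J (CoordBundle.Sec.smoothOn s b c) hxb]
      -- The inductive formula may be differentiated because it holds near `x` in `R`, not only at
      -- `x`.
      have hgerm : b.pd R.carrier (Fin.tail J) ((E R).comp b s.1 c) =ᶠ[𝓝[R.carrier] x]
          fun z => ∑ p, q p z * a.pd R.carrier (I p) ((E R).comp a s.1 (d p)) z := by
        filter_upwards [mem_nhdsWithin_of_mem_nhds
          ((a.isOpen_dom.inter b.isOpen_dom).mem_nhds hx.1), self_mem_nhdsWithin] with z hz hzR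
        exact hP R ⟨s.1, CoordBundle.Sec.mono (E R) R (Nat.le_succ k) s.2⟩ z ⟨hz, hzR⟩
      rw [b.dpd_congr _ _ hgerm hxb, b.dpd_sum R _ _
        (f := fun p z => q p z * a.pd R.carrier (I p) ((E R).comp a s.1 (d p)) z)
        (fun p => ((hqx p).contMDiffWithinAt).mul (hpx p)) hxb, Fintype.sum_sum_type,
        Fintype.sum_prod_type, ← Finset.sum_add_distrib]
      refine Finset.sum_congr rfl fun p _ => ?_
      rw [b.dpd_mul R _ (hqx p).contMDiffWithinAt (hpx p) hxb,
        b.dpd_restrict R _ (hqx p).contMDiffWithinAt hxb, a.dpd_change b R _ (hpx p) hx,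
        Finset.mul_sum]
      refine congrArg₂ (· + ·) rfl (Finset.sum_congr rfl fun j _ => ?_)
      have hsm : SmoothOn n (len p + 1 : ℕ) ((E R).comp a s.1 (d p)) (a.dom ∩ R.carrier) :=
        (CoordBundle.Sec.smoothOn s a (d p)).of_le
          (by exact_mod_cast Nat.succ_le_succ (hlen p))
      have h3 := a.pd_succ R (Fin.cons j (I p)) hsm hxa
      simp only [Fin.cons_zero, Fin.tail_cons] at h3
      simp only [Sum.elim_inr]
      rw [h3, b.dpd_restrict R _ (hcx j).contMDiffWithinAt hxb, mul_assoc]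

end IsTame

end Tame

/-! ### Transition matrices of jet bundles -/

section TameJets

variable {n m : ℕ} {X : Type u} [TopologicalSpace X] [ChartedSpace (EuclideanQuadrant n) X]
  {W : X → Type u} [∀ x, AddCommGroup (W x)] [∀ x, Module ℝ (W x)]
  [TopologicalSpace (TotalSpace (EuclideanSpace ℝ (Fin m)) W)] [∀ x, TopologicalSpace (W x)]
  [FiberBundle (EuclideanSpace ℝ (Fin m)) W] {ι : Type}

/-- The non-decreasing rearrangement of a multi-index. -/
def JetIdx.sort {r k : ℕ} (hk : k ≤ r) (I : Fin k → Fin n) : JetIdx n r :=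
  ⟨⟨k, Nat.lt_succ_of_le hk⟩, I ∘ Tuple.sort I, Tuple.monotone_sort I⟩

/-- Jet coordinates are indexed by non-decreasing multi-indices only, while the chain rule and the
`C^r`-norm involve arbitrary ones. Commuting partial derivatives reconcile the two. -/
theorem VBChart.pd_sort (a : VBChart n m W) (R : Body n X) {r k : ℕ} (hk : k ≤ r)
    (I : Fin k → Fin n) {f : X → ℝ} (hf : SmoothOn n (r : ℕ) f (a.dom ∩ R.carrier)) {x : X}
    (hx : x ∈ a.dom ∩ R.carrier) :
    a.pd R.carrier (JetIdx.sort hk I).2.1 f x = a.pd R.carrier I f x :=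
  a.pd_comp_perm R I (hf.of_le (by exact_mod_cast hk)) hx _

variable [IsManifold (quadrant n) ∞ X] [CompactSpace X] [T2Space X]

/-- A smooth function supported in a given neighbourhood and equal to one near the point. -/
theorem exists_bump (x : X) {U : Set X} (hU : U ∈ 𝓝 x) : ∃ (ρ : X → ℝ) (C : Set X),
    IsClosed C ∧ C ⊆ U ∧ SmoothOn n ∞ ρ univ ∧ (∀ᶠ z in 𝓝 x, ρ z = 1) ∧ (∀ z ∉ C, ρ z = 0) ∧
      ∀ z, ρ z ∈ Icc (0 : ℝ) 1 := by
  obtain ⟨C, hCx, hC, hCU⟩ := exists_mem_nhds_isClosed_subset hU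
  obtain ⟨f, hf1, hf0, hf01⟩ := exists_contMDiffMap_one_nhds_of_subset_interior (quadrant n)
    (n := ⊤) (isClosed_singleton (x := x))
    (singleton_subset_iff.2 (mem_interior_iff_mem_nhds.2 hCx))
  rw [nhdsSet_singleton] at hf1
  exact ⟨f, C, hC, hCU, f.contMDiff.contMDiffOn, hf1, hf0, hf01⟩

/-- Near a point, a given jet is the jet of a function supported in the chart domain. -/
theorem VBChart.exists_jet (a : VBChart n m W) (r : ℕ) {x : X} (hx : x ∈ a.dom)
    (v : JetIdx n r × ι → ℝ) : ∃ (f : X → ι → ℝ) (C : Set X), IsClosed C ∧ C ⊆ a.dom ∧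
      (∀ z ∉ C, f z = 0) ∧ (∀ c, SmoothOn n ∞ (fun z => f z c) a.dom) ∧
      ∀ (R : Body n X), x ∈ R.carrier →
        ∀ p c, a.pd R.carrier p.2.1 (fun z => f z c) x = v (p, c) := by
  obtain ⟨ρ, C, hC, hCa, hρ, hρ1, hρ0, -⟩ := exists_bump (n := n) x (a.isOpen_dom.mem_nhds hx)
  -- A polynomial with the given Taylor coefficients is multiplied by a cut-off equal to one near
  -- `x`, which leaves the germ at `x` unchanged.
  choose P hP hPv using fun c => exists_contDiff_partial_eq (r := r) (a.ext x) fun p => v (p, c)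
  refine ⟨fun z c => ρ z * P c (a.ext z), C, hC, hCa, fun z hz => ?_, fun c => ?_,
    fun R hxR p c => ?_⟩
  · funext c; simp [hρ0 z hz]
  · refine (hρ.mono (subset_univ _)).mul ?_
    rw [← inter_univ a.dom]
    refine (a.smoothOn_iff le_rfl (f := fun z => P c (a.ext z))).2 ?_
    refine (hP c).contDiffOn.congr fun y hy => ?_
    simp only [Function.comp, a.ext_inv hy]
  · rw [← hPv c p, VBChart.pd, partialWithin]
    have hxa : x ∈ a.dom ∩ R.carrier := ⟨hx, hxR⟩
    rw [← iteratedFDerivWithin_eq_iteratedFDeriv (a.uniqueDiffOn_img R)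
      ((hP c).contDiffAt.of_le (by exact_mod_cast le_top)) (a.ext_mem hxa)]
    congr 1
    refine Filter.EventuallyEq.iteratedFDerivWithin_eq ?_ ?_ _
    · have h1 : Filter.Tendsto a.inv (𝓝[a.img R.carrier] (a.ext x)) (𝓝 x) := by
        have := (a.continuousAt_inv hx).continuousWithinAt (s := a.img R.carrier)
        rwa [ContinuousWithinAt, a.inv_ext hx] at this
      filter_upwards [h1.eventually hρ1, self_mem_nhdsWithin] with y hy hyR
      simp only [Function.comp, hy, one_mul, a.ext_inv hyR]
    · simp only [Function.comp, a.inv_ext hx, hρ1.self_of_nhds, one_mul]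

variable [Fintype ι] {E : Body n X → CoordBundle n m W ι}
  {T : VBChart n m W → VBChart n m W → X → ι → ι → ℝ}

/-- The jet bundles of a tame family of bundles form a tame family. -/
theorem IsTame.exists_jetBundle (hE : IsTame E T) (r : ℕ) :
    ∃ T', IsTame (fun R => (E R).jetBundle R r) T' := by
  classical
  choose P hP q len I d hlen hq hpd using fun (a b : VBChart n m W) (p : JetIdx n r × ι) =>
    hE.exists_pd_change a b p.1.2.1 p.2
  have hle : ∀ a b p j, len a b p j ≤ r := fun a b p j =>
    (hlen a b p j).trans (Nat.lt_succ_iff.1 p.1.1.2)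
  -- The entry at `p'` collects all coefficients whose multi-index and component become `p'` after
  -- sorting, as several terms may lead to the same jet coordinate.
  have hch : ∀ (R : Body n X) (a b : VBChart n m W) (x : X), x ∈ (a.dom ∩ b.dom) ∩ R.carrier →
      ∀ (ξ : (E R).Sec R r ⧸ (E R).vanishing R r x) p,
      ((E R).jetBundle R r).coord b x ξ p =
        ∑ p', (∑ j, if (JetIdx.sort (hle a b p j) (I a b p j), d a b p j) = p'
          then q a b p j x else 0) * ((E R).jetBundle R r).coord a x ξ p' := by
    intro R a b x hx ξ p
    have hxa : x ∈ a.dom ∩ R.carrier := ⟨hx.1.1, hx.2⟩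
    obtain ⟨s, rfl⟩ := Submodule.Quotient.mk_surjective _ ξ
    have hps : s.1 ∈ (E R).Sec R p.1.1 :=
      CoordBundle.Sec.mono (E R) R (Nat.lt_succ_iff.1 p.1.1.2) s.2
    rw [(E R).jetBundle_coord_mk R r b ⟨hx.1.2, hx.2⟩, hpd a b p R ⟨s.1, hps⟩ x hx]
    simp only [Finset.sum_mul]
    rw [Finset.sum_comm]
    refine Finset.sum_congr rfl fun j _ => ?_
    rw [Finset.sum_eq_single (JetIdx.sort (hle a b p j) (I a b p j), d a b p j)]
    · rw [if_pos rfl, (E R).jetBundle_coord_mk R r a hxa, a.pd_sort R _ _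
        (CoordBundle.Sec.smoothOn s a _) hxa]
    · intro p' _ hp'
      rw [if_neg hp'.symm, zero_mul]
    · intro h
      exact absurd (Finset.mem_univ _) h
  refine ⟨fun a b x p p' => ∑ j, if (JetIdx.sort (hle a b p j) (I a b p j), d a b p j) = p'
    then q a b p j x else 0, ?_, hch, ?_, ?_⟩
  · intro a b p p'
    refine contMDiffOn_finsetSum fun j _ => ?_
    split_ifs
    · exact hq a b p j
    · exact contMDiffOn_const
  · intro R a x hx
    rw [← LinearMap.ker_eq_bot, LinearMap.ker_eq_bot']
    intro ξ hξ
    obtain ⟨s, rfl⟩ := Submodule.Quotient.mk_surjective _ ξ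
    refine (Submodule.Quotient.mk_eq_zero _).2 ?_
    simp only [CoordBundle.vanishing, Submodule.mem_iInf]
    -- A jet is zero when its coordinates vanish in every chart. `hch` transfers the vanishing from
    -- the chart `a` to any chart `b` around `x`.
    intro b hxb
    refine LinearMap.mem_ker.2 (funext fun p => ?_)
    have h1 := hch R a b x ⟨⟨hx.1, hxb.1⟩, hx.2⟩ (Submodule.Quotient.mk s) p
    rw [(E R).jetBundle_coord_mk R r b hxb, hξ] at h1
    refine Eq.trans ?_ (h1.trans (by simp))
    rfl
  · intro R a x hx v
    obtain ⟨f, C, hC, hCa, hf0, hf, hfv⟩ := a.exists_jet r hx.1 v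
    obtain ⟨s, hs, hsf, -⟩ := hE.exists_sec R a (k := r) f hC hCa hf0
      (fun c => ((hf c).of_le (by exact_mod_cast le_top)).mono inter_subset_left)
    refine ⟨Submodule.Quotient.mk ⟨s, hs⟩, funext fun p => ?_⟩
    rw [(E R).jetBundle_coord_mk R r a hx, ← hfv R hx.2 p.1 p.2]
    exact a.pd_congr _ _ (fun z hz => hsf z hz p.2) hx

theorem exists_isTame_jetB (r : ℕ) : ∃ T, IsTame (fun R : Body n X => jetB m W R r) T := by
  obtain ⟨T, hT⟩ := exists_isTame_base (n := n) (m := m) (W := W)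
  exact hT.exists_jetBundle r

theorem exists_isTame_iterJetB (r : ℕ) :
    ∃ T, IsTame (fun R : Body n X => iterJetB m W R r) T := by
  induction r with
  | zero => exact exists_isTame_base
  | succ r ih =>
    obtain ⟨T, hT⟩ := ih
    exact hT.exists_jetBundle 1

end TameJets

/-! ### Coordinates of holonomic and iterated jets as partial derivatives -/

section JetCoordinates

variable {n m : ℕ} {X : Type u} [TopologicalSpace X] [ChartedSpace (EuclideanQuadrant n) X]
  {W : X → Type u} [∀ x, AddCommGroup (W x)] [∀ x, Module ℝ (W x)]
  [TopologicalSpace (TotalSpace (EuclideanSpace ℝ (Fin m)) W)] [∀ x, TopologicalSpace (W x)]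
  [FiberBundle (EuclideanSpace ℝ (Fin m)) W]

theorem comp_jet (R : Body n X) (r : ℕ) (w : CrSec m W R r) (a : VBChart n m W) {x : X}
    (hx : x ∈ a.dom ∩ R.carrier) (p : JetIdx n r × Fin m) :
    (jetB m W R r).comp a (jet R r w).1 p x =
      a.pd R.carrier p.1.2.1 ((baseBundle n m W).comp a w.1 p.2) x :=
  (baseBundle n m W).jetBundle_coord_mk R r a hx _ p

theorem comp_iterJetAux_succ (R : Body n X) (r : ℕ) {k l : ℕ} (h : k + (r + 1) ≤ l)
    (w : CrSec m W R l) (a : VBChart n m W) {x : X} (hx : x ∈ a.dom ∩ R.carrier)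
    (p : JetIdx n 1 × IterIdx n m r) :
    (iterJetB m W R (r + 1)).comp a (iterJetAux R (r + 1) h w).1 p x =
      a.pd R.carrier p.1.2.1 ((iterJetB m W R r).comp a
        (iterJetAux R r (k := k + 1) (by omega) w).1 p.2) x :=
  (iterJetB m W R r).jetBundle_coord_mk R 1 a hx _ p

theorem VBChart.pd_one (a : VBChart n m W) (R : Body n X) {f : X → ℝ}
    (hf : SmoothOn n (1 : ℕ) f (a.dom ∩ R.carrier)) {x : X} (hx : x ∈ a.dom ∩ R.carrier)
    (I : Fin 1 → Fin n) : a.pd R.carrier I f x = a.dpd R.carrier (I 0) f x := by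
  rw [a.pd_succ R I hf hx]
  refine a.dpd_congr _ _ ?_ hx
  filter_upwards [mem_nhdsWithin_of_mem_nhds (a.isOpen_dom.mem_nhds hx.1)] with z hz
  exact a.pd_zero _ _ _ hz

/-- Every fibre coordinate of the iterated jet of `w` is a partial derivative of `w`. -/
theorem iterJet_coord_eq_pd (r : ℕ) (θ : IterIdx n m r) : ∃ (k : ℕ) (I : Fin k → Fin n) (α : Fin m),
    k ≤ r ∧ ∀ (R : Body n X) {j l : ℕ} (h : j + r ≤ l) (w : CrSec m W R l) (a : VBChart n m W),
      ∀ x ∈ a.dom ∩ R.carrier, (iterJetB m W R r).comp a (iterJetAux R r h w).1 θ x =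
        a.pd R.carrier I ((baseBundle n m W).comp a w.1 α) x := by
  induction r with
  | zero =>
    refine ⟨0, Fin.elim0, θ, le_rfl, fun R j l h w a x hx => ?_⟩
    rw [a.pd_zero _ _ _ hx.1]
    rfl
  | succ r ih =>
    obtain ⟨⟨⟨⟨k', hk'⟩, J, hJ⟩, θ⟩, rfl⟩ : ∃ p : JetIdx n 1 × IterIdx n m r, p = θ := ⟨θ, rfl⟩
    obtain ⟨k, I, α, hk, hI⟩ := ih θ
    -- Each generation of the iterated jet either keeps the previous coordinate or differentiates it
    -- once.
    have hk1 : k' = 0 ∨ k' = 1 := by omega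
    rcases hk1 with rfl | rfl
    · refine ⟨k, I, α, hk.trans (Nat.le_succ r), fun R j l h w a x hx => ?_⟩
      rw [comp_iterJetAux_succ R r h w a hx, a.pd_zero _ _ _ hx.1]
      exact hI R (by omega) w a x hx
    · refine ⟨k + 1, Fin.cons (J 0) I, α, Nat.succ_le_succ hk, fun R j l h w a x hx => ?_⟩
      have hw : SmoothOn n (k + 1 : ℕ) ((baseBundle n m W).comp a w.1 α) (a.dom ∩ R.carrier) := by
        have hkl : ((k + 1 : ℕ) : ℕ∞ω) ≤ (l : ℕ) := by exact_mod_cast (by omega : k + 1 ≤ l)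
        exact (CoordBundle.Sec.smoothOn (E := baseBundle n m W) w a α).of_le hkl
      rw [comp_iterJetAux_succ R r h w a hx, a.pd_succ R _ hw hx, a.pd_one R _ hx]
      · refine a.dpd_congr _ _ ?_ hx
        filter_upwards [mem_nhdsWithin_of_mem_nhds (a.isOpen_dom.mem_nhds hx.1),
          self_mem_nhdsWithin] with z hz hzR
        exact hI R (by omega) w a z ⟨hz, hzR⟩
      · exact (CoordBundle.Sec.smoothOn (iterJetAux R r (k := j + 1) (by omega) w) a θ).of_le
          (by exact_mod_cast (by omega : 1 ≤ j + 1))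

/-- Every partial derivative of `w` is a fibre coordinate of the iterated jet of `w`. -/
theorem exists_iterJet_coord (r : ℕ) {k : ℕ} (hk : k ≤ r) (I : Fin k → Fin n) (α : Fin m) :
    ∃ θ : IterIdx n m r, ∀ (R : Body n X) {j l : ℕ} (h : j + r ≤ l) (w : CrSec m W R l)
      (a : VBChart n m W), ∀ x ∈ a.dom ∩ R.carrier,
        (iterJetB m W R r).comp a (iterJetAux R r h w).1 θ x =
          a.pd R.carrier I ((baseBundle n m W).comp a w.1 α) x := by
  induction r generalizing k with
  | zero =>
    obtain rfl : k = 0 := by omega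
    refine ⟨α, fun R j l h w a x hx => ?_⟩
    rw [a.pd_zero _ _ _ hx.1]
    rfl
  | succ r ih =>
    rcases k with _ | k
    · obtain ⟨θ, hθ⟩ := ih (Nat.zero_le r) I
      -- When the order of the derivative is exhausted, the remaining generations carry the empty
      -- multi-index.
      refine ⟨(⟨0, Fin.elim0, fun i => i.elim0⟩, θ), fun R j l h w a x hx => ?_⟩
      rw [comp_iterJetAux_succ R r h w a hx, a.pd_zero _ _ _ hx.1]
      exact hθ R (by omega) w a x hx
    · obtain ⟨θ, hθ⟩ := ih (Nat.le_of_succ_le_succ hk) (Fin.tail I)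
      refine ⟨(⟨1, fun _ => I 0, fun _ _ _ => le_rfl⟩, θ), fun R j l h w a x hx => ?_⟩
      have hw : SmoothOn n (k + 1 : ℕ) ((baseBundle n m W).comp a w.1 α) (a.dom ∩ R.carrier) := by
        have hkl : ((k + 1 : ℕ) : ℕ∞ω) ≤ (l : ℕ) := by exact_mod_cast (by omega : k + 1 ≤ l)
        exact (CoordBundle.Sec.smoothOn (E := baseBundle n m W) w a α).of_le hkl
      rw [comp_iterJetAux_succ R r h w a hx, a.pd_succ R _ hw hx]
      refine (a.pd_one R ?_ hx (fun _ => I 0)).trans ?_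
      · exact (CoordBundle.Sec.smoothOn (iterJetAux R r (k := j + 1) (by omega) w) a θ).of_le
          (by exact_mod_cast (by omega : 1 ≤ j + 1))
      · refine a.dpd_congr _ _ ?_ hx
        filter_upwards [mem_nhdsWithin_of_mem_nhds (a.isOpen_dom.mem_nhds hx.1),
          self_mem_nhdsWithin] with z hz hzR
        exact hθ R (by omega) w a z ⟨hz, hzR⟩

end JetCoordinates

/-! ### Bounded measurable test functions and `L¹`-continuous functionals -/

section TestFunctions

variable {X : Type u} [MeasurableSpace X]

/-- Bounded measurable functions. -/
def IsBddMeas (f : X → ℝ) : Prop := Measurable f ∧ ∃ C : ℝ, ∀ x, |f x| ≤ C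

theorem IsBddMeas.sub {f g : X → ℝ} (hf : IsBddMeas f) (hg : IsBddMeas g) :
    IsBddMeas fun x => f x - g x := by
  obtain ⟨C, hC⟩ := hf.2
  obtain ⟨D, hD⟩ := hg.2
  exact ⟨hf.1.sub hg.1, C + D, fun x => (abs_sub _ _).trans (add_le_add (hC x) (hD x))⟩

theorem IsBddMeas.integrable {f : X → ℝ} (hf : IsBddMeas f) (μ : Measure X) [IsFiniteMeasure μ] :
    Integrable f μ := by
  obtain ⟨C, hC⟩ := hf.2
  exact Integrable.of_bound hf.1.aestronglyMeasurable C (Filter.Eventually.of_forall hC)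

variable [TopologicalSpace X]

/-- Bounded measurable functions vanishing outside a compact subset of `U`. -/
structure IsTestFun (U : Set X) (f : X → ℝ) : Prop where
  measurable : Measurable f
  exists_compact : ∃ (K : Set X) (C : ℝ), IsCompact K ∧ K ⊆ U ∧ (∀ x ∉ K, f x = 0) ∧
    ∀ x, |f x| ≤ C

namespace IsTestFun

variable {U V : Set X} {f g : X → ℝ}

theorem isBddMeas (hf : IsTestFun U f) : IsBddMeas f :=
  ⟨hf.measurable, let ⟨_, C, _, _, _, h⟩ := hf.exists_compact; ⟨C, h⟩⟩

theorem mono (hf : IsTestFun U f) (h : U ⊆ V) : IsTestFun V f :=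
  ⟨hf.1, let ⟨K, C, hK, hKU, h0, hC⟩ := hf.2; ⟨K, C, hK, hKU.trans h, h0, hC⟩⟩

theorem bdd_mul (hg : IsBddMeas g) (hf : IsTestFun U f) : IsTestFun U fun x => g x * f x := by
  obtain ⟨K, C, hK, hKU, h0, hC⟩ := hf.2
  obtain ⟨D, hD⟩ := hg.2
  refine ⟨hg.1.mul hf.1, K, D * C, hK, hKU, fun x hx => by rw [h0 x hx, mul_zero], fun x => ?_⟩
  rw [abs_mul]
  exact mul_le_mul (hD x) (hC x) (abs_nonneg _) ((abs_nonneg _).trans (hD x))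

theorem zero : IsTestFun U fun _ => 0 :=
  ⟨measurable_const, ∅, 0, isCompact_empty, empty_subset _, fun _ _ => rfl, fun _ => by simp⟩

theorem add (hf : IsTestFun U f) (hg : IsTestFun U g) : IsTestFun U fun x => f x + g x := by
  obtain ⟨K, C, hK, hKU, h0, hC⟩ := hf.2
  obtain ⟨L, D, hL, hLU, h0', hD⟩ := hg.2
  refine ⟨hf.1.add hg.1, K ∪ L, C + D, hK.union hL, union_subset hKU hLU, fun x hx => ?_,
    fun x => (abs_add_le _ _).trans (add_le_add (hC x) (hD x))⟩
  rw [h0 x fun h => hx (Or.inl h), h0' x fun h => hx (Or.inr h), add_zero]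

theorem sum {P : Type*} (s : Finset P) {f : P → X → ℝ} (hf : ∀ p, IsTestFun U (f p)) :
    IsTestFun U fun x => ∑ p ∈ s, f p x := by
  classical
  induction s using Finset.induction_on with
  | empty => simpa using zero
  | insert p s hp ih =>
    simp only [Finset.sum_insert hp]
    exact (hf p).add ih

/-- Continuity is required on `K` only. This suits sections over a body, whose extension by zero may
jump at the boundary of the body. -/
theorem of_continuousOn [BorelSpace X] [T2Space X] {K : Set X} (hK : IsCompact K) (hKU : K ⊆ U)
    (hf : ContinuousOn f K) (h0 : ∀ x ∉ K, f x = 0) : IsTestFun U f := by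
  classical
  obtain ⟨C, hC⟩ := hK.exists_bound_of_continuousOn hf
  -- The bound `C` on `K` says nothing about its own sign when `K` is empty, hence the maximum with
  -- `0`.
  refine ⟨?_, K, max C 0, hK, hKU, h0, fun x => ?_⟩
  · have h1 := hf.measurable_piecewise (g := fun _ => 0) continuousOn_const hK.measurableSet
    convert! h1 using 1
    funext x
    by_cases hx : x ∈ K
    · rw [piecewise_eq_of_mem _ _ _ hx]
    · rw [piecewise_eq_of_notMem _ _ _ hx, h0 x hx]
  · by_cases hx : x ∈ K
    · exact (hC x hx).trans (le_max_left _ _)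
    · rw [h0 x hx, abs_zero]
      exact le_max_right _ _

end IsTestFun

/-- A functional on the bounded measurable functions which is continuous in the `L¹`-seminorm of
some finite measure. -/
def HasMajorant (Φ : (X → ℝ) → ℝ) : Prop :=
  ∃ ν : Measure X, IsFiniteMeasure ν ∧ ∀ f g, IsBddMeas f → IsBddMeas g →
    |Φ f - Φ g| ≤ ∫ x, |f x - g x| ∂ν

namespace HasMajorant

variable {Φ Ψ : (X → ℝ) → ℝ}

theorem zero : HasMajorant fun _ : X → ℝ => 0 :=
  ⟨0, inferInstance, fun f g _ _ => by simp⟩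

theorem add (hΦ : HasMajorant Φ) (hΨ : HasMajorant Ψ) : HasMajorant fun f => Φ f + Ψ f := by
  obtain ⟨μ, _, hμ⟩ := hΦ
  obtain ⟨ν, _, hν⟩ := hΨ
  refine ⟨μ + ν, inferInstance, fun f g hf hg => ?_⟩
  have hi := fun (ν : Measure X) [IsFiniteMeasure ν] => ((hf.sub hg).integrable ν).abs
  rw [integral_add_measure (hi μ) (hi ν), add_sub_add_comm]
  exact (abs_add_le _ _).trans (add_le_add (hμ f g hf hg) (hν f g hf hg))

theorem neg (hΦ : HasMajorant Φ) : HasMajorant fun f => -Φ f := by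
  obtain ⟨μ, h, hμ⟩ := hΦ
  refine ⟨μ, h, fun f g hf hg => ?_⟩
  rw [← neg_sub', abs_neg]
  exact hμ f g hf hg

theorem sub (hΦ : HasMajorant Φ) (hΨ : HasMajorant Ψ) : HasMajorant fun f => Φ f - Ψ f := by
  simpa only [sub_eq_add_neg] using hΦ.add hΨ.neg

theorem sum {P : Type*} (s : Finset P) {Φ : P → (X → ℝ) → ℝ} (hΦ : ∀ p, HasMajorant (Φ p)) :
    HasMajorant fun f => ∑ p ∈ s, Φ p f := by
  classical
  induction s using Finset.induction_on with
  | empty => simpa using zero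
  | insert p s hp ih =>
    simp only [Finset.sum_insert hp]
    exact (hΦ p).add ih

/-- A functional with a majorant is determined by its values on the continuous functions. -/
theorem eq_of_eq_on_continuous [BorelSpace X] [CompactSpace X] [T2Space X]
    [SecondCountableTopology X] (hΦ : HasMajorant Φ) (hΨ : HasMajorant Ψ)
    (h : ∀ f : X → ℝ, Continuous f → Φ f = Ψ f) {f : X → ℝ} (hf : IsBddMeas f) : Φ f = Ψ f := by
  let : MetricSpace X := TopologicalSpace.metrizableSpaceMetric X
  have hcont : ∀ g : X → ℝ, Continuous g → IsBddMeas g := fun g hg => by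
    obtain ⟨C, hC⟩ := isCompact_univ.exists_bound_of_continuousOn hg.continuousOn
    exact ⟨hg.measurable, C, fun x => hC x (mem_univ x)⟩
  obtain ⟨ν, _, hν⟩ := hΦ.sub hΨ
  rw [← sub_eq_zero, ← abs_nonpos_iff]
  refine le_of_forall_pos_le_add fun ε hε => ?_
  -- `X` carries a metric, so the finite measure `ν` is weakly regular and the bounded continuous
  -- functions are dense in `L¹(ν)`.
  obtain ⟨g, hg, -⟩ := (hf.integrable ν).exists_boundedContinuous_integral_sub_le hε
  have h1 := hν f g hf (hcont g g.continuous)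
  simp only [h g g.continuous, sub_self, sub_zero] at h1
  rw [zero_add]
  exact h1.trans hg

end HasMajorant

end TestFunctions

/-! ### Radon measures on chart images, seen from `X` -/

section ChartMeasures

variable {n m : ℕ} {X : Type u} [TopologicalSpace X] [ChartedSpace (EuclideanQuadrant n) X]
  {W : X → Type u} [∀ x, AddCommGroup (W x)] [∀ x, Module ℝ (W x)]
  [TopologicalSpace (TotalSpace (EuclideanSpace ℝ (Fin m)) W)] [∀ x, TopologicalSpace (W x)]
  [FiberBundle (EuclideanSpace ℝ (Fin m)) W]

/-- Second countability makes the compact Hausdorff space `X` metrizable, which the approximation by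
continuous functions relies on. -/
theorem secondCountableTopology_of_compact (n : ℕ) (X : Type u) [TopologicalSpace X]
    [ChartedSpace (EuclideanQuadrant n) X] [CompactSpace X] : SecondCountableTopology X := by
  have : SecondCountableTopology (EuclideanQuadrant n) :=
    inferInstanceAs (SecondCountableTopology {x : EuclideanSpace ℝ (Fin n) // ∀ i, 0 ≤ x i})
  exact ChartedSpace.secondCountable_of_sigmaCompact (EuclideanQuadrant n) X

namespace VBChart

/-- The inverse coordinate map on the chart image. -/
def point (a : VBChart n m W) (y : a.img univ) : X := a.inv y

theorem point_mem (a : VBChart n m W) (y : a.img univ) : a.point y ∈ a.dom := (a.inv_mem y.2).1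

theorem isOpenEmbedding_point (a : VBChart n m W) : Topology.IsOpenEmbedding a.point := by
  let h : a.img univ ≃ₜ a.dom :=
    { toFun := fun y => ⟨a.inv y, a.point_mem y⟩
      invFun := fun x => ⟨a.ext x, a.ext_mem ⟨x.2, mem_univ _⟩⟩
      left_inv := fun y => Subtype.ext (a.ext_inv y.2)
      right_inv := fun x => Subtype.ext (a.inv_ext x.2)
      continuous_toFun :=
        (continuousOn_iff_continuous_domRestrict.1 (a.continuousOn_inv univ)).subtype_mk _
      continuous_invFun :=
        (continuousOn_iff_continuous_domRestrict.1 a.continuousOn_ext).subtype_mk _ }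
  exact a.isOpen_dom.isOpenEmbedding_subtypeVal.comp h.isOpenEmbedding

theorem range_point (a : VBChart n m W) : range a.point = a.dom := by
  refine Subset.antisymm (range_subset_iff.2 a.point_mem) fun x hx => ?_
  exact ⟨⟨a.ext x, a.ext_mem ⟨hx, mem_univ _⟩⟩, a.inv_ext hx⟩

theorem isCompact_preimage_point (a : VBChart n m W) {K : Set X} (hK : IsCompact K)
    (hKa : K ⊆ a.dom) : IsCompact (a.point ⁻¹' K) :=
  a.isOpenEmbedding_point.isInducing.isCompact_preimage_iff (by rwa [a.range_point]) |>.2 hK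

theorem locallyCompactSpace_img [CompactSpace X] [T2Space X] (a : VBChart n m W) :
    LocallyCompactSpace (a.img univ) :=
  a.isOpenEmbedding_point.locallyCompactSpace

variable [MeasurableSpace X] [BorelSpace X]

theorem measurableEmbedding_point (a : VBChart n m W) : MeasurableEmbedding a.point :=
  a.isOpenEmbedding_point.measurableEmbedding

/-- The measure may be infinite near the edge of the chart image, but a compact set inside the chart
domain pulls back to a compact set of finite measure. -/
theorem integrable_point (a : VBChart n m W) (μ : Measure (a.img univ))
    [IsFiniteMeasureOnCompacts μ] {f : X → ℝ} (hf : IsTestFun a.dom f) :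
    Integrable (fun y => f (a.point y)) μ := by
  obtain ⟨K, C, hK, hKU, h0, hC⟩ := hf.2
  have hK' := a.isCompact_preimage_point hK hKU
  rw [← integrableOn_iff_integrable_of_support_subset (s := a.point ⁻¹' K)
    (Function.support_subset_iff'.2 fun y hy => h0 _ hy)]
  exact Measure.integrableOn_of_bounded (M := C) hK'.measure_lt_top.ne
    (hf.1.comp a.measurableEmbedding_point.measurable).aestronglyMeasurable
    (Filter.Eventually.of_forall fun y => hC _)

theorem abs_integral_point_le (a : VBChart n m W) (μ : Measure (a.img univ))
    [IsFiniteMeasureOnCompacts μ] {f : X → ℝ} {K : Set X} (hK : IsCompact K) (hKa : K ⊆ a.dom)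
    (h0 : ∀ x ∉ K, f x = 0) {C : ℝ} (hC : ∀ x ∈ K, |f x| ≤ C) :
    |∫ y, f (a.point y) ∂μ| ≤ C * μ.real (a.point ⁻¹' K) := by
  rw [← setIntegral_eq_integral_of_forall_compl_eq_zero (s := a.point ⁻¹' K) (μ := μ)
    (f := fun y => f (a.point y)) fun y hy => h0 _ hy]
  exact norm_setIntegral_le_of_norm_le_const (f := fun y => f (a.point y))
    (a.isCompact_preimage_point hK hKa).measure_lt_top fun y hy => hC _ hy

/-- If `|h| ≤ C` and `h` vanishes off a compact set `K`, the majorant is `C` times the push-forward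
of `μ` restricted to the preimage of `K`. -/
theorem hasMajorant_integral_point (a : VBChart n m W) (μ : Measure (a.img univ))
    [IsFiniteMeasureOnCompacts μ] {h : X → ℝ} (hh : IsTestFun a.dom h) :
    HasMajorant fun g => ∫ y, g (a.point y) * h (a.point y) ∂μ := by
  obtain ⟨K, C, hK, hKU, h0, hC⟩ := hh.2
  have hK' := a.isCompact_preimage_point hK hKU
  have : IsFiniteMeasure (μ.restrict (a.point ⁻¹' K)) :=
    isFiniteMeasure_restrict.2 hK'.measure_lt_top.ne
  set ν := (μ.restrict (a.point ⁻¹' K)).map a.point with hν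
  have : IsFiniteMeasure ν := Measure.isFiniteMeasure_map _ _
  refine ⟨ENNReal.ofReal C • ν, ?_, fun f g hf hg => ?_⟩
  · exact Measure.smul_finite _ ENNReal.ofReal_ne_top
  rw [← integral_sub (a.integrable_point μ (IsTestFun.bdd_mul hf hh))
    (a.integrable_point μ (IsTestFun.bdd_mul hg hh)), integral_smul_measure, hν,
    a.measurableEmbedding_point.integral_map]
  rw [← setIntegral_eq_integral_of_forall_compl_eq_zero (s := a.point ⁻¹' K) fun y hy => by
    rw [h0 _ hy, mul_zero, mul_zero, sub_zero]]
  refine (abs_integral_le_integral_abs).trans ?_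
  rw [smul_eq_mul, ← integral_const_mul]
  refine integral_mono_of_nonneg (Filter.Eventually.of_forall fun _ => abs_nonneg _) ?_
    (Filter.Eventually.of_forall fun y => ?_)
  · exact ((a.measurableEmbedding_point.integrable_map_iff).1
      (((hf.sub hg).integrable ν).abs)).const_mul _
  · simp only
    rw [← sub_mul, abs_mul, mul_comm]
    refine mul_le_mul_of_nonneg_right ?_ (abs_nonneg _)
    rw [ENNReal.toReal_ofReal ((abs_nonneg _).trans (hC (a.point y)))]
    exact hC _

end VBChart

end ChartMeasures

instance {Y : Type*} [TopologicalSpace Y] [MeasurableSpace Y] (μ : RealRadonMeasure Y) :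
    μ.pos.Regular := μ.regular_pos

instance {Y : Type*} [TopologicalSpace Y] [MeasurableSpace Y] (μ : RealRadonMeasure Y) :
    μ.neg.Regular := μ.regular_neg

/-! ### Gluing local integrals -/

section Gluing

variable {n m : ℕ} {X : Type u} [TopologicalSpace X] [ChartedSpace (EuclideanQuadrant n) X]
  {W : X → Type u} [∀ x, AddCommGroup (W x)] [∀ x, Module ℝ (W x)]
  [TopologicalSpace (TotalSpace (EuclideanSpace ℝ (Fin m)) W)] [∀ x, TopologicalSpace (W x)]
  [FiberBundle (EuclideanSpace ℝ (Fin m)) W] {ι : Type}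

theorem CoordBundle.Sec.continuousOn {E : CoordBundle n m W ι} {R : Body n X} {k : ℕ}
    (s : E.Sec R k) (a : VBChart n m W) (c : ι) :
    ContinuousOn (E.comp a s.1 c) (a.dom ∩ R.carrier) :=
  (CoordBundle.Sec.smoothOn s a c).continuousOn

/-- A partition function times a component of a section over a body. -/
theorem CoordBundle.Sec.isTestFun [T2Space X] [CompactSpace X] [MeasurableSpace X] [BorelSpace X]
    {E : CoordBundle n m W ι} {R : Body n X} {k : ℕ} (s : E.Sec R k) (a : VBChart n m W) (c : ι)
    {u : X → ℝ} (hu : Continuous u) {U : Set X} (hUa : U ⊆ a.dom) (hUu : tsupport u ⊆ U) :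
    IsTestFun U fun x => u x * E.comp a s.1 c x := by
  refine IsTestFun.of_continuousOn (K := tsupport u ∩ R.carrier)
    ((isClosed_tsupport u).isCompact.inter R.isCompact) (inter_subset_left.trans hUu) ?_ ?_
  · exact hu.continuousOn.mul ((CoordBundle.Sec.continuousOn s a c).mono
      (inter_subset_inter_left _ (hUu.trans hUa)))
  · intro x hx
    by_cases h1 : x ∈ tsupport u
    · rw [CoordBundle.Sec.comp_eq_zero s a c fun h => hx ⟨h1, h⟩, mul_zero]
    · rw [image_eq_zero_of_notMem_tsupport h1, zero_mul]

variable [CompactSpace X] [IsManifold (quadrant n) ∞ X] [Fintype ι]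

namespace BundleMeasure

variable {E₀ : CoordBundle n m W ι} (ς : BundleMeasure E₀)

/-- The integral of a function on `X` with respect to a local component of `ς`. -/
def int (a : VBChart n m W) (c : ι) (f : X → ℝ) : ℝ :=
  ∫ y, f (a.point y) ∂(ς.meas a c).pos - ∫ y, f (a.point y) ∂(ς.meas a c).neg

theorem int_congr {a : VBChart n m W} {c : ι} {f g : X → ℝ} (h : EqOn f g a.dom) :
    ς.int a c f = ς.int a c g := by
  have : (fun y => f (a.point y)) = fun y => g (a.point y) :=
    funext fun y => h (a.point_mem y)
  rw [int, int, this]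

theorem integralOn_univ_rep {E : CoordBundle n m W ι} (a : VBChart n m W) (s : ∀ x, E.Fib x)
    (c : ι) : (ς.meas a c).integralOn univ (fun y => E.rep a s y c) =
      ς.int a c (E.comp a s c) := by
  rw [RealRadonMeasure.integralOn, Measure.restrict_univ, Measure.restrict_univ]
  rfl

variable [MeasurableSpace X] [BorelSpace X]

theorem int_add {a : VBChart n m W} {c : ι} {f g : X → ℝ} (hf : IsTestFun a.dom f)
    (hg : IsTestFun a.dom g) :
    ς.int a c (fun x => f x + g x) = ς.int a c f + ς.int a c g := by
  simp only [int]
  rw [integral_add (a.integrable_point _ hf) (a.integrable_point _ hg),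
    integral_add (a.integrable_point _ hf) (a.integrable_point _ hg)]
  ring

theorem int_zero (a : VBChart n m W) (c : ι) : ς.int a c (fun _ => 0) = 0 := by
  simp [int]

theorem int_sum {a : VBChart n m W} {c : ι} {P : Type*} (s : Finset P) {f : P → X → ℝ}
    (hf : ∀ p, IsTestFun a.dom (f p)) :
    ς.int a c (fun x => ∑ p ∈ s, f p x) = ∑ p ∈ s, ς.int a c (f p) := by
  classical
  induction s using Finset.induction_on with
  | empty => simpa using ς.int_zero a c
  | insert p s hp ih =>
    simp only [Finset.sum_insert hp]
    rw [ς.int_add (hf p) (IsTestFun.sum s hf), ih]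

theorem int_const_mul {a : VBChart n m W} {c : ι} (z : ℝ) (f : X → ℝ) :
    ς.int a c (fun x => z * f x) = z * ς.int a c f := by
  simp only [int]
  rw [integral_const_mul, integral_const_mul]
  ring

theorem hasMajorant_int {a : VBChart n m W} {c : ι} {h : X → ℝ} (hh : IsTestFun a.dom h) :
    HasMajorant fun g => ς.int a c fun x => g x * h x :=
  (a.hasMajorant_integral_point _ hh).sub (a.hasMajorant_integral_point _ hh)

theorem abs_int_le {a : VBChart n m W} {c : ι} {f : X → ℝ} {K : Set X} (hK : IsCompact K)
    (hKa : K ⊆ a.dom) (h0 : ∀ x ∉ K, f x = 0) {C : ℝ} (hC : ∀ x ∈ K, |f x| ≤ C) :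
    |ς.int a c f| ≤ C * ((ς.meas a c).pos.real (a.point ⁻¹' K) +
      (ς.meas a c).neg.real (a.point ⁻¹' K)) := by
  rw [mul_add]
  exact (abs_sub _ _).trans (add_le_add (a.abs_integral_point_le _ hK hKa h0 hC)
    (a.abs_integral_point_le _ hK hKa h0 hC))

end BundleMeasure

variable [MeasurableSpace X] [BorelSpace X] [T2Space X]
  {E : Body n X → CoordBundle n m W ι}
  {T : VBChart n m W → VBChart n m W → X → ι → ι → ℝ}

namespace IsTame

theorem isTestFun_change (hE : IsTame E T) (a b : VBChart n m W) (c d : ι) {u : X → ℝ}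
    (hu : Continuous u) (hua : tsupport u ⊆ a.dom ∩ b.dom) :
    IsTestFun (a.dom ∩ b.dom) fun x => u x * T a b x c d := by
  refine IsTestFun.of_continuousOn (isClosed_tsupport u).isCompact hua ?_ fun x hx => ?_
  · exact hu.continuousOn.mul ((hE.smooth a b c d).continuousOn.mono hua)
  · rw [image_eq_zero_of_notMem_tsupport hx, zero_mul]

/-- The transformation rule of the local components of a bundle measure. -/
theorem int_change (hE : IsTame E T) (ς : BundleMeasure (E (Body.whole n X)))
    (a b : VBChart n m W) (d : ι) {u : X → ℝ} (hu : Continuous u)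
    (hua : tsupport u ⊆ a.dom ∩ b.dom) {g : X → ℝ} (hg : IsBddMeas g) :
    ς.int a d (fun x => g x * u x) =
      ∑ c, ς.int b c (fun x => g x * (u x * T a b x c d)) := by
  classical
  have := secondCountableTopology_of_compact n X
  have hu' : IsTestFun (a.dom ∩ b.dom) u :=
    IsTestFun.of_continuousOn (isClosed_tsupport u).isCompact hua hu.continuousOn fun x hx =>
      image_eq_zero_of_notMem_tsupport hx
  -- As functionals of `g` both sides have majorants, so `g` may be assumed continuous. Only then
  -- does the compatibility condition apply.
  refine HasMajorant.eq_of_eq_on_continuous (ς.hasMajorant_int (hu'.mono inter_subset_left))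
    (HasMajorant.sum _ fun c => ς.hasMajorant_int
      ((hE.isTestFun_change a b c d hu hua).mono inter_subset_right)) (fun f hf => ?_) hg
  -- The test section has the single component `f u` in the chart `a`, in position `d`.
  -- Compatibility for it is the asserted rule.
  obtain ⟨s, hs, hsf, hs0⟩ := hE.exists_sec (Body.whole n X) a (k := 0)
    (fun x e => if e = d then f x * u x else 0) (isClosed_tsupport u)
    (hua.trans inter_subset_left)
    (fun x hx => by funext e; simp [image_eq_zero_of_notMem_tsupport hx])
    (fun c => by
      refine contMDiffOn_zero_iff.2 (Continuous.continuousOn ?_)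
      split_ifs
      · exact hf.mul hu
      · exact continuous_const)
  have hsup : closure {x | s x ≠ 0} ⊆ tsupport u :=
    closure_minimal (fun x hx => by_contra fun h => hx (hs0 x h)) (isClosed_tsupport u)
  have hcompat := ς.compat a b s hs (hsup.trans hua)
  simp only [ς.integralOn_univ_rep] at hcompat
  have hL : ∑ e, ς.int a e ((E (Body.whole n X)).comp a s e) = ς.int a d fun x => f x * u x := by
    rw [Finset.sum_eq_single d]
    · exact ς.int_congr fun x hx => by rw [hsf x ⟨hx, mem_univ x⟩, if_pos rfl]
    · intro e _ he
      rw [← ς.int_zero a e]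
      exact ς.int_congr fun x hx => by rw [hsf x ⟨hx, mem_univ x⟩, if_neg he]
    · intro h
      exact absurd (Finset.mem_univ d) h
  rw [← hL, hcompat]
  refine Finset.sum_congr rfl fun c _ => ς.int_congr fun x hx => ?_
  by_cases hxa : x ∈ a.dom
  · rw [CoordBundle.comp, hE.change (Body.whole n X) a b x ⟨⟨hxa, hx⟩, mem_univ x⟩,
      Finset.sum_eq_single d]
    · have := hsf x ⟨hxa, mem_univ x⟩ d
      rw [CoordBundle.comp, if_pos rfl] at this
      rw [this]
      ring
    · intro e _ he
      have := hsf x ⟨hxa, mem_univ x⟩ e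
      rw [CoordBundle.comp, if_neg he] at this
      rw [this, mul_zero]
    · intro h
      exact absurd (Finset.mem_univ d) h
  · have hxu : x ∉ tsupport u := fun h => hxa (hua h).1
    rw [CoordBundle.comp, hs0 x hxu, map_zero, image_eq_zero_of_notMem_tsupport hxu]
    simp

/-- The local integrals of a section over a body agree on the overlap of two charts. -/
theorem sum_int_eq (hE : IsTame E T) (ς : BundleMeasure (E (Body.whole n X))) {R : Body n X}
    (χ : (E R).Sec R 0) (a b : VBChart n m W) {u : X → ℝ} (hu : Continuous u)
    (hua : tsupport u ⊆ a.dom ∩ b.dom) :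
    ∑ c, ς.int a c (fun x => u x * (E R).comp a χ.1 c x) =
      ∑ c, ς.int b c (fun x => u x * (E R).comp b χ.1 c x) := by
  classical
  set K := tsupport u ∩ R.carrier with hK
  -- These factors are bounded and measurable but in general discontinuous at the boundary of `R`.
  -- This is why `int_change` is needed beyond continuous functions.
  set g : ι → X → ℝ := fun d => K.indicator ((E R).comp a χ.1 d) with hg
  have hgm : ∀ d, IsBddMeas (g d) := fun d => by
    refine (IsTestFun.of_continuousOn (U := a.dom) (K := K)
      ((isClosed_tsupport u).isCompact.inter R.isCompact)
      (inter_subset_left.trans (hua.trans inter_subset_left)) ?_ fun x hx => ?_).isBddMeas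
    · refine ContinuousOn.congr ((CoordBundle.Sec.continuousOn χ a d).mono
        (inter_subset_inter_left _ (hua.trans inter_subset_left))) fun x hx => ?_
      exact indicator_of_mem hx _
    · exact indicator_of_notMem hx _
  have hgu : ∀ d x, u x * (E R).comp a χ.1 d x = g d x * u x := by
    intro d x
    by_cases hx : x ∈ K
    · simp only [hg, indicator_of_mem hx, mul_comm]
    · simp only [hg, indicator_of_notMem hx, zero_mul]
      by_cases h1 : x ∈ tsupport u
      · rw [CoordBundle.Sec.comp_eq_zero χ a d fun h => hx ⟨h1, h⟩, mul_zero]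
      · rw [image_eq_zero_of_notMem_tsupport h1, zero_mul]
  simp only [hgu]
  simp only [hE.int_change ς a b _ hu hua (hgm _)]
  rw [Finset.sum_comm]
  refine Finset.sum_congr rfl fun c _ => ?_
  rw [← ς.int_sum _ fun d => IsTestFun.bdd_mul (hgm d)
    ((hE.isTestFun_change a b c d hu hua).mono inter_subset_right)]
  refine ς.int_congr fun x hx => ?_
  by_cases h1 : x ∈ tsupport u
  · by_cases h2 : x ∈ R.carrier
    · rw [CoordBundle.comp, hE.change R a b x ⟨hua h1, h2⟩, Finset.mul_sum]
      refine Finset.sum_congr rfl fun d _ => ?_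
      have := hgu d x
      rw [CoordBundle.comp] at this
      rw [← mul_assoc, ← this]
      ring
    · rw [CoordBundle.Sec.comp_eq_zero χ b c h2, mul_zero]
      refine Finset.sum_eq_zero fun d _ => ?_
      simp [hg, hK, h2]
  · simp [image_eq_zero_of_notMem_tsupport h1]

end IsTame

namespace PartitionedAtlas

theorem tsupport_subset (𝔓 : PartitionedAtlas n m W) (i : Fin 𝔓.A) :
    tsupport (𝔓.u i) ⊆ (𝔓.chart i).dom := 𝔓.isSubordinate i

theorem sum_eq_one (𝔓 : PartitionedAtlas n m W) (x : X) : ∑ i, 𝔓.u i x = 1 := by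
  rw [← finsum_eq_sum_of_fintype]
  exact 𝔓.u.sum_eq_one (mem_univ x)

end PartitionedAtlas

namespace BundleMeasure

variable {E₀ : CoordBundle n m W ι} (ς : BundleMeasure E₀)

/-- The glued integral of a section, with respect to a partitioned atlas. -/
def glued (𝔓 : PartitionedAtlas n m W) {E₁ : CoordBundle n m W ι} (s : ∀ x, E₁.Fib x) : ℝ :=
  ∑ i, ∑ c, ς.int (𝔓.chart i) c fun x => 𝔓.u i x * E₁.comp (𝔓.chart i) s c x

/-- Integrability is automatic, since each integrand is bounded with compact support in its chart.
Restricting the domain to `R` changes nothing, since sections over `R` are extended by zero. Only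
the value of the sum remains. -/
theorem hasIntegral_iff {E₁ : CoordBundle n m W ι} {R : Body n X} (χ : E₁.Sec R 0) (v : ℝ) :
    ς.HasIntegral R χ v ↔ ∀ 𝔓 : PartitionedAtlas n m W, ς.glued 𝔓 χ.1 = v := by
  refine forall_congr' fun 𝔓 => ?_
  have hint : ∀ i c, IsTestFun (𝔓.chart i).dom
      fun x => 𝔓.u i x * E₁.comp (𝔓.chart i) χ.1 c x := fun i c =>
    CoordBundle.Sec.isTestFun χ _ c (𝔓.u i).continuous Subset.rfl (𝔓.tsupport_subset i)
  have h0 : ∀ i c (y : (𝔓.chart i).img univ), y ∉ {y : (𝔓.chart i).img univ |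
      (𝔓.chart i).inv y ∈ R.carrier} → 𝔓.u i ((𝔓.chart i).inv y) *
        E₁.rep (𝔓.chart i) χ.1 y c = 0 := fun i c y hy => by
    rw [E₁.rep_eq_comp, CoordBundle.Sec.comp_eq_zero χ _ c hy, mul_zero]
  constructor
  · rintro ⟨-, h⟩
    rw [← h]
    refine Finset.sum_congr rfl fun i _ => Finset.sum_congr rfl fun c _ => ?_
    rw [RealRadonMeasure.integralOn, setIntegral_eq_integral_of_forall_compl_eq_zero (h0 i c),
      setIntegral_eq_integral_of_forall_compl_eq_zero (h0 i c)]
    rfl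
  · intro h
    refine ⟨fun i c => ⟨?_, ?_⟩, ?_⟩
    · exact ((𝔓.chart i).integrable_point _ (hint i c)).integrableOn
    · exact ((𝔓.chart i).integrable_point _ (hint i c)).integrableOn
    · rw [← h]
      refine Finset.sum_congr rfl fun i _ => Finset.sum_congr rfl fun c _ => ?_
      rw [RealRadonMeasure.integralOn, setIntegral_eq_integral_of_forall_compl_eq_zero (h0 i c),
        setIntegral_eq_integral_of_forall_compl_eq_zero (h0 i c)]
      rfl

end BundleMeasure

namespace IsTame

/-- The glued integral does not depend on the atlas and the partition of unity. -/
theorem glued_eq (hE : IsTame E T) (ς : BundleMeasure (E (Body.whole n X))) {R : Body n X}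
    (χ : (E R).Sec R 0) (𝔓 𝔔 : PartitionedAtlas n m W) : ς.glued 𝔓 χ.1 = ς.glued 𝔔 χ.1 := by
  -- Refinement by the products `u_i v_j` of the two partitions. Each product is supported in both
  -- charts, so its contribution can be computed in either.
  have key : ∀ 𝔓 𝔔 : PartitionedAtlas n m W, ς.glued 𝔓 χ.1 =
      ∑ i, ∑ j, ∑ c, ς.int (𝔓.chart i) c fun x =>
        (𝔓.u i x * 𝔔.u j x) * (E R).comp (𝔓.chart i) χ.1 c x := by
    intro 𝔓 𝔔
    refine Finset.sum_congr rfl fun i _ => ?_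
    rw [Finset.sum_comm]
    refine Finset.sum_congr rfl fun c _ => ?_
    rw [← ς.int_sum _ fun j => CoordBundle.Sec.isTestFun χ _ c
      (u := fun x => 𝔓.u i x * 𝔔.u j x) ((𝔓.u i).continuous.mul (𝔔.u j).continuous) Subset.rfl
        ((tsupport_mul_subset_left).trans (𝔓.tsupport_subset i))]
    refine ς.int_congr fun x _ => ?_
    rw [← Finset.sum_mul, ← Finset.mul_sum, 𝔔.sum_eq_one, mul_one]
  rw [key 𝔓 𝔔, key 𝔔 𝔓, Finset.sum_comm]
  refine Finset.sum_congr rfl fun j _ => Finset.sum_congr rfl fun i _ => ?_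
  rw [hE.sum_int_eq ς χ (𝔓.chart i) (𝔔.chart j) (u := fun x => 𝔓.u i x * 𝔔.u j x)
    ((𝔓.u i).continuous.mul (𝔔.u j).continuous)
    (subset_inter (tsupport_mul_subset_left.trans (𝔓.tsupport_subset i))
      (tsupport_mul_subset_right.trans (𝔔.tsupport_subset j)))]
  simp only [mul_comm (𝔓.u i _)]

theorem hasIntegral_glued (hE : IsTame E T) (ς : BundleMeasure (E (Body.whole n X)))
    {R : Body n X} (χ : (E R).Sec R 0) (𝔓 : PartitionedAtlas n m W) :
    ς.HasIntegral R χ (ς.glued 𝔓 χ.1) :=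
  (ς.hasIntegral_iff χ _).2 fun 𝔔 => hE.glued_eq ς χ 𝔔 𝔓

end IsTame

end Gluing

/-! ### Stress measures induce forces -/

section Forces

variable {n m r : ℕ} {X : Type u} [TopologicalSpace X] [ChartedSpace (EuclideanQuadrant n) X]
  {W : X → Type u} [∀ x, AddCommGroup (W x)] [∀ x, Module ℝ (W x)]
  [TopologicalSpace (TotalSpace (EuclideanSpace ℝ (Fin m)) W)] [∀ x, TopologicalSpace (W x)]
  [FiberBundle (EuclideanSpace ℝ (Fin m)) W] {R : Body n X}

/-- The partial derivative `∂_I w_a^α` in the chart `a` of a section of `W`. -/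
def secPd (R : Body n X) (a : VBChart n m W) {k : ℕ} (I : Fin k → Fin n) (α : Fin m)
    (w : ∀ x, W x) (x : X) : ℝ :=
  a.pd R.carrier I ((baseBundle n m W).comp a w α) x

theorem contDiffOn_comp (w : CrSec m W R r) (a : VBChart n m W) (α : Fin m) :
    ContDiffOn ℝ r ((baseBundle n m W).comp a w.1 α ∘ a.inv) (a.img R.carrier) :=
  w.2.2 a α

theorem secPd_add (w w' : CrSec m W R r) (a : VBChart n m W) {k : ℕ} (hk : k ≤ r)
    (I : Fin k → Fin n) (α : Fin m) {x : X} (hx : x ∈ a.dom ∩ R.carrier) :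
    secPd R a I α (w + w').1 x = secPd R a I α w.1 x + secPd R a I α w'.1 x := by
  have hk' : (k : ℕ∞ω) ≤ r := by exact_mod_cast hk
  rw [secPd, VBChart.pd]
  have : (baseBundle n m W).comp a (w + w').1 α ∘ a.inv =
      (baseBundle n m W).comp a w.1 α ∘ a.inv + (baseBundle n m W).comp a w'.1 α ∘ a.inv := by
    funext y
    exact congrFun (map_add ((baseBundle n m W).coord a (a.inv y)) _ _) α
  rw [this, partialWithin_add (a.uniqueDiffOn_img R) (a.ext_mem hx)
    ((contDiffOn_comp w a α _ (a.ext_mem hx)).of_le hk')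
    ((contDiffOn_comp w' a α _ (a.ext_mem hx)).of_le hk')]
  rfl

theorem secPd_smul (z : ℝ) (w : CrSec m W R r) (a : VBChart n m W) {k : ℕ} (hk : k ≤ r)
    (I : Fin k → Fin n) (α : Fin m) {x : X} (hx : x ∈ a.dom ∩ R.carrier) :
    secPd R a I α (z • w).1 x = z * secPd R a I α w.1 x := by
  have hk' : (k : ℕ∞ω) ≤ r := by exact_mod_cast hk
  rw [secPd, VBChart.pd]
  have : (baseBundle n m W).comp a (z • w).1 α ∘ a.inv =
      z • ((baseBundle n m W).comp a w.1 α ∘ a.inv) := by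
    funext y
    exact congrFun (map_smul ((baseBundle n m W).coord a (a.inv y)) _ _) α
  rw [this, partialWithin_smul z (a.uniqueDiffOn_img R) (a.ext_mem hx)
    ((contDiffOn_comp w a α _ (a.ext_mem hx)).of_le hk')]
  rfl

theorem continuousOn_secPd (w : CrSec m W R r) (a : VBChart n m W) {k : ℕ} (hk : k ≤ r)
    (I : Fin k → Fin n) (α : Fin m) : ContinuousOn (secPd R a I α w.1) (a.dom ∩ R.carrier) :=
  (a.smoothOn_pd R I (CoordBundle.Sec.smoothOn (E := baseBundle n m W) w a α) (j := 0)
    (by omega)).continuousOn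

namespace PrecompactAtlas

theorem crNorm_nonneg (𝔎 : PrecompactAtlas m W R) (w : CrSec m W R r) : 0 ≤ 𝔎.crNorm r w := by
  refine Real.sSup_nonneg ?_
  rintro _ ⟨i, α, k, I, x, -, -, rfl⟩
  exact abs_nonneg _

theorem crNorm_le (𝔎 : PrecompactAtlas m W R) (w : CrSec m W R r) {M : ℝ} (hM : 0 ≤ M)
    (h : ∀ i α (k : ℕ) (I : Fin k → Fin n), k ≤ r → ∀ x ∈ 𝔎.K i,
      |secPd R (𝔎.chart i) I α w.1 x| ≤ M) : 𝔎.crNorm r w ≤ M := by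
  refine Real.sSup_le ?_ hM
  rintro _ ⟨i, α, k, I, x, hk, hx, rfl⟩
  exact h i α k I hk x hx

/-- The supremum is a genuine one because the set is bounded: finitely many derivatives occur, each
continuous on a compact set. -/
theorem le_crNorm (𝔎 : PrecompactAtlas m W R) (w : CrSec m W R r) (i : Fin 𝔎.A) (α : Fin m)
    {k : ℕ} (hk : k ≤ r) (I : Fin k → Fin n) {x : X} (hx : x ∈ 𝔎.K i) :
    |secPd R (𝔎.chart i) I α w.1 x| ≤ 𝔎.crNorm r w := by
  refine le_csSup ?_ ⟨i, α, k, I, x, hk, hx, rfl⟩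
  choose B hB using fun p : (Σ k : Fin (r + 1), Fin k → Fin n) × Fin 𝔎.A × Fin m =>
    (𝔎.isCompact p.2.1).exists_bound_of_continuousOn
      ((continuousOn_secPd w (𝔎.chart p.2.1) (Nat.lt_succ_iff.1 p.1.1.2) p.1.2 p.2.2).mono
        (𝔎.subset p.2.1))
  refine ⟨∑ p, |B p|, ?_⟩
  rintro _ ⟨i, α, k, I, x, hk, hx, rfl⟩
  have h1 := hB (⟨⟨k, Nat.lt_succ_of_le hk⟩, I⟩, i, α) x hx
  exact (h1.trans (le_abs_self _)).trans
    (Finset.single_le_sum (f := fun p => |B p|) (fun p _ => abs_nonneg _) (Finset.mem_univ _))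

end PrecompactAtlas

/-- The precompact atlas on a body consisting of the supports of a partition of unity. -/
def PartitionedAtlas.precompact [CompactSpace X] (𝔓 : PartitionedAtlas n m W) (R : Body n X)
    [T2Space X] : PrecompactAtlas m W R where
  A := 𝔓.A
  chart := 𝔓.chart
  K i := tsupport (𝔓.u i) ∩ R.carrier
  isCompact i := (isClosed_tsupport _).isCompact.inter R.isCompact
  subset i := inter_subset_inter_left _ (𝔓.isSubordinate i)
  cover x hx := by
    obtain ⟨i, hi⟩ := 𝔓.u.exists_pos (mem_univ x)
    refine ⟨i, Filter.inter_mem (mem_nhdsWithin_of_mem_nhds ?_) self_mem_nhdsWithin⟩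
    have h1 : Function.support (𝔓.u i) ∈ 𝓝 x :=
      (𝔓.u i).continuous.isOpen_support.mem_nhds hi.ne'
    exact Filter.mem_of_superset h1 (subset_tsupport _)

variable [CompactSpace X] [IsManifold (quadrant n) ∞ X] [T2Space X] {ι : Type} [Fintype ι]
  [MeasurableSpace X] [BorelSpace X] {E : Body n X → CoordBundle n m W ι}
  {T : VBChart n m W → VBChart n m W → X → ι → ι → ℝ}

/-- A differential operator whose components are partial derivatives turns a bundle measure into a
force on each body. -/
theorem IsTame.exists_force [VectorBundle ℝ (EuclideanSpace ℝ (Fin m)) W]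
    [ContMDiffVectorBundle ∞ (EuclideanSpace ℝ (Fin m)) W (quadrant n)]
    (hE : IsTame E T) (ς : BundleMeasure (E (Body.whole n X)))
    (D : CrSec m W R r → (E R).Sec R 0)
    (hD : ∀ c : ι, ∃ (k : ℕ) (I : Fin k → Fin n) (α : Fin m), k ≤ r ∧
      ∀ (w : CrSec m W R r) (a : VBChart n m W), ∀ x ∈ a.dom ∩ R.carrier,
        (E R).comp a (D w).1 c x = secPd R a I α w.1 x) :
    ∃ F : Force m W R r, ∀ w, ς.HasIntegral R (D w) (F.toLin w) := by
  classical
  obtain ⟨𝔓⟩ := PartitionedAtlas.nonempty (n := n) (m := m) (W := W)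
  choose k I α hk hD using hD
  -- `D` is not assumed to be linear. Linearity of its components follows from that of partial
  -- derivatives on `R`, and off `R` they vanish.
  have hadd : ∀ w w' a c x, x ∈ a.dom → (E R).comp a (D (w + w')).1 c x =
      (E R).comp a (D w).1 c x + (E R).comp a (D w').1 c x := by
    intro w w' a c x hx
    by_cases hxR : x ∈ R.carrier
    · rw [hD c _ a x ⟨hx, hxR⟩, hD c _ a x ⟨hx, hxR⟩, hD c _ a x ⟨hx, hxR⟩,
        secPd_add w w' a (hk c) _ _ ⟨hx, hxR⟩]
    · simp only [CoordBundle.Sec.comp_eq_zero _ a c hxR, add_zero]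
  have hsmul : ∀ (z : ℝ) w a c x, x ∈ a.dom → (E R).comp a (D (z • w)).1 c x =
      z * (E R).comp a (D w).1 c x := by
    intro z w a c x hx
    by_cases hxR : x ∈ R.carrier
    · rw [hD c _ a x ⟨hx, hxR⟩, hD c _ a x ⟨hx, hxR⟩, secPd_smul z w a (hk c) _ _ ⟨hx, hxR⟩]
    · simp only [CoordBundle.Sec.comp_eq_zero _ a c hxR, mul_zero]
  have htest : ∀ w i c, IsTestFun (𝔓.chart i).dom
      fun x => 𝔓.u i x * (E R).comp (𝔓.chart i) (D w).1 c x := fun w i c =>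
    CoordBundle.Sec.isTestFun (D w) _ c (𝔓.u i).continuous Subset.rfl (𝔓.tsupport_subset i)
  -- The bound is the total mass of the positive and negative parts of all local components on the
  -- supports of the partition functions in `R`.
  refine ⟨⟨⟨⟨fun w => ς.glued 𝔓 (D w).1, fun w w' => ?_⟩, fun z w => ?_⟩, 𝔓.precompact R,
    ∑ i, ∑ c, ((ς.meas (𝔓.chart i) c).pos.real
        ((𝔓.chart i).point ⁻¹' (tsupport (𝔓.u i) ∩ R.carrier)) +
      (ς.meas (𝔓.chart i) c).neg.real
        ((𝔓.chart i).point ⁻¹' (tsupport (𝔓.u i) ∩ R.carrier))), fun w => ?_⟩,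
    fun w => hE.hasIntegral_glued ς (D w) 𝔓⟩
  · simp only [BundleMeasure.glued, ← Finset.sum_add_distrib]
    refine Finset.sum_congr rfl fun i _ => Finset.sum_congr rfl fun c _ => ?_
    rw [← ς.int_add (htest w i c) (htest w' i c)]
    exact ς.int_congr fun x hx => by rw [hadd w w' _ c x hx, mul_add]
  · simp only [BundleMeasure.glued, RingHom.id_apply, smul_eq_mul, Finset.mul_sum]
    refine Finset.sum_congr rfl fun i _ => Finset.sum_congr rfl fun c _ => ?_
    rw [← ς.int_const_mul]
    exact ς.int_congr fun x hx => by rw [hsmul z w _ c x hx]; ring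
  · change |ς.glued 𝔓 (D w).1| ≤ _
    rw [BundleMeasure.glued, Finset.sum_mul]
    refine (Finset.abs_sum_le_sum_abs _ _).trans (Finset.sum_le_sum fun i _ => ?_)
    rw [Finset.sum_mul]
    refine (Finset.abs_sum_le_sum_abs _ _).trans (Finset.sum_le_sum fun c _ => ?_)
    rw [mul_comm]
    refine ς.abs_int_le ((𝔓.precompact R).isCompact i)
      (inter_subset_left.trans (𝔓.tsupport_subset i)) (fun x hx => ?_) fun x hx => ?_
    · by_cases h1 : x ∈ tsupport (𝔓.u i)
      · rw [CoordBundle.Sec.comp_eq_zero (D w) _ c fun h => hx ⟨h1, h⟩, mul_zero]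
      · rw [image_eq_zero_of_notMem_tsupport h1, zero_mul]
    · rw [hD c w _ x ⟨𝔓.tsupport_subset i hx.1, hx.2⟩, abs_mul, abs_of_nonneg (𝔓.u.nonneg i x)]
      refine (mul_le_of_le_one_left (abs_nonneg _) (𝔓.u.le_one i x)).trans ?_
      exact (𝔓.precompact R).le_crNorm w i (α c) (hk c) (I c) hx

end Forces

/-! ### Jordan decomposition of a difference of Radon measures -/

section JordanDecomposition

variable {Y : Type*} [TopologicalSpace Y] [MeasurableSpace Y] [BorelSpace Y]
  [SecondCountableTopology Y] [LocallyCompactSpace Y] [T2Space Y]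

/-- The difference of two Radon measures, as a real Radon measure. -/
theorem RealRadonMeasure.exists_sub (P N : Measure Y) [IsFiniteMeasureOnCompacts P]
    [IsFiniteMeasureOnCompacts N] : ∃ ρ : RealRadonMeasure Y,
      ρ.pos ≤ P ∧ ρ.neg ≤ N ∧ ∀ f : Y → ℝ, Integrable f P → Integrable f N →
        ∫ y, f y ∂ρ.pos - ∫ y, f y ∂ρ.neg = ∫ y, f y ∂P - ∫ y, f y ∂N := by
  let _ : MetricSpace Y := TopologicalSpace.metrizableSpaceMetric Y
  have : IsLocallyFiniteMeasure P := isLocallyFiniteMeasure_of_isFiniteMeasureOnCompacts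
  have : IsLocallyFiniteMeasure N := isLocallyFiniteMeasure_of_isFiniteMeasureOnCompacts
  -- Both measures have densities `p`, `q` with respect to their sum. The truncated differences `p -
  -- q` and `q - p` are never positive at the same point, so they define mutually singular measures.
  set σ := P + N with hσ
  set p := P.rnDeriv σ with hp
  set q := N.rnDeriv σ with hq
  have hPσ : σ.withDensity p = P := Measure.withDensity_rnDeriv_eq P σ
    (Measure.absolutelyContinuous_of_le (Measure.le_add_right le_rfl))
  have hNσ : σ.withDensity q = N := Measure.withDensity_rnDeriv_eq N σ
    (Measure.absolutelyContinuous_of_le (Measure.le_add_left le_rfl))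
  have hpm : Measurable p := Measure.measurable_rnDeriv _ _
  have hqm : Measurable q := Measure.measurable_rnDeriv _ _
  have hpos : σ.withDensity (p - q) ≤ P := by
    conv_rhs => rw [← hPσ]
    exact withDensity_mono (Filter.Eventually.of_forall fun y => tsub_le_self)
  have hneg : σ.withDensity (q - p) ≤ N := by
    conv_rhs => rw [← hNσ]
    exact withDensity_mono (Filter.Eventually.of_forall fun y => tsub_le_self)
  have : IsLocallyFiniteMeasure (σ.withDensity (p - q)) :=
    Measure.isLocallyFiniteMeasure_of_le hpos
  have : IsLocallyFiniteMeasure (σ.withDensity (q - p)) :=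
    Measure.isLocallyFiniteMeasure_of_le hneg
  -- Both sides have density `max p q`. Stating the identity as a sum avoids subtracting possibly
  -- infinite measures.
  have hadd : σ.withDensity (p - q) + N = σ.withDensity (q - p) + P := by
    conv_lhs => rw [← hNσ]
    conv_rhs => rw [← hPσ]
    rw [← withDensity_add_left (hpm.sub hqm), ← withDensity_add_left (hqm.sub hpm)]
    congr 1
    funext y
    simp only [Pi.add_apply, Pi.sub_apply, tsub_add_eq_max, max_comm]
  refine ⟨⟨σ.withDensity (p - q), σ.withDensity (q - p), inferInstance, inferInstance, ?_⟩,
    hpos, hneg, fun f hfP hfN => ?_⟩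
  · refine ⟨{y | p y ≤ q y}, measurableSet_le hpm hqm, ?_, ?_⟩
    · rw [withDensity_apply _ (measurableSet_le hpm hqm),
        setLIntegral_congr_fun (f := p - q) (g := fun _ => 0) (measurableSet_le hpm hqm)
          (fun y hy => tsub_eq_zero_of_le hy), lintegral_zero]
    · rw [withDensity_apply _ (measurableSet_le hpm hqm).compl,
        setLIntegral_congr_fun (f := q - p) (g := fun _ => 0) (measurableSet_le hpm hqm).compl
          (fun y (hy : ¬ p y ≤ q y) => tsub_eq_zero_of_le (not_le.1 hy).le), lintegral_zero]
  · have h1 : ∫ y, f y ∂(σ.withDensity (p - q) + N) = ∫ y, f y ∂(σ.withDensity (q - p) + P) := by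
      rw [hadd]
    rw [integral_add_measure (hfP.mono_measure hpos) hfN,
      integral_add_measure (hfN.mono_measure hneg) hfP] at h1
    change ∫ y, f y ∂σ.withDensity (p - q) - ∫ y, f y ∂σ.withDensity (q - p) = _
    linarith

end JordanDecomposition

/-! ### Bundle measures from scalar measures on charts -/

section Construction

variable {n m : ℕ} {X : Type u} [TopologicalSpace X] [ChartedSpace (EuclideanQuadrant n) X]
  {W : X → Type u} [∀ x, AddCommGroup (W x)] [∀ x, Module ℝ (W x)]
  [TopologicalSpace (TotalSpace (EuclideanSpace ℝ (Fin m)) W)] [∀ x, TopologicalSpace (W x)]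
  [FiberBundle (EuclideanSpace ℝ (Fin m)) W] [CompactSpace X] [T2Space X]
  [MeasurableSpace X] [BorelSpace X]

/-- Measurable functions which are bounded on the compact subsets of `U`. -/
def IsLocBdd (U : Set X) (h : X → ℝ) : Prop :=
  Measurable h ∧ ∀ L, IsCompact L → L ⊆ U → ∃ C : ℝ, ∀ x ∈ L, |h x| ≤ C

theorem IsLocBdd.mul_isTestFun {U : Set X} {h f : X → ℝ} (hh : IsLocBdd U h)
    (hf : IsTestFun U f) : IsTestFun U fun x => h x * f x := by
  obtain ⟨K, C, hK, hKU, h0, hC⟩ := hf.2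
  obtain ⟨D, hD⟩ := hh.2 K hK hKU
  -- `|D|` instead of `D`, as `D` may be negative when `K` is empty.
  refine ⟨hh.1.mul hf.1, K, |D| * C, hK, hKU, fun x hx => by rw [h0 x hx, mul_zero],
    fun x => ?_⟩
  by_cases hx : x ∈ K
  · rw [abs_mul]
    exact mul_le_mul ((hD x hx).trans (le_abs_self D)) (hC x) (abs_nonneg _) (abs_nonneg _)
  · rw [h0 x hx, mul_zero, abs_zero]
    exact mul_nonneg (abs_nonneg _) ((abs_nonneg _).trans (hC x))

namespace VBChart

/-- The representative in the chart `b` of the measure `h⁺ μ` on `X`. -/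
def localMeasure (b : VBChart n m W) (μ : Measure X) (h : X → ℝ) : Measure (b.img univ) :=
  (μ.withDensity fun x => ENNReal.ofReal (h x)).comap b.point

theorem isFiniteMeasureOnCompacts_localMeasure (b : VBChart n m W) (μ : Measure X)
    [IsFiniteMeasure μ] {h : X → ℝ} (hh : IsLocBdd b.dom h) :
    IsFiniteMeasureOnCompacts (b.localMeasure μ h) := by
  refine ⟨fun L hL => ?_⟩
  have hL' : IsCompact (b.point '' L) := hL.image b.isOpenEmbedding_point.continuous
  obtain ⟨C, hC⟩ := hh.2 _ hL' (image_subset_iff.2 fun y _ => b.point_mem y)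
  rw [localMeasure, b.measurableEmbedding_point.comap_apply,
    withDensity_apply _ hL'.measurableSet]
  refine (setLIntegral_mono (g := fun _ => ENNReal.ofReal C) measurable_const fun x hx =>
    ENNReal.ofReal_le_ofReal ((le_abs_self _).trans (hC x hx))).trans_lt ?_
  rw [setLIntegral_const]
  exact ENNReal.mul_lt_top ENNReal.ofReal_lt_top (measure_lt_top _ _)

/-- `ENNReal.ofReal` truncates the density at zero, whence the `max`. The negative part is supplied
by applying the result to `-h`. -/
theorem integral_localMeasure (b : VBChart n m W) (μ : Measure X) [IsFiniteMeasure μ]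
    {h : X → ℝ} (hh : IsLocBdd b.dom h) {f : X → ℝ} (hf : IsTestFun b.dom f) :
    ∫ y, f (b.point y) ∂b.localMeasure μ h = ∫ x, max (h x) 0 * f x ∂μ := by
  have h0 : ∀ x ∉ b.dom, f x = 0 := fun x hx =>
    let ⟨K, _, _, hKU, h0, _⟩ := hf.2
    h0 x fun h => hx (hKU h)
  rw [← b.measurableEmbedding_point.integral_map (μ := b.localMeasure μ h) (g := f),
    localMeasure, b.measurableEmbedding_point.map_comap, b.range_point,
    setIntegral_eq_integral_of_forall_compl_eq_zero h0,
    integral_withDensity_eq_integral_toReal_smul hh.1.ennreal_ofReal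
      (Filter.Eventually.of_forall fun _ => ENNReal.ofReal_lt_top)]
  refine integral_congr_ae (Filter.Eventually.of_forall fun x => ?_)
  simp only [ENNReal.toReal_ofReal', smul_eq_mul]

/-- A real Radon measure on a chart image with given densities with respect to finitely many
measures on `X`. -/
theorem exists_realRadonMeasure (b : VBChart n m W) {P : Type*} [Fintype P] (μ : P → Measure X)
    [∀ p, IsFiniteMeasure (μ p)] {h : P → X → ℝ} (hh : ∀ p, IsLocBdd b.dom (h p)) :
    ∃ ρ : RealRadonMeasure (b.img univ), ∀ f, IsTestFun b.dom f →
      ∫ y, f (b.point y) ∂ρ.pos - ∫ y, f (b.point y) ∂ρ.neg = ∑ p, ∫ x, h p x * f x ∂μ p := by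
  have := b.locallyCompactSpace_img
  have hneg : ∀ p, IsLocBdd b.dom fun x => -h p x := fun p =>
    ⟨(hh p).1.neg, fun L hL hLU => by simpa using (hh p).2 L hL hLU⟩
  have hP : ∀ p, IsFiniteMeasureOnCompacts (b.localMeasure (μ p) (h p)) := fun p =>
    b.isFiniteMeasureOnCompacts_localMeasure (μ p) (hh p)
  have hN : ∀ p, IsFiniteMeasureOnCompacts (b.localMeasure (μ p) fun x => -h p x) := fun p =>
    b.isFiniteMeasureOnCompacts_localMeasure (μ p) (hneg p)
  have : IsFiniteMeasureOnCompacts (∑ p, b.localMeasure (μ p) (h p)) := ⟨fun L hL => by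
    rw [Measure.finsetSum_apply]
    exact ENNReal.sum_lt_top.2 fun p _ => hL.measure_lt_top⟩
  have : IsFiniteMeasureOnCompacts (∑ p, b.localMeasure (μ p) fun x => -h p x) := ⟨fun L hL => by
    rw [Measure.finsetSum_apply]
    exact ENNReal.sum_lt_top.2 fun p _ => hL.measure_lt_top⟩
  -- Positive and negative parts for different `p` may overlap after summation, so the decomposition
  -- is taken afresh for the difference of the sums.
  obtain ⟨ρ, -, -, hρ⟩ := RealRadonMeasure.exists_sub (∑ p, b.localMeasure (μ p) (h p))
    (∑ p, b.localMeasure (μ p) fun x => -h p x)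
  refine ⟨ρ, fun f hf => ?_⟩
  rw [hρ _ (b.integrable_point _ hf) (b.integrable_point _ hf),
    integral_finsetSum_measure fun p _ => b.integrable_point _ hf,
    integral_finsetSum_measure fun p _ => b.integrable_point _ hf, ← Finset.sum_sub_distrib]
  refine Finset.sum_congr rfl fun p _ => ?_
  have hmax : ∀ {k : X → ℝ}, IsLocBdd b.dom k → IsLocBdd b.dom fun x => max (k x) 0 :=
    fun hk => ⟨hk.1.max measurable_const, fun L hL hLU =>
      let ⟨C, hC⟩ := hk.2 L hL hLU
      ⟨C, fun x hx => (abs_max_le_max_abs_abs.trans (by simp)).trans (hC x hx)⟩⟩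
  rw [b.integral_localMeasure _ (hh p) hf, b.integral_localMeasure _ (hneg p) hf,
    ← integral_sub (((hmax (hh p)).mul_isTestFun hf).isBddMeas.integrable _)
      (((hmax (hneg p)).mul_isTestFun hf).isBddMeas.integrable _)]
  refine integral_congr_ae (Filter.Eventually.of_forall fun x => ?_)
  simp only
  rw [← sub_mul]
  congr 1
  rcases le_total 0 (h p x) with h0 | h0
  · rw [max_eq_left h0, max_eq_right (neg_nonpos.2 h0), sub_zero]
  · rw [max_eq_right h0, max_eq_left (neg_nonneg.2 h0), zero_sub, neg_neg]

end VBChart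

variable [IsManifold (quadrant n) ∞ X] {ι : Type} [Fintype ι]
  {E : Body n X → CoordBundle n m W ι} {T : VBChart n m W → VBChart n m W → X → ι → ι → ℝ}

/-- Finitely many finite measures on compact subsets of chart domains, acting on components of
sections in these charts, combine to a bundle measure. -/
theorem IsTame.exists_bundleMeasure (hE : IsTame E T) {P : Type*} [Fintype P]
    (a : P → VBChart n m W) {K : P → Set X} (hK : ∀ p, IsCompact (K p))
    (hKa : ∀ p, K p ⊆ (a p).dom) (μ : P → Measure X) [∀ p, IsFiniteMeasure (μ p)] (z : P → ℝ)
    (c : P → ι) : ∃ ς : BundleMeasure (E (Body.whole n X)), ∀ (R : Body n X)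
      (χ : (E R).Sec R 0), ς.HasIntegral R χ
        (∑ p, z p * ∫ x in K p, (E R).comp (a p) χ.1 (c p) x ∂μ p) := by
  classical
  -- In the chart `b` the component `χ_{a p}^{c p}` is a combination of the `χ_b^q` with the entries
  -- of the transition matrix. These entries, times `z p` and cut off to `K p`, are the densities of
  -- component `q` of the measure.
  set H : VBChart n m W → ι → P → X → ℝ := fun b q p =>
    (K p ∩ b.dom).indicator fun x => z p * T b (a p) x (c p) q with hH
  have hT : ∀ b q p, ContinuousOn (fun x => z p * T b (a p) x (c p) q) (K p ∩ b.dom) :=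
    fun b q p => continuousOn_const.mul ((hE.smooth b (a p) (c p) q).continuousOn.mono
      fun x hx => ⟨hx.2, hKa p hx.1⟩)
  have hHb : ∀ b q p, IsLocBdd b.dom (H b q p) := by
    refine fun b q p => ⟨?_, fun L hL hLb => ?_⟩
    · have h1 := (hT b q p).measurable_piecewise (g := 0) continuousOn_const
        ((hK p).measurableSet.inter b.isOpen_dom.measurableSet)
      rwa [piecewise_eq_indicator] at h1
    · obtain ⟨C, hC⟩ := ((hK p).inter hL).exists_bound_of_continuousOn
        ((hT b q p).mono (inter_subset_inter_right _ hLb))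
      refine ⟨max C 0, fun x hx => ?_⟩
      by_cases hxK : x ∈ K p ∩ b.dom
      · simp only [hH, indicator_of_mem hxK]
        exact (hC x ⟨hxK.1, hx⟩).trans (le_max_left _ _)
      · simp only [hH, indicator_of_notMem hxK, abs_zero]
        exact le_max_right _ _
  have hHc : ∀ (R : Body n X) (χ : (E R).Sec R 0) (b : VBChart n m W) p x, x ∈ b.dom →
      ∑ q, H b q p x * (E R).comp b χ.1 q x =
        (K p).indicator (fun x => z p * (E R).comp (a p) χ.1 (c p) x) x := by
    intro R χ b p x hx
    by_cases hxK : x ∈ K p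
    · have hxK' : x ∈ K p ∩ b.dom := ⟨hxK, hx⟩
      simp only [hH, indicator_of_mem hxK, indicator_of_mem hxK']
      by_cases hxR : x ∈ R.carrier
      · simp only [CoordBundle.comp]
        rw [hE.change R b (a p) x ⟨⟨hx, hKa p hxK⟩, hxR⟩, Finset.mul_sum]
        exact Finset.sum_congr rfl fun q _ => mul_assoc _ _ _
      · simp [CoordBundle.Sec.comp_eq_zero χ _ _ hxR]
    · have hxK' : x ∉ K p ∩ b.dom := fun h => hxK h.1
      simp only [hH, indicator_of_notMem hxK, indicator_of_notMem hxK', zero_mul,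
        Finset.sum_const_zero]
  choose ρ hρ using fun (b : VBChart n m W) (q : ι) => b.exists_realRadonMeasure μ (hHb b q)
  have hsum : ∀ (b : VBChart n m W) (f : ι → X → ℝ), (∀ q, IsTestFun b.dom (f q)) →
      ∑ q, (∫ y, f q (b.point y) ∂(ρ b q).pos - ∫ y, f q (b.point y) ∂(ρ b q).neg) =
        ∑ p, ∫ x, ∑ q, H b q p x * f q x ∂μ p := by
    intro b f hf
    simp only [hρ b _ _ (hf _)]
    rw [Finset.sum_comm]
    refine Finset.sum_congr rfl fun p _ => ?_
    rw [integral_finsetSum _ fun q _ =>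
      ((hHb b q p).mul_isTestFun (hf q)).isBddMeas.integrable (μ p)]
  -- The right-hand side does not mention `b`, which is the compatibility of the local measures.
  have hloc : ∀ (b : VBChart n m W), ∀ χ ∈ (E (Body.whole n X)).Sec (Body.whole n X) 0,
      closure {x | χ x ≠ 0} ⊆ b.dom →
      ∑ q, (ρ b q).integralOn univ (fun y => (E (Body.whole n X)).rep b χ y q) =
        ∑ p, ∫ x in K p, z p * (E (Body.whole n X)).comp (a p) χ (c p) x ∂μ p := by
    intro b χ hχ hχb
    have h0 : ∀ x ∉ closure {x | χ x ≠ 0}, χ x = 0 := fun x hx =>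
      not_not.1 fun h => hx (subset_closure h)
    have h1 := hsum b (fun q => (E (Body.whole n X)).comp b χ q) fun q => by
      refine IsTestFun.of_continuousOn isClosed_closure.isCompact hχb ?_ fun x hx => ?_
      · exact (CoordBundle.Sec.continuousOn ⟨χ, hχ⟩ b q).mono fun x hx => ⟨hχb hx, mem_univ x⟩
      · rw [CoordBundle.comp, h0 x hx, map_zero]; rfl
    simp only [RealRadonMeasure.integralOn, Measure.restrict_univ]
    refine h1.trans (Finset.sum_congr rfl fun p _ => ?_)
    rw [← integral_indicator (hK p).measurableSet]
    refine integral_congr_ae (Filter.Eventually.of_forall fun x => ?_)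
    by_cases hxb : x ∈ b.dom
    · exact hHc (Body.whole n X) ⟨χ, hχ⟩ b p x hxb
    · have hx0 : ∀ b q, (E (Body.whole n X)).comp b χ q x = 0 := fun b q => by
        rw [CoordBundle.comp, h0 x fun h => hxb (hχb h), map_zero]; rfl
      simp only [hx0, mul_zero, Finset.sum_const_zero]
      simp [indicator, hx0]
  refine ⟨⟨ρ, fun b b' χ hχ hs => ?_⟩, fun R χ => (BundleMeasure.hasIntegral_iff _ χ _).2
    fun 𝔓 => ?_⟩
  · rw [hloc b χ hχ (hs.trans inter_subset_left), hloc b' χ hχ (hs.trans inter_subset_right)]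
  · have hint : ∀ p, IsBddMeas ((K p).indicator fun x =>
        z p * (E R).comp (a p) χ.1 (c p) x) := fun p => by
      refine (IsTestFun.of_continuousOn (U := univ) (K := K p ∩ R.carrier)
        ((hK p).inter R.isCompact) (subset_univ _) ?_ fun x hx => ?_).isBddMeas
      · refine ContinuousOn.congr (f := fun x => z p * (E R).comp (a p) χ.1 (c p) x)
          (continuousOn_const.mul ((CoordBundle.Sec.continuousOn χ (a p) (c p)).mono
            (inter_subset_inter_left _ (hKa p)))) fun x hx => indicator_of_mem hx.1 _
      · by_cases hxK : x ∈ K p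
        · rw [indicator_of_mem hxK, CoordBundle.Sec.comp_eq_zero χ _ _ fun h => hx ⟨hxK, h⟩,
            mul_zero]
        · exact indicator_of_notMem hxK _
    have hu : ∀ i, IsBddMeas (𝔓.u i) := fun i =>
      ⟨(𝔓.u i).continuous.measurable, 1, fun x => by
        rw [abs_of_nonneg (𝔓.u.nonneg i x)]; exact 𝔓.u.le_one i x⟩
    have hmul : ∀ i p, IsBddMeas fun x => 𝔓.u i x * (K p).indicator (fun x =>
        z p * (E R).comp (a p) χ.1 (c p) x) x := fun i p => by
      obtain ⟨C, hC⟩ := (hu i).2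
      obtain ⟨D, hD⟩ := (hint p).2
      refine ⟨(hu i).1.mul (hint p).1, C * D, fun x => ?_⟩
      rw [abs_mul]
      exact mul_le_mul (hC x) (hD x) (abs_nonneg _) ((abs_nonneg _).trans (hC x))
    have h1 : ∀ i, ∑ q, (∫ y, (𝔓.u i ((𝔓.chart i).point y) *
          (E R).comp (𝔓.chart i) χ.1 q ((𝔓.chart i).point y)) ∂(ρ (𝔓.chart i) q).pos -
        ∫ y, (𝔓.u i ((𝔓.chart i).point y) *
          (E R).comp (𝔓.chart i) χ.1 q ((𝔓.chart i).point y)) ∂(ρ (𝔓.chart i) q).neg) =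
        ∑ p, ∫ x, 𝔓.u i x * (K p).indicator (fun x =>
          z p * (E R).comp (a p) χ.1 (c p) x) x ∂μ p := by
      intro i
      refine (hsum (𝔓.chart i) (fun q x => 𝔓.u i x * (E R).comp (𝔓.chart i) χ.1 q x)
        fun q => CoordBundle.Sec.isTestFun χ _ q (𝔓.u i).continuous Subset.rfl
          (𝔓.tsupport_subset i)).trans ?_
      refine Finset.sum_congr rfl fun p _ =>
        integral_congr_ae (Filter.Eventually.of_forall fun x => ?_)
      by_cases hx : x ∈ (𝔓.chart i).dom
      · simp only
        rw [← hHc R χ (𝔓.chart i) p x hx, Finset.mul_sum]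
        exact Finset.sum_congr rfl fun q _ => by ring
      · have : 𝔓.u i x = 0 :=
          image_eq_zero_of_notMem_tsupport fun h => hx (𝔓.tsupport_subset i h)
        simp [this]
    refine (Finset.sum_congr rfl fun i _ => h1 i).trans ?_
    rw [Finset.sum_comm]
    refine Finset.sum_congr rfl fun p _ => ?_
    rw [← integral_finsetSum _ fun i _ => (hmul i p).integrable (μ p),
      ← integral_const_mul, ← integral_indicator (hK p).measurableSet]
    refine integral_congr_ae (Filter.Eventually.of_forall fun x => ?_)
    simp only
    rw [← Finset.sum_mul, 𝔓.sum_eq_one, one_mul]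

end Construction

/-! ### Hahn–Banach extension and Riesz representation -/

section Representation

open scoped CompactlySupported

/-- A positive linear functional on the continuous functions on a compact space is given by a
finite measure. -/
theorem exists_measure_of_nonneg {Z : Type*} [TopologicalSpace Z] [CompactSpace Z] [T2Space Z]
    [MeasurableSpace Z] [BorelSpace Z] (Λ : C(Z, ℝ) →ₗ[ℝ] ℝ) (hΛ : ∀ f, 0 ≤ f → 0 ≤ Λ f) :
    ∃ μ : Measure Z, IsFiniteMeasure μ ∧ ∀ f : C(Z, ℝ), Λ f = ∫ z, f z ∂μ := by
  let Λ' : C_c(Z, ℝ) →ₚ[ℝ] ℝ := PositiveLinearMap.mk₀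
    { toFun := fun f => Λ f.toContinuousMap
      map_add' := fun f g => Λ.map_add f.toContinuousMap g.toContinuousMap
      map_smul' := fun c f => Λ.map_smul c f.toContinuousMap } fun f hf => hΛ _ hf
  refine ⟨RealRMK.rieszMeasure Λ', ⟨isCompact_univ.measure_lt_top⟩, fun f => ?_⟩
  exact (RealRMK.integral_rieszMeasure Λ'
    (CompactlySupportedContinuousMap.continuousMapEquiv f)).symm

/-- A linear functional dominated by the supremum of the positive part of continuous functions is
given by a finite measure. -/
theorem exists_measure_of_le {Z : Type*} [TopologicalSpace Z] [CompactSpace Z] [T2Space Z]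
    [MeasurableSpace Z] [BorelSpace Z] {V : Type*} [AddCommGroup V] [Module ℝ V]
    (L : V →ₗ[ℝ] C(Z, ℝ)) (F : V →ₗ[ℝ] ℝ) {C : ℝ} (hC : 0 ≤ C)
    (hF : ∀ w (M : ℝ), 0 ≤ M → (∀ z, L w z ≤ M) → F w ≤ C * M) :
    ∃ μ : Measure Z, IsFiniteMeasure μ ∧ ∀ w, F w = ∫ z, L w z ∂μ := by
  have hle : ∀ (f : C(Z, ℝ)) z, max (f z) 0 ≤ ‖f ⊔ 0‖ := fun f z =>
    (le_abs_self _).trans ((f ⊔ 0).norm_coe_le_norm z)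
  have hnorm : ∀ (f : C(Z, ℝ)) {M : ℝ}, 0 ≤ M → (∀ z, f z ≤ M) → ‖f ⊔ 0‖ ≤ M := by
    refine fun f M hM h => (ContinuousMap.norm_le _ hM).2 fun z => ?_
    change |max (f z) 0| ≤ M
    rw [abs_of_nonneg (le_max_right _ _)]
    exact max_le (h z) hM
  -- The extension takes place on `V × C(Z)` with the sublinear bound `C ‖(L w + f)⁺‖`, starting
  -- from `F` on `V × 0`. This spares defining `F` on the range of `L`, where well-definedness would
  -- have to be argued first.
  let Φ : V × C(Z, ℝ) →ₗ[ℝ] C(Z, ℝ) := L.coprod LinearMap.id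
  have hN1 : ∀ c : ℝ, 0 < c → ∀ p, C * ‖Φ (c • p) ⊔ 0‖ = c * (C * ‖Φ p ⊔ 0‖) := by
    intro c hc p
    have : Φ (c • p) ⊔ 0 = c • (Φ p ⊔ 0) := by
      ext z
      simp only [map_smul, ContinuousMap.sup_apply, ContinuousMap.smul_apply,
        ContinuousMap.zero_apply, smul_eq_mul]
      rw [mul_max_of_nonneg _ _ hc.le, mul_zero]
    rw [this, norm_smul, Real.norm_of_nonneg hc.le]
    ring
  have hN2 : ∀ p q, C * ‖Φ (p + q) ⊔ 0‖ ≤ C * ‖Φ p ⊔ 0‖ + C * ‖Φ q ⊔ 0‖ := by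
    intro p q
    rw [← mul_add]
    refine mul_le_mul_of_nonneg_left (hnorm _ (by positivity) fun z => ?_) hC
    rw [map_add]
    exact add_le_add ((le_max_left _ _).trans (hle _ z)) ((le_max_left _ _).trans (hle _ z))
  obtain ⟨g, hg, hgN⟩ := exists_extension_of_le_sublinear
    (⟨Submodule.prod ⊤ ⊥, F ∘ₗ LinearMap.fst ℝ V C(Z, ℝ) ∘ₗ Submodule.subtype _⟩ :
      V × C(Z, ℝ) →ₗ.[ℝ] ℝ) (fun p => C * ‖Φ p ⊔ 0‖) hN1 hN2 (by
      rintro ⟨⟨w, f⟩, hp⟩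
      obtain rfl : f = 0 := by simpa using hp
      refine hF w _ (norm_nonneg _) fun z => ?_
      simpa [Φ] using (le_max_left _ _).trans (hle (L w) z))
  -- Bounding by the positive part rather than by the norm makes the extension a positive functional
  -- of `f`.
  have hg0 : ∀ p, (∀ z, Φ p z ≤ 0) → g p ≤ 0 := fun p hp =>
    (hgN p).trans (mul_nonpos_of_nonneg_of_nonpos hC (hnorm _ le_rfl hp))
  obtain ⟨μ, hμ, h⟩ := exists_measure_of_nonneg (g ∘ₗ LinearMap.inr ℝ V C(Z, ℝ)) fun f hf => by
    have := hg0 (-LinearMap.inr ℝ V C(Z, ℝ) f) fun z => by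
      have := hf z
      simpa [Φ] using this
    rw [map_neg] at this
    simpa using this
  refine ⟨μ, hμ, fun w => ?_⟩
  rw [← h]
  have h1 : g (w, 0) = F w := hg ⟨(w, 0), by simp⟩
  -- `Φ` vanishes at `(w, -L w)` and at its negative, so `g` vanishes there, that is, `F w = g (0, L
  -- w)`.
  have h2 : g (w, -L w) ≤ 0 := hg0 _ fun z => by simp [Φ]
  have h3 : g (-(w, -L w)) ≤ 0 := hg0 _ fun z => by simp [Φ]
  have h4 : ((w, -L w) : V × C(Z, ℝ)) = (w, 0) - LinearMap.inr ℝ V C(Z, ℝ) (L w) := by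
    simp
  rw [map_neg] at h3
  rw [h4, map_sub, h1] at h2 h3
  change F w = g (LinearMap.inr ℝ V C(Z, ℝ) (L w))
  linarith

variable {X : Type*} [TopologicalSpace X] [T2Space X] [MeasurableSpace X] [BorelSpace X]

/-- A linear functional dominated by the supremum of the positive parts of finitely many functions
which are continuous on compact sets is a sum of integrals over these sets. -/
theorem exists_measures_of_le {P : Type*} [Fintype P] {K : P → Set X} (hK : ∀ p, IsCompact (K p))
    {V : Type*} [AddCommGroup V] [Module ℝ V] (L : V → P → X → ℝ)
    (hL : ∀ w p, ContinuousOn (L w p) (K p))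
    (hadd : ∀ w w' p, ∀ x ∈ K p, L (w + w') p x = L w p x + L w' p x)
    (hsmul : ∀ (c : ℝ) w p, ∀ x ∈ K p, L (c • w) p x = c * L w p x)
    (F : V →ₗ[ℝ] ℝ) {C : ℝ} (hC : 0 ≤ C)
    (hF : ∀ w (M : ℝ), 0 ≤ M → (∀ p, ∀ x ∈ K p, L w p x ≤ M) → F w ≤ C * M) :
    ∃ μ : P → Measure X, (∀ p, IsFiniteMeasure (μ p)) ∧
      ∀ w, F w = ∑ p, ∫ x in K p, L w p x ∂μ p := by
  classical
  -- On the disjoint union the finitely many functions become one continuous function on a compact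
  -- space, even where the sets `K p` overlap in `X`.
  let Z := Σ p, K p
  have : ∀ p, CompactSpace (K p) := fun p => isCompact_iff_compactSpace.1 (hK p)
  let _ : MeasurableSpace Z := borel Z
  have : BorelSpace Z := ⟨rfl⟩
  let L' : V →ₗ[ℝ] C(Z, ℝ) :=
    { toFun := fun w => ⟨fun z => L w z.1 z.2.1, continuous_sigma fun p =>
        continuousOn_iff_continuous_domRestrict.1 (hL w p)⟩
      map_add' := fun w w' => ContinuousMap.ext fun z => hadd w w' z.1 z.2.1 z.2.2
      map_smul' := fun c w => ContinuousMap.ext fun z => hsmul c w z.1 z.2.1 z.2.2 }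
  obtain ⟨μ, hμ, h⟩ := exists_measure_of_le L' F hC fun w M hM hw =>
    hF w M hM fun p x hx => hw ⟨p, x, hx⟩
  let A : P → Set Z := fun p => range (Sigma.mk p)
  have hA : ∀ p, MeasurableSet (A p) := fun p => isOpen_range_sigmaMk.measurableSet
  have hπ : Measurable fun z : Z => (z.2.1 : X) :=
    (continuous_sigma fun p => continuous_subtype_val).measurable
  -- The part of the measure on the `p`-th summand is pushed forward to `X`.
  refine ⟨fun p => (μ.restrict (A p)).map fun z => z.2.1, fun p => inferInstance, fun w => ?_⟩
  have hAu : (⋃ p, A p) = univ := by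
    refine eq_univ_of_forall fun z => mem_iUnion.2 ⟨z.1, z.2, rfl⟩
  have hAd : Pairwise fun p q => Disjoint (A p) (A q) := by
    intro p q hpq
    refine disjoint_left.2 ?_
    rintro _ ⟨x, rfl⟩ ⟨y, hy⟩
    exact hpq (congrArg Sigma.fst hy).symm
  have hint : Integrable (L' w) μ :=
    (L' w).continuous.integrable_of_hasCompactSupport (HasCompactSupport.of_compactSpace _)
  rw [h w, ← setIntegral_univ, ← hAu, integral_iUnion_fintype hA hAd fun p => hint.integrableOn]
  refine Finset.sum_congr rfl fun p _ => ?_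
  have hm : Measurable ((K p).indicator (L w p)) := by
    rw [← piecewise_eq_indicator]
    exact (hL w p).measurable_piecewise continuousOn_const (hK p).measurableSet
  rw [← integral_indicator (hK p).measurableSet, integral_map hπ.aemeasurable
    hm.aestronglyMeasurable]
  refine setIntegral_congr_fun (hA p) ?_
  rintro _ ⟨x, rfl⟩
  exact (indicator_of_mem x.2 _).symm

end Representation

/-! ### Forces as sums of integrals of partial derivatives -/

section Forces

variable {n m r : ℕ} {X : Type u} [TopologicalSpace X] [ChartedSpace (EuclideanQuadrant n) X]
  {W : X → Type u} [∀ x, AddCommGroup (W x)] [∀ x, Module ℝ (W x)]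
  [TopologicalSpace (TotalSpace (EuclideanSpace ℝ (Fin m)) W)] [∀ x, TopologicalSpace (W x)]
  [FiberBundle (EuclideanSpace ℝ (Fin m)) W] [T2Space X] [MeasurableSpace X] [BorelSpace X]

/-- A force is a sum of integrals of partial derivatives in charts with respect to finite
measures on compact sets. -/
theorem Force.exists_measures {R : Body n X} (F : Force m W R r) :
    ∃ (𝔎 : PrecompactAtlas m W R)
      (μ : Bool × Fin 𝔎.A × JetIdx n r × Fin m → Measure X), (∀ p, IsFiniteMeasure (μ p)) ∧
      ∀ w, F.toLin w = ∑ p, (cond p.1 1 (-1) : ℝ) * ∫ x in 𝔎.K p.2.1,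
        secPd R (𝔎.chart p.2.1) p.2.2.1.2.1 p.2.2.2 w.1 x ∂μ p := by
  obtain ⟨𝔎, C, hC⟩ := F.bounded
  have hr : ∀ p : Bool × Fin 𝔎.A × JetIdx n r × Fin m, (p.2.2.1.1 : ℕ) ≤ r := fun p =>
    Nat.lt_succ_iff.1 p.2.2.1.1.2
  -- The Boolean index doubles each derivative with both signs, since one-sided bounds on both signs
  -- bound the absolute value. `max C 0` replaces the bound `C` of the force, whose sign is not
  -- prescribed.
  have hle : ∀ (w : CrSec m W R r) (M : ℝ), 0 ≤ M →
      (∀ (p : Bool × Fin 𝔎.A × JetIdx n r × Fin m), ∀ x ∈ 𝔎.K p.2.1, (cond p.1 1 (-1) : ℝ) *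
        secPd R (𝔎.chart p.2.1) p.2.2.1.2.1 p.2.2.2 w.1 x ≤ M) →
      F.toLin w ≤ max C 0 * M := by
    intro w M hM hw
    have h1 : 𝔎.crNorm r w ≤ M := by
      refine 𝔎.crNorm_le w hM fun i α k I hk x hx => ?_
      -- The norm runs over all multi-indices, the measures only over the sorted ones.
      have h2 : secPd R (𝔎.chart i) (JetIdx.sort hk I).2.1 α w.1 x =
          secPd R (𝔎.chart i) I α w.1 x :=
        (𝔎.chart i).pd_sort R hk I
          (CoordBundle.Sec.smoothOn (E := baseBundle n m W) w _ α) (𝔎.subset i hx)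
      rw [← h2, abs_le]
      have h3 := hw (true, i, JetIdx.sort hk I, α) x hx
      have h4 := hw (false, i, JetIdx.sort hk I, α) x hx
      simp only [cond_true, cond_false] at h3 h4
      constructor <;> linarith
    refine (le_abs_self _).trans ((hC w).trans ?_)
    refine (mul_le_mul_of_nonneg_right (le_max_left C 0) (𝔎.crNorm_nonneg w)).trans ?_
    exact mul_le_mul_of_nonneg_left h1 (le_max_right C 0)
  obtain ⟨μ, hμ, h⟩ := exists_measures_of_le
    (fun p : Bool × Fin 𝔎.A × JetIdx n r × Fin m => 𝔎.isCompact p.2.1)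
    (fun (w : CrSec m W R r) p x =>
      (cond p.1 1 (-1) : ℝ) * secPd R (𝔎.chart p.2.1) p.2.2.1.2.1 p.2.2.2 w.1 x)
    (fun w p => continuousOn_const.mul
      ((continuousOn_secPd w _ (hr p) _ _).mono (𝔎.subset p.2.1)))
    (fun w w' p x hx => by rw [secPd_add w w' _ (hr p) _ _ (𝔎.subset p.2.1 hx), mul_add])
    (fun c w p x hx => by rw [secPd_smul c w _ (hr p) _ _ (𝔎.subset p.2.1 hx)]; ring)
    F.toLin (le_max_right C 0) hle
  refine ⟨𝔎, μ, hμ, fun w => ?_⟩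
  rw [h w]
  exact Finset.sum_congr rfl fun p _ => integral_const_mul _ _

end Forces

variable {n m r : ℕ} {X : Type u} [TopologicalSpace X] [ChartedSpace (EuclideanQuadrant n) X]
  {W : X → Type u} [∀ x, AddCommGroup (W x)] [∀ x, Module ℝ (W x)]
  [TopologicalSpace (TotalSpace (EuclideanSpace ℝ (Fin m)) W)] [∀ x, TopologicalSpace (W x)]
  [FiberBundle (EuclideanSpace ℝ (Fin m)) W]

/-! ### Coordinate segments and the fundamental theorem of calculus -/

section Segment

/-- Inside each chart there is a segment parallel to a coordinate axis. -/
theorem VBChart.exists_segment (a : VBChart n m W) {x : X} (hx : x ∈ a.dom) (i : Fin n) :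
    ∃ ε > 0, ∀ t ∈ Icc (0 : ℝ) ε, a.ext x + t • EuclideanSpace.single i 1 ∈ a.img univ := by
  have h1 : a.img univ ∈ 𝓝[range (quadrant n)] a.ext x := by
    rw [VBChart.ext, ← a.chart.map_extend_nhds (I := quadrant n) hx.1, img, inter_univ]
    exact Filter.image_mem_map (a.isOpen_dom.mem_nhds hx)
  -- Moving in a positive coordinate direction never leaves the quadrant, so the segment exists at
  -- corner points as well.
  have h2 : Filter.Tendsto (fun t : ℝ => a.ext x + t • EuclideanSpace.single i (1 : ℝ))
      (𝓝[≥] 0) (𝓝[range (quadrant n)] a.ext x) := by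
    refine tendsto_nhdsWithin_iff.2 ⟨?_, ?_⟩
    · have h3 : Continuous fun t : ℝ => a.ext x + t • EuclideanSpace.single i (1 : ℝ) := by
        fun_prop
      have h4 := h3.continuousWithinAt (s := Ici 0) (x := 0)
      rwa [ContinuousWithinAt, zero_smul, add_zero] at h4
    · filter_upwards [self_mem_nhdsWithin] with t ht
      refine ⟨⟨a.ext x + t • EuclideanSpace.single i 1, fun j => ?_⟩, rfl⟩
      have h5 : 0 ≤ a.ext x j := (a.chart x).2 j
      have h6 : (0 : ℝ) ≤ t * (EuclideanSpace.single i (1 : ℝ) : EuclideanSpace ℝ (Fin n)) j := by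
        refine mul_nonneg ht ?_
        rw [PiLp.single_apply]
        split_ifs <;> simp
      exact add_nonneg h5 h6
  obtain ⟨ε, hε, h⟩ := mem_nhdsGE_iff_exists_Icc_subset.1 (h2 h1)
  exact ⟨ε, hε, h⟩

/-- The fundamental theorem of calculus along a segment parallel to a coordinate axis. -/
theorem VBChart.integral_dpd [CompactSpace X] [IsManifold (quadrant n) ∞ X] (a : VBChart n m W)
    {f : X → ℝ} (hf : SmoothOn n (1 : ℕ) f (a.dom ∩ (Body.whole n X).carrier))
    {y : EuclideanSpace ℝ (Fin n)} (i : Fin n) {ε : ℝ} (hε : 0 ≤ ε)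
    (hy : ∀ t ∈ Icc (0 : ℝ) ε, y + t • EuclideanSpace.single i 1 ∈ a.img univ) :
    ∫ t in (0 : ℝ)..ε,
        a.pd univ (fun _ : Fin 1 => i) f (a.inv (y + t • EuclideanSpace.single i 1)) =
      f (a.inv (y + ε • EuclideanSpace.single i 1)) - f (a.inv y) := by
  set γ : ℝ → EuclideanSpace ℝ (Fin n) := fun t => y + t • EuclideanSpace.single i 1 with hγ
  have hγc : Continuous γ := by fun_prop
  have hfc : ContDiffOn ℝ 1 (f ∘ a.inv) (a.img univ) :=
    (a.smoothOn_iff (k := (1 : ℕ)) (by exact_mod_cast le_top)).1 hf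
  have hpd : ∀ t ∈ Icc 0 ε, a.pd univ (fun _ : Fin 1 => i) f (a.inv (γ t)) =
      fderivWithin ℝ (f ∘ a.inv) (a.img univ) (γ t) (EuclideanSpace.single i 1) := by
    intro t ht
    refine (a.pd_one (Body.whole n X) hf (a.inv_mem (hy t ht)) _).trans ?_
    change a.dpd univ i f _ = _
    rw [dpd, a.ext_inv (hy t ht)]
  have hcont : ContinuousOn (fun t => fderivWithin ℝ (f ∘ a.inv) (a.img univ) (γ t)
      (EuclideanSpace.single i 1)) (Icc 0 ε) :=
    ((hfc.continuousOn_fderivWithin (a.uniqueDiffOn_img (Body.whole n X)) le_rfl).comp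
      hγc.continuousOn hy).clm_apply continuousOn_const
  rw [intervalIntegral.integral_congr (g := fun t => fderivWithin ℝ (f ∘ a.inv) (a.img univ) (γ t)
    (EuclideanSpace.single i 1)) fun t ht => hpd t (by rwa [uIcc_of_le hε] at ht)]
  rw [intervalIntegral.integral_eq_sub_of_hasDerivAt_of_le (f := fun t => (f ∘ a.inv) (γ t)) hε
    (hfc.continuousOn.comp hγc.continuousOn hy) (fun t ht => ?_)
    (hcont.intervalIntegrable_of_Icc hε)]
  · simp [hγ]
  · have h1 := (hfc.differentiableOn one_ne_zero _
      (hy t (Ioo_subset_Icc_self ht))).hasFDerivWithinAt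
    have h2 : HasDerivWithinAt γ (EuclideanSpace.single i 1) (Icc 0 ε) t := by
      have := ((hasDerivAt_id t).smul_const (EuclideanSpace.single i (1 : ℝ))).const_add y
      rw [one_smul] at this
      exact this.hasDerivWithinAt
    -- Although the image may be entered at a boundary point, the one-variable function is two-sided
    -- differentiable at interior parameters.
    exact (h1.comp_hasDerivWithinAt t h2 hy).hasDerivAt (Icc_mem_nhds ht.1 ht.2)

end Segment

/-! ### Non-uniqueness and the existence of stress measures -/

variable [CompactSpace X] [T2Space X] [MeasurableSpace X] [BorelSpace X]
  [IsManifold (quadrant n) ∞ X] {ι : Type} [Fintype ι]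
  {E : Body n X → CoordBundle n m W ι} {T : VBChart n m W → VBChart n m W → X → ι → ι → ℝ}

/-- The sum of two bundle measures. -/
theorem BundleMeasure.exists_add {E₀ : CoordBundle n m W ι} (ς τ : BundleMeasure E₀) :
    ∃ σ : BundleMeasure E₀, ∀ (R : Body n X) (E₁ : CoordBundle n m W ι) (χ : E₁.Sec R 0) (u v : ℝ),
      ς.HasIntegral R χ u → τ.HasIntegral R χ v → σ.HasIntegral R χ (u + v) := by
  have hloc : ∀ a : VBChart n m W, LocallyCompactSpace (a.img univ) := fun a =>
    a.locallyCompactSpace_img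
  have hfin : ∀ {a : VBChart n m W} (μ ν : Measure (a.img univ)) [IsFiniteMeasureOnCompacts μ]
      [IsFiniteMeasureOnCompacts ν], IsFiniteMeasureOnCompacts (μ + ν) := fun μ ν => ⟨fun K hK => by
    rw [Measure.add_apply]
    exact ENNReal.add_lt_top.2 ⟨hK.measure_lt_top, hK.measure_lt_top⟩⟩
  -- Sums of Jordan parts need not be mutually singular, so each local component is decomposed anew.
  choose ρ hρ using fun (a : VBChart n m W) (c : ι) => RealRadonMeasure.exists_sub
    ((ς.meas a c).pos + (τ.meas a c).pos) ((ς.meas a c).neg + (τ.meas a c).neg)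
  have key : ∀ a c f, IsTestFun a.dom f →
      ∫ y, f (a.point y) ∂(ρ a c).pos - ∫ y, f (a.point y) ∂(ρ a c).neg =
        ς.int a c f + τ.int a c f := by
    intro a c f hf
    rw [(hρ a c).2.2 _ (a.integrable_point _ hf) (a.integrable_point _ hf),
      integral_add_measure (a.integrable_point _ hf) (a.integrable_point _ hf),
      integral_add_measure (a.integrable_point _ hf) (a.integrable_point _ hf), int, int]
    ring
  have htest : ∀ (a : VBChart n m W) (c : ι), ∀ χ ∈ E₀.Sec (Body.whole n X) 0,
      closure {x | χ x ≠ 0} ⊆ a.dom → IsTestFun a.dom (E₀.comp a χ c) := by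
    intro a c χ hχ hχa
    refine IsTestFun.of_continuousOn isClosed_closure.isCompact hχa ?_ fun x hx => ?_
    · exact (CoordBundle.Sec.continuousOn ⟨χ, hχ⟩ a c).mono fun x hx => ⟨hχa hx, mem_univ x⟩
    · rw [CoordBundle.comp, not_not.1 fun h => hx (subset_closure h), map_zero]
      rfl
  have hsum : ∀ (a : VBChart n m W), ∀ χ ∈ E₀.Sec (Body.whole n X) 0,
      closure {x | χ x ≠ 0} ⊆ a.dom →
      ∑ c, (ρ a c).integralOn univ (fun y => E₀.rep a χ y c) =
        ∑ c, (ς.meas a c).integralOn univ (fun y => E₀.rep a χ y c) +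
          ∑ c, (τ.meas a c).integralOn univ (fun y => E₀.rep a χ y c) := by
    intro a χ hχ hχa
    rw [← Finset.sum_add_distrib]
    refine Finset.sum_congr rfl fun c _ => ?_
    rw [ς.integralOn_univ_rep, τ.integralOn_univ_rep, ← key a c _ (htest a c χ hχ hχa)]
    simp only [RealRadonMeasure.integralOn, Measure.restrict_univ]
    rfl
  refine ⟨⟨ρ, fun a b χ hχ hs => ?_⟩, fun R E₁ χ u v hu hv =>
    (BundleMeasure.hasIntegral_iff _ χ _).2 fun 𝔓 => ?_⟩
  · rw [hsum a χ hχ (hs.trans inter_subset_left), hsum b χ hχ (hs.trans inter_subset_right),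
      ς.compat a b χ hχ hs, τ.compat a b χ hχ hs]
  · rw [← (ς.hasIntegral_iff χ u).1 hu 𝔓, ← (τ.hasIntegral_iff χ v).1 hv 𝔓]
    simp only [glued, ← Finset.sum_add_distrib]
    exact Finset.sum_congr rfl fun i _ => Finset.sum_congr rfl fun c _ => key _ _ _
      (CoordBundle.Sec.isTestFun χ _ c (𝔓.u i).continuous Subset.rfl (𝔓.tsupport_subset i))

variable [VectorBundle ℝ (EuclideanSpace ℝ (Fin m)) W]
  [ContMDiffVectorBundle ∞ (EuclideanSpace ℝ (Fin m)) W (quadrant n)]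

/-- `HasIntegral` quantifies over all partitioned atlases. The value is unique because at least one
exists. -/
theorem BundleMeasure.HasIntegral.unique {E₀ E₁ : CoordBundle n m W ι} {ς : BundleMeasure E₀}
    {R : Body n X} {χ : E₁.Sec R 0} {u v : ℝ} (hu : ς.HasIntegral R χ u)
    (hv : ς.HasIntegral R χ v) : u = v := by
  obtain ⟨𝔓⟩ := PartitionedAtlas.nonempty (n := n) (m := m) (W := W)
  exact (hu 𝔓).2.symm.trans (hv 𝔓).2

/-- If two components of a differential operator are a function and one of its first derivatives,
then there is a nonzero bundle measure which annihilates the range of the operator. -/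
theorem IsTame.exists_null (hE : IsTame E T) [Nonempty X] (hr : 1 ≤ r)
    (D : CrSec m W (Body.whole n X) r → (E (Body.whole n X)).Sec (Body.whole n X) 0)
    (i : Fin n) (α : Fin m) (θ₁ θ₀ : ι)
    (h₁ : ∀ w (a : VBChart n m W), ∀ x ∈ a.dom, (E (Body.whole n X)).comp a (D w).1 θ₁ x =
      secPd (Body.whole n X) a (fun _ : Fin 1 => i) α w.1 x)
    (h₀ : ∀ w (a : VBChart n m W), ∀ x ∈ a.dom, (E (Body.whole n X)).comp a (D w).1 θ₀ x =
      (baseBundle n m W).comp a w.1 α x) :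
    ∃ τ : BundleMeasure (E (Body.whole n X)),
      (∀ w, τ.HasIntegral (Body.whole n X) (D w) 0) ∧
      ∃ (χ : (E (Body.whole n X)).Sec (Body.whole n X) 0) (v : ℝ), v ≠ 0 ∧
        τ.HasIntegral (Body.whole n X) χ v := by
  classical
  obtain ⟨x₀⟩ := ‹Nonempty X›
  set a := VBChart.atPoint n m W x₀
  have hx₀ : x₀ ∈ a.dom := VBChart.mem_dom_atPoint x₀
  obtain ⟨ε, hε, hseg⟩ := a.exists_segment hx₀ i
  set y := a.ext x₀
  set γ : ℝ → X := fun t => a.inv (y + t • EuclideanSpace.single i 1) with hγ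
  have hγa : ∀ t ∈ Icc 0 ε, γ t ∈ a.dom := fun t ht => (a.inv_mem (hseg t ht)).1
  have hline : Continuous fun t : ℝ => y + t • EuclideanSpace.single i (1 : ℝ) := by fun_prop
  have hγc : ContinuousOn γ (Icc 0 ε) := (a.continuousOn_inv univ).comp hline.continuousOn hseg
  have hinj : InjOn γ (Icc 0 ε) := by
    intro s hs t ht hst
    have h1 := congrArg a.ext hst
    rw [hγ, a.ext_inv (hseg s hs), a.ext_inv (hseg t ht)] at h1
    have h2 := congrArg (fun z : EuclideanSpace ℝ (Fin n) => z i) h1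
    simpa using h2
  have hl : (0 : ℝ) ∈ Icc 0 ε := left_mem_Icc.2 hε.le
  have hu : ε ∈ Icc 0 ε := right_mem_Icc.2 hε.le
  have hmid : ε / 2 ∈ Icc 0 ε := ⟨by positivity, by linarith⟩
  set S := γ '' Icc 0 ε with hS
  have hSc : IsCompact S := isCompact_Icc.image_of_continuousOn hγc
  -- The functional is `∫ χ^{θ₁}(γ t) dt - χ^{θ₀}(γ ε) + χ^{θ₀}(γ 0)`, with one measure for each
  -- term and signs `1, -1, 1`. On the range of `D` it vanishes by the fundamental theorem of
  -- calculus.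
  set μ : Fin 3 → Measure X :=
    ![(volume.restrict (Icc 0 ε)).map γ, Measure.dirac (γ ε), Measure.dirac (γ 0)] with hμ
  have hγm : AEMeasurable γ (volume.restrict (Icc 0 ε)) := hγc.aemeasurable measurableSet_Icc
  have : ∀ p, IsFiniteMeasure (μ p) := by
    intro p
    fin_cases p <;> simp only [hμ] <;> dsimp <;> infer_instance
  obtain ⟨τ, hτ⟩ := hE.exists_bundleMeasure (P := Fin 3) (fun _ => a)
    (K := ![S, {γ ε}, {γ 0}])
    (fun p => by fin_cases p; exacts [hSc, isCompact_singleton, isCompact_singleton])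
    (fun p => by
      fin_cases p
      exacts [image_subset_iff.2 hγa, singleton_subset_iff.2 (hγa ε hu),
        singleton_subset_iff.2 (hγa 0 hl)]) μ ![1, -1, 1] ![θ₁, θ₀, θ₀]
  have hval : ∀ χ : (E (Body.whole n X)).Sec (Body.whole n X) 0, τ.HasIntegral (Body.whole n X) χ
      ((∫ t in (0 : ℝ)..ε, (E (Body.whole n X)).comp a χ.1 θ₁ (γ t)) -
        (E (Body.whole n X)).comp a χ.1 θ₀ (γ ε) + (E (Body.whole n X)).comp a χ.1 θ₀ (γ 0)) := by
    intro χ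
    have hχ : ContinuousOn ((E (Body.whole n X)).comp a χ.1 θ₁) S :=
      (CoordBundle.Sec.continuousOn χ a θ₁).mono fun x hx =>
        ⟨image_subset_iff.2 hγa hx, mem_univ x⟩
    have hm : Measurable (S.indicator ((E (Body.whole n X)).comp a χ.1 θ₁)) := by
      rw [← piecewise_eq_indicator]
      exact hχ.measurable_piecewise continuousOn_const hSc.measurableSet
    have h1 : ∫ x in S, (E (Body.whole n X)).comp a χ.1 θ₁ x ∂(volume.restrict (Icc 0 ε)).map γ =
        ∫ t in (0 : ℝ)..ε, (E (Body.whole n X)).comp a χ.1 θ₁ (γ t) := by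
      rw [← integral_indicator hSc.measurableSet, integral_map hγm hm.aestronglyMeasurable,
        intervalIntegral.integral_of_le hε.le, ← integral_Icc_eq_integral_Ioc]
      exact setIntegral_congr_fun measurableSet_Icc fun t ht =>
        indicator_of_mem (mem_image_of_mem γ ht) _
    have h2 := hτ (Body.whole n X) χ
    rw [Fin.sum_univ_three] at h2
    simp only [hμ] at h2
    dsimp at h2
    rw [h1, integral_singleton, integral_singleton] at h2
    simpa [sub_eq_add_neg, measureReal_def] using h2
  refine ⟨τ, fun w => ?_, ?_⟩
  · have hw : SmoothOn n (r : ℕ) ((baseBundle n m W).comp a w.1 α)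
        (a.dom ∩ (Body.whole n X).carrier) :=
      CoordBundle.Sec.smoothOn (E := baseBundle n m W) w a α
    have h1 := a.integral_dpd (hw.of_le (by exact_mod_cast hr)) i hε.le hseg
    have h2 := hval (D w)
    rw [intervalIntegral.integral_congr (g := fun t => a.pd univ (fun _ : Fin 1 => i)
      ((baseBundle n m W).comp a w.1 α) (γ t)) (fun t ht =>
        h₁ w a _ (hγa t (by rwa [uIcc_of_le hε.le] at ht))), h1, h₀ w a _ (hγa ε hu),
      h₀ w a _ (hγa 0 hl)] at h2
    simpa [hγ] using h2
  -- A section all of whose components equal a bump around the midpoint that vanishes at both ends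
  -- leaves only the line integral, which is positive.
  · have hU : a.dom \ {γ 0, γ ε} ∈ 𝓝 (γ (ε / 2)) := by
      refine (a.isOpen_dom.sdiff (Set.toFinite _).isClosed).mem_nhds ⟨hγa _ hmid, ?_⟩
      rintro (h | h)
      · exact absurd (hinj hmid hl h) (by positivity)
      · exact absurd (hinj hmid hu h) (by linarith)
    obtain ⟨ρ, C, hC, hCU, hρ, hρ1, hρ0, hρI⟩ := exists_bump (n := n) _ hU
    obtain ⟨s, hs, hsρ, -⟩ := hE.exists_sec (Body.whole n X) a (k := 0) (fun x _ => ρ x) hC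
      (hCU.trans sdiff_subset) (fun x hx => funext fun _ => hρ0 x hx)
      fun _ => (hρ.mono (subset_univ _)).of_le (by simp)
    refine ⟨⟨s, hs⟩, _, ?_, hval ⟨s, hs⟩⟩
    have hsρ' : ∀ t ∈ Icc 0 ε, ∀ c, (E (Body.whole n X)).comp a s c (γ t) = ρ (γ t) :=
      fun t ht c => hsρ _ ⟨hγa t ht, mem_univ _⟩ c
    have h0 : ρ (γ 0) = 0 := hρ0 _ fun h => (hCU h).2 (by simp)
    have h1 : ρ (γ ε) = 0 := hρ0 _ fun h => (hCU h).2 (by simp)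
    simp only
    rw [hsρ' _ hl, hsρ' _ hu, h0, h1, sub_zero, add_zero,
      intervalIntegral.integral_congr (g := fun t => ρ (γ t))
        fun t ht => hsρ' t (by rwa [uIcc_of_le hε.le] at ht) _]
    refine (intervalIntegral.integral_pos hε ?_ (fun t _ => (hρI _).1)
      ⟨ε / 2, hmid, by rw [hρ1.self_of_nhds]; exact one_pos⟩).ne'
    exact hρ.continuousOn.comp hγc fun _ _ => mem_univ _

/-- A bundle measure representing a functional by means of a differential operator which has a
function and one of its first derivatives among its components is not unique. -/
theorem IsTame.exists_ne (hE : IsTame E T) [Nonempty X] (hr : 1 ≤ r)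
    (D : CrSec m W (Body.whole n X) r → (E (Body.whole n X)).Sec (Body.whole n X) 0)
    (i : Fin n) (α : Fin m) (θ₁ θ₀ : ι)
    (h₁ : ∀ w (a : VBChart n m W), ∀ x ∈ a.dom, (E (Body.whole n X)).comp a (D w).1 θ₁ x =
      secPd (Body.whole n X) a (fun _ : Fin 1 => i) α w.1 x)
    (h₀ : ∀ w (a : VBChart n m W), ∀ x ∈ a.dom, (E (Body.whole n X)).comp a (D w).1 θ₀ x =
      (baseBundle n m W).comp a w.1 α x)
    (ς : BundleMeasure (E (Body.whole n X))) {F : CrSec m W (Body.whole n X) r → ℝ}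
    (hς : ∀ w, ς.HasIntegral (Body.whole n X) (D w) (F w)) :
    ∃ ς', ς' ≠ ς ∧ ∀ w, ς'.HasIntegral (Body.whole n X) (D w) (F w) := by
  obtain ⟨τ, hτ, χ, v, hv, hχ⟩ := hE.exists_null hr D i α θ₁ θ₀ h₁ h₀
  obtain ⟨σ, hσ⟩ := ς.exists_add τ
  obtain ⟨𝔓⟩ := PartitionedAtlas.nonempty (n := n) (m := m) (W := W)
  refine ⟨σ, ?_, fun w => by simpa using hσ _ _ _ _ _ (hς w) (hτ w)⟩
  -- If adding `τ` changed nothing, the integral of `χ` would equal itself plus `v ≠ 0`.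
  rintro rfl
  have h1 := hE.hasIntegral_glued σ χ 𝔓
  exact hv (by simpa using (hσ _ _ χ _ _ h1 hχ).unique h1)

/-- A force is represented by a hyper-stress measure and by a non-holonomic stress measure which
have the same integrals over all bodies. -/
theorem Force.exists_stress (F : Force m W (Body.whole n X) r) :
    ∃ (ς : HyperStressMeasure n m W r) (ςh : NonholonomicStressMeasure n m W r),
      ς.Represents F ∧ ∀ (R : Body n X) (w : CrSec m W R r), ∃ v,
        ς.HasIntegral R (jet R r w) v ∧ ςh.HasIntegral R (iterJet R r w) v := by
  obtain ⟨T, hT⟩ := exists_isTame_jetB (n := n) (m := m) (W := W) r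
  obtain ⟨T', hT'⟩ := exists_isTame_iterJetB (n := n) (m := m) (W := W) r
  obtain ⟨𝔎, μ, hμ, hF⟩ := F.exists_measures
  -- `θ q` is a coordinate of the iterated jet showing the same partial derivative as the jet
  -- coordinate `q`. Both stress measures use the same scalar measures and signs and differ only in
  -- this component.
  choose θ hθ using fun q : JetIdx n r × Fin m => exists_iterJet_coord (X := X) (W := W) r
    (Nat.lt_succ_iff.1 q.1.1.2) q.1.2.1 q.2
  have hKa : ∀ p : Bool × Fin 𝔎.A × JetIdx n r × Fin m,
      𝔎.K p.2.1 ⊆ (𝔎.chart p.2.1).dom := fun p => (𝔎.subset p.2.1).trans inter_subset_left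
  obtain ⟨ς, hς⟩ := hT.exists_bundleMeasure (fun p => 𝔎.chart p.2.1)
    (fun p => 𝔎.isCompact p.2.1) hKa μ (fun p => cond p.1 1 (-1)) fun p => p.2.2
  obtain ⟨ςh, hςh⟩ := hT'.exists_bundleMeasure (fun p => 𝔎.chart p.2.1)
    (fun p => 𝔎.isCompact p.2.1) hKa μ (fun p => cond p.1 1 (-1)) fun p => θ p.2.2
  refine ⟨ς, ςh, fun w => ?_, fun R w => ⟨_, hς R _, ?_⟩⟩
  · rw [hF w]
    convert! hς _ (jet (Body.whole n X) r w) using 1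
    refine Finset.sum_congr rfl fun p _ => ?_
    congr 1
    refine setIntegral_congr_fun (𝔎.isCompact _).measurableSet fun x hx => ?_
    exact (comp_jet _ r w _ (𝔎.subset _ hx) p.2.2).symm
  · convert! hςh R (iterJet R r w) using 1
    refine Finset.sum_congr rfl fun p _ => ?_
    congr 1
    refine setIntegral_congr_fun (𝔎.isCompact _).measurableSet fun x hx => ?_
    -- The integrands agree on `R` by the choice of `θ`, and off `R` both are zero by the convention
    -- on sections over `R`.
    by_cases hxR : x ∈ R.carrier
    · exact (comp_jet R r w _ ⟨hKa p hx, hxR⟩ p.2.2).trans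
        (hθ p.2.2 R (by simp) w _ x ⟨hKa p hx, hxR⟩).symm
    · exact (CoordBundle.Sec.comp_eq_zero (jet R r w) _ _ hxR).trans
        (CoordBundle.Sec.comp_eq_zero (iterJet R r w) _ _ hxR).symm

end GlobalStress

end

/-! ### The main theorem -/

open GlobalStress in
theorem mainTheorem4 {n m r : ℕ} {X : Type u} [TopologicalSpace X]
    [ChartedSpace (EuclideanQuadrant n) X] [IsManifold (quadrant n) ∞ X] [CompactSpace X] [T2Space X]
    {W : X → Type u} [∀ x, AddCommGroup (W x)] [∀ x, Module ℝ (W x)]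
    [TopologicalSpace (TotalSpace (EuclideanSpace ℝ (Fin m)) W)] [∀ x, TopologicalSpace (W x)]
    [FiberBundle (EuclideanSpace ℝ (Fin m)) W] [VectorBundle ℝ (EuclideanSpace ℝ (Fin m)) W]
    [ContMDiffVectorBundle ∞ (EuclideanSpace ℝ (Fin m)) W (quadrant n)] :
    -- every force is represented by a hyper-stress measure and by a non-holonomic stress measure,
    -- which moreover induce the same force system on the sub-bodies
    (∀ F : Force m W (Body.whole n X) r,
      ∃ (ς : HyperStressMeasure n m W r) (ςh : NonholonomicStressMeasure n m W r),
        ς.Represents F ∧ ςh.Represents F ∧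
        ∃ 𝓕 : ∀ R : Body n X, Force m W R r, ∀ (R : Body n X) (w : CrSec m W R r),
          ς.HasIntegral R (jet R r w) ((𝓕 R).toLin w) ∧
          ςh.HasIntegral R (iterJet R r w) ((𝓕 R).toLin w)) ∧
    -- the representing measures are never unique, except in the degenerate cases
    (1 ≤ r → 1 ≤ n → 1 ≤ m → Nonempty X → ∀ F : Force m W (Body.whole n X) r,
      (∀ ς : HyperStressMeasure n m W r, ς.Represents F → ∃ ς', ς' ≠ ς ∧ ς'.Represents F) ∧
      (∀ ςh : NonholonomicStressMeasure n m W r, ςh.Represents F →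
        ∃ ςh', ςh' ≠ ςh ∧ ςh'.Represents F)) ∧
    -- the glued integral of continuous sections is well defined, and every hyper-stress measure
    -- and every non-holonomic stress measure induces a system of forces on the sub-bodies
    (∀ ς : HyperStressMeasure n m W r,
      (∀ (R : Body n X) (χ : (jetB m W R r).Sec R 0), ∃ v, ς.HasIntegral R χ v) ∧
      ∃ 𝓕 : ∀ R : Body n X, Force m W R r, ∀ (R : Body n X) (w : CrSec m W R r),
        ς.HasIntegral R (jet R r w) ((𝓕 R).toLin w)) ∧
    (∀ ςh : NonholonomicStressMeasure n m W r,
      (∀ (R : Body n X) (χ : (iterJetB m W R r).Sec R 0), ∃ v, ςh.HasIntegral R χ v) ∧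
      ∃ 𝓕 : ∀ R : Body n X, Force m W R r, ∀ (R : Body n X) (w : CrSec m W R r),
        ςh.HasIntegral R (iterJet R r w) ((𝓕 R).toLin w)) := by
  -- The Borel structure on `X` is auxiliary: the measures in the statement live on chart images.
  let _ : MeasurableSpace X := borel X
  have : BorelSpace X := ⟨rfl⟩
  obtain ⟨T, hT⟩ := exists_isTame_jetB (n := n) (m := m) (X := X) (W := W) r
  obtain ⟨T', hT'⟩ := exists_isTame_iterJetB (n := n) (m := m) (X := X) (W := W) r
  obtain ⟨𝔓⟩ := PartitionedAtlas.nonempty (n := n) (m := m) (W := W)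
  have hforce : ∀ (ς : HyperStressMeasure n m W r) (R : Body n X),
      ∃ F : Force m W R r, ∀ w, ς.HasIntegral R (jet R r w) (F.toLin w) := fun ς R =>
    hT.exists_force ς (jet R r) fun p => ⟨_, p.1.2.1, p.2, Nat.lt_succ_iff.1 p.1.1.2,
      fun w a x hx => comp_jet R r w a hx p⟩
  have hforce' : ∀ (ς : NonholonomicStressMeasure n m W r) (R : Body n X),
      ∃ F : Force m W R r, ∀ w, ς.HasIntegral R (iterJet R r w) (F.toLin w) := fun ς R =>
    hT'.exists_force ς (iterJet R r) fun θ => by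
      obtain ⟨k, I, α, hk, h⟩ := iterJet_coord_eq_pd (X := X) (W := W) r θ
      exact ⟨k, I, α, hk, fun w a x hx => h R (by simp) w a x hx⟩
  refine ⟨fun F => ?_, fun hr hn hm _ F => ⟨fun ς hς => ?_, fun ς hς => ?_⟩, fun ς => ⟨?_, ?_⟩,
    fun ς => ⟨?_, ?_⟩⟩
  · obtain ⟨ς, ςh, hς, h⟩ := F.exists_stress
    choose 𝓕 h𝓕 using hforce ς
    -- The two measures share some value for each body and section. By uniqueness of the integral it
    -- is the value of the force system of `ς`, which therefore serves both.
    have hh : ∀ (R : Body n X) (w : CrSec m W R r) v, ς.HasIntegral R (jet R r w) v →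
        ςh.HasIntegral R (iterJet R r w) v := by
      intro R w v hv
      obtain ⟨v', h1, h2⟩ := h R w
      rwa [hv.unique h1]
    exact ⟨ς, ςh, hς, fun w => hh _ w _ (hς w), 𝓕, fun R w => ⟨h𝓕 R w, hh R w _ (h𝓕 R w)⟩⟩
  · refine hT.exists_ne hr (jet (Body.whole n X) r) ⟨0, hn⟩ ⟨0, hm⟩
      (⟨⟨1, by omega⟩, fun _ => ⟨0, hn⟩, monotone_const⟩, ⟨0, hm⟩)
      (⟨⟨0, by omega⟩, Fin.elim0, fun i => i.elim0⟩, ⟨0, hm⟩) (fun w a x hx => ?_)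
      (fun w a x hx => ?_) ς hς
    · exact comp_jet _ r w a ⟨hx, mem_univ x⟩ _
    · exact (comp_jet _ r w a ⟨hx, mem_univ x⟩ _).trans (a.pd_zero _ _ _ hx)
  · obtain ⟨θ₁, h₁⟩ := exists_iterJet_coord (X := X) (W := W) r hr (fun _ : Fin 1 => ⟨0, hn⟩)
      ⟨0, hm⟩
    obtain ⟨θ₀, h₀⟩ := exists_iterJet_coord (X := X) (W := W) r (Nat.zero_le r)
      (Fin.elim0 : Fin 0 → Fin n) ⟨0, hm⟩
    refine hT'.exists_ne hr (iterJet (Body.whole n X) r) ⟨0, hn⟩ ⟨0, hm⟩ θ₁ θ₀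
      (fun w a x hx => ?_) (fun w a x hx => ?_) ς hς
    · exact h₁ _ (by simp) w a x ⟨hx, mem_univ x⟩
    · exact (h₀ _ (by simp) w a x ⟨hx, mem_univ x⟩).trans (a.pd_zero _ _ _ hx)
  · exact fun (R : Body n X) χ => ⟨_, hT.hasIntegral_glued ς χ 𝔓⟩
  · choose 𝓕 h𝓕 using hforce ς
    exact ⟨𝓕, h𝓕⟩
  · exact fun (R : Body n X) χ => ⟨_, hT'.hasIntegral_glued ς χ 𝔓⟩
  · choose 𝓕 h𝓕 using hforce' ς
    exact ⟨𝓕, h𝓕⟩
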